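/- Fix a real number $q$ with $0<q<1$ and write $(a)_\infty=\prod_{i=0}^\infty(1-q^ia)$, $(a)_N=\prod_{i=0}^{N-1}(1-q^ia)$ for $N\in\mathbb{Z}_{\ge 0}$, and $\theta(a)=(a)_\infty(q/a)_\infty$. For $a,b\in\mathbb{C}^*$ put $$\int_0^{a\infty}f(z)\,d_qz=(1-q)\sum_{\nu=-\infty}^{\infty}f(aq^\nu)\,aq^\nu,\qquad \int_{a\infty}^{b\infty}f(z)\,d_qz=\int_0^{b\infty}f(z)\,d_qz-\int_0^{a\infty}f(z)\,d_qz .$$ Let $n$ and $\tau$ be positive integers, $t=q^\tau$, and let $a_1,a_2,b_1,b_2\in\mathbb{C}$ satisfy $q<|a_1a_2b_1b_2t^{2i-2}|$ for $i=1,\dots,n$. Let $x_1,x_2\in\mathbb{C}^*$ be such that $x_ib_jq^m\neq 1$ for all $m\in\mathbb{Z}$ and $i,j\in\{1,2\}$. Let $$F(z)=\prod_{i=1}^n z_i^{(n-1)\tau}\frac{(qa_1^{-1}z_i)_\infty}{(b_1z_i)_\infty}\frac{(qa_2^{-1}z_i)_\infty}{(b_2z_i)_\infty}\prod_{1\le j<k\le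 n}(z_j/z_k)_\tau(z_k/z_j)_\tau .$$ Then, for every $y\in\{x_1,x_2\}^n$, the series $\sum_{\nu\in\mathbb{Z}^n}F(y_1q^{\nu_1},\dots,y_nq^{\nu_n})\prod_{i=1}^n y_iq^{\nu_i}$ converges absolutely, and $$\frac1{n!}\int_{x_1\infty}^{x_2\infty}\!\!\cdots\int_{x_1\infty}^{x_2\infty}F(z)\,d_qz_1\cdots d_qz_n =C_0\prod_{j=1}^n\frac{(x_1x_2q^{(j-1)\tau})^{(n-j)\tau}\,x_2\,\theta(x_1/x_2)\,\theta(x_1x_2b_1b_2q^{(n+j-2)\tau})}{\theta(x_1b_1q^{(j-1)\tau})\,\theta(x_1b_2q^{(j-1)\tau})\,\theta(x_2b_1q^{(j-1)\tau})\,\theta(x_2b_2q^{(j-1)\tau})},$$ where $$C_0=(1-q)^n\prod_{k=1}^n\frac{(q)_\infty(t)_\infty\prod_{i=1}^2\prod_{j=1}^2(qa_i^{-1}b_j^{-1}t^{-(k-1)})_\infty}{(t^k)_\infty(qa_1^{-1}a_2^{-1}b_1^{-1}b_2^{-1}t^{-(n+k-2)})_\infty}.$$ -/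

import Mathlib

namespace AskeyEvans

noncomputable section

/-- The infinite `q`-shifted factorial `(a)_∞ = ∏_{i ≥ 0} (1 - q^i a)`. -/
def qInf (q a : ℂ) : ℂ := ∏' i : ℕ, (1 - q ^ i * a)

/-- The finite `q`-shifted factorial `(a)_N = (1 - a)(1 - q a)⋯(1 - q^{N-1} a)`, which is the
quotient `(a)_∞ / (q^N a)_∞` (continued to its removable singularities), see
`qFin_eq_div`. -/
def qFin (q a : ℂ) (N : ℕ) : ℂ := ∏ i ∈ Finset.range N, (1 - q ^ i * a)

theorem qFin_mul_qInf {q : ℂ} (hq : ‖q‖ < 1) (a : ℂ) (N : ℕ) :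
    qFin q a N * qInf q (q ^ N * a) = qInf q a := by
  have hm : ∀ c : ℂ, Multipliable fun i : ℕ => 1 - q ^ i * c := by
    intro c
    have hs : Summable fun i : ℕ => ‖-(q ^ i * c)‖ := by
      simp only [norm_neg, norm_mul, norm_pow]
      exact (summable_geometric_of_lt_one (norm_nonneg q) hq).mul_right _
    simpa [sub_eq_add_neg] using multipliable_one_add_of_summable hs
  have h := Multipliable.prod_mul_tprod_nat_mul' (f := fun i : ℕ => 1 - q ^ i * a) (k := N)
    (by simpa [pow_add, mul_assoc] using hm (q ^ N * a))
  simpa [qFin, qInf, pow_add, mul_assoc] using h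

theorem qFin_eq_div {q : ℂ} (hq : ‖q‖ < 1) (a : ℂ) (N : ℕ) (h : qInf q (q ^ N * a) ≠ 0) :
    qFin q a N = qInf q a / qInf q (q ^ N * a) :=
  (eq_div_iff h).2 (qFin_mul_qInf hq a N)

/-- The theta function `θ(a) = (a)_∞ (q/a)_∞`. -/
def theta (q a : ℂ) : ℂ := qInf q a * qInf q (q / a)

/-- The bilateral Jackson integral
`∫_0^{a∞} f(z) d_q z = (1 - q) ∑_{ν ∈ ℤ} f(a q^ν) a q^ν`. -/
def jacksonZero (q a : ℂ) (f : ℂ → ℂ) : ℂ :=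
  (1 - q) * ∑' ν : ℤ, f (a * q ^ ν) * (a * q ^ ν)

/-- The bilateral Jackson integral
`∫_{a∞}^{b∞} f(z) d_q z = ∫_0^{b∞} f(z) d_q z - ∫_0^{a∞} f(z) d_q z`. -/
def jackson (q a b : ℂ) (f : ℂ → ℂ) : ℂ :=
  jacksonZero q b f - jacksonZero q a f

/-- The iterated bilateral Jackson integral
`∫_{a∞}^{b∞} ⋯ ∫_{a∞}^{b∞} f(z_1, …, z_n) d_q z_1 ⋯ d_q z_n`, with `z_1` the innermost variable
and `z_n` the outermost one. -/
def jacksonIter (q a b : ℂ) : (n : ℕ) → ((Fin n → ℂ) → ℂ) → ℂ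
  | 0, f => f Fin.elim0
  | n + 1, f => jackson q a b fun z =>
      jacksonIter q a b n fun w => f (Fin.snoc (α := fun _ => ℂ) w z)

/-- The Askey–Evans integrand
`∏_i z_i^{(n-1)τ} (q z_i/a₁)_∞ (q z_i/a₂)_∞ / ((b₁ z_i)_∞ (b₂ z_i)_∞)
  · ∏_{j<k} (z_j/z_k)_τ (z_k/z_j)_τ`. -/
def integrand (q a₁ a₂ b₁ b₂ : ℂ) (τ n : ℕ) (z : Fin n → ℂ) : ℂ :=
  (∏ i : Fin n, z i ^ ((n - 1) * τ) *
      (qInf q (q * a₁⁻¹ * z i) / qInf q (b₁ * z i)) *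
      (qInf q (q * a₂⁻¹ * z i) / qInf q (b₂ * z i))) *
    ∏ j : Fin n, ∏ k ∈ Finset.Ioi j, qFin q (z j / z k) τ * qFin q (z k / z j) τ

/-- The constant `C₀`, with `t = q^τ`:
`(1-q)^n ∏_{k=1}^n (q)_∞ (t)_∞ ∏_{i,j} (q a_i⁻¹ b_j⁻¹ t^{-(k-1)})_∞
  / ((t^k)_∞ (q a₁⁻¹ a₂⁻¹ b₁⁻¹ b₂⁻¹ t^{-(n+k-2)})_∞)`. -/
def C₀ (q a₁ a₂ b₁ b₂ t : ℂ) (n : ℕ) : ℂ :=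
  (1 - q) ^ n * ∏ k ∈ Finset.Icc 1 n,
    (qInf q q * qInf q t *
        (qInf q (q * a₁⁻¹ * b₁⁻¹ * (t ^ (k - 1))⁻¹) * qInf q (q * a₁⁻¹ * b₂⁻¹ * (t ^ (k - 1))⁻¹) *
          qInf q (q * a₂⁻¹ * b₁⁻¹ * (t ^ (k - 1))⁻¹) *
          qInf q (q * a₂⁻¹ * b₂⁻¹ * (t ^ (k - 1))⁻¹))) /
      (qInf q (t ^ k) * qInf q (q * a₁⁻¹ * a₂⁻¹ * b₁⁻¹ * b₂⁻¹ * (t ^ (n + k - 2))⁻¹))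

end

end AskeyEvans

/-!
Write `t = q ^ τ` and `αᵢ = aᵢ⁻¹`. Expanding the kernel in monomials turns the `n`-fold Jackson
integral into the value, at a polynomial, of the `n`-th tensor power of a linear functional in one
variable. The shift `z ↦ q z` of the lattices gives the moments of this functional a three-term
relation (`MomentRel`) in which the nodes `x₁`, `x₂` do not occur.

* *Ordered kernel.* Replacing `(z_j/z_k)_τ (z_k/z_j)_τ` by `(z_j/z_k)_τ (q z_k/z_j)_τ` for `j < k`
  multiplies the kernel by `(z_j - t z_k) / (z_j - z_k)` for each pair. The sum of the product of
  these factors over all permutations of the variables is the `t`-factorial of `n`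
  (`sum_perm_pairProd`), so the symmetric integral is an explicit multiple of the ordered one
  (`symIntegral_eq`).
* *Aomoto's recursion.* Integrating a total `q`-difference shows that the averages of
  `∏_{i ≤ m} (1 - α₁ z_i)` over the ordered kernel satisfy a first-order recursion in `m`
  (`headAverage_succ`). From `m = 0` to `m = n` it is a first-order `q`-difference equation in
  `α₁`, since multiplying the weight by `1 - α₁ z` amounts to `α₁ ↦ α₁ / q`. Its
  iteration sends `α₁` and `α₂` to `0` and produces the infinite products which depend on them
  (`ordJackson_reduce`).
* *Vanishing parameters.* Positive moments which satisfy the same relations are proportional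
  (`MomentRel.proportional`). For `α₁ = b₁ t^(n-1)` and `α₂ = 0` the relations have a solution
  supported on finitely many points of a geometric progression, and the ordered kernel vanishes at
  all configurations of these points but one (`ordIntegral_nodeMoment`). The comparison of the two
  solutions, for `n` variables and for one, evaluates the integral at `α₁ = α₂ = 0` as a constant
  times the `n`-th power of the one-dimensional integral (`ordJackson_zero`).
* *The one-dimensional integral.* Multiplied by its theta denominators it is, as a function of `b₁`,
  holomorphic on `ℂ ∖ {0}` with the multiplier of `θ(x₁ x₂ b₁ b₂)`, hence a multiple of it, because
  the Laurent coefficients obey a two-term recursion (`mul_theta_eq_of_multiplier`). The factor is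
  found at `b₁ = 1 / x₁` from Cauchy's sum over Durfee squares (`durfee_sum`,
  `jacksonMoment_one_mul_theta`).

The quasi-periodicity of `θ` relates the `n`-th power of the theta quotient to the product over `j`
(`prod_theta_shift`).
-/

namespace AskeyEvans

open Filter Topology

/-! ### Infinite `q`-factorials -/

section QInf

variable {q : ℂ}

theorem qInf_eq_tprod_one_add (q a : ℂ) : qInf q a = ∏' i : ℕ, (1 + -(q ^ i * a)) := by
  simp [qInf, sub_eq_add_neg]

theorem summable_norm_neg_pow_mul (hq : ‖q‖ < 1) (a : ℂ) :
    Summable fun i : ℕ => ‖-(q ^ i * a)‖ := by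
  simp only [norm_neg, norm_mul, norm_pow]
  exact (summable_geometric_of_lt_one (norm_nonneg q) hq).mul_right _

theorem multipliable_qInf (hq : ‖q‖ < 1) (a : ℂ) : Multipliable fun i : ℕ => 1 - q ^ i * a := by
  simpa [sub_eq_add_neg] using multipliable_one_add_of_summable (summable_norm_neg_pow_mul hq a)

@[simp] theorem qFin_zero (q a : ℂ) : qFin q a 0 = 1 := by simp [qFin]

theorem qFin_succ (q a : ℂ) (N : ℕ) : qFin q a (N + 1) = qFin q a N * (1 - q ^ N * a) := by
  simp [qFin, Finset.prod_range_succ]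

theorem qFin_succ' (q a : ℂ) (N : ℕ) : qFin q a (N + 1) = (1 - a) * qFin q (q * a) N := by
  simp [qFin, Finset.prod_range_succ', pow_succ, mul_assoc, mul_comm (1 - a)]

theorem qFin_add (q a : ℂ) (M N : ℕ) : qFin q a (M + N) = qFin q a M * qFin q (q ^ M * a) N := by
  simp [qFin, Finset.prod_range_add, pow_add, mul_assoc, mul_comm]

theorem qInf_eq_one_sub_mul (hq : ‖q‖ < 1) (a : ℂ) : qInf q a = (1 - a) * qInf q (q * a) := by
  have := qFin_mul_qInf hq a 1
  simpa [qFin_succ] using this.symm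

@[simp] theorem qInf_zero (q : ℂ) : qInf q 0 = 1 := by simp [qInf]

theorem qInf_ne_zero (hq : ‖q‖ < 1) {a : ℂ} (h : ∀ i : ℕ, q ^ i * a ≠ 1) : qInf q a ≠ 0 := by
  rw [qInf_eq_tprod_one_add]
  refine tprod_one_add_ne_zero_of_summable (fun i hi => h i ?_) (summable_norm_neg_pow_mul hq a)
  linear_combination -hi

theorem qInf_ne_zero_of_norm_lt_one (hq : ‖q‖ < 1) {a : ℂ} (ha : ‖a‖ < 1) : qInf q a ≠ 0 := by
  refine qInf_ne_zero hq fun i hi => ?_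
  have : ‖q ^ i * a‖ < 1 := by
    rw [norm_mul, norm_pow]
    exact (mul_le_of_le_one_left (norm_nonneg _) (pow_le_one₀ (norm_nonneg _) hq.le)).trans_lt ha
  simp [hi] at this

theorem qInf_eq_zero (hq : ‖q‖ < 1) {a : ℂ} {i : ℕ} (h : q ^ i * a = 1) : qInf q a = 0 := by
  rw [← qFin_mul_qInf hq a (i + 1), qFin_succ, h]; simp

theorem qFin_ne_zero_of_qInf (hq : ‖q‖ < 1) {a : ℂ} (h : qInf q a ≠ 0) (N : ℕ) :
    qFin q a N ≠ 0 := by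
  rw [← qFin_mul_qInf hq a N] at h
  exact left_ne_zero_of_mul h

theorem tendsto_qFin (hq : ‖q‖ < 1) (a : ℂ) :
    Tendsto (fun N => qFin q a N) atTop (𝓝 (qInf q a)) :=
  (multipliable_qInf hq a).hasProd.tendsto_prod_nat

theorem differentiable_qInf (hq : ‖q‖ < 1) : Differentiable ℂ (qInf q) := by
  intro a
  set R : ℝ := ‖a‖ + 1
  have h := Summable.hasProdLocallyUniformlyOn_nat_one_add
    (f := fun (i : ℕ) (z : ℂ) => -(q ^ i * z)) (K := Metric.ball 0 R) Metric.isOpen_ball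
    (u := fun i => ‖q‖ ^ i * R)
    ((summable_geometric_of_lt_one (norm_nonneg q) hq).mul_right R)
    (Eventually.of_forall fun i z hz => by
      rw [norm_neg, norm_mul, norm_pow]
      gcongr
      simpa using (Metric.mem_ball.1 hz).le)
    (fun i => by fun_prop)
  have hd : DifferentiableOn ℂ (fun z => ∏' i : ℕ, (1 + -(q ^ i * z))) (Metric.ball 0 R) := by
    refine h.differentiableOn (Eventually.of_forall fun s => ?_) Metric.isOpen_ball
    fun_prop
  have hd' := hd.differentiableAt (Metric.isOpen_ball.mem_nhds (x := a) (by simp [R]))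
  simpa only [← qInf_eq_tprod_one_add] using hd'

theorem continuous_qInf (hq : ‖q‖ < 1) : Continuous (qInf q) := (differentiable_qInf hq).continuous

theorem tendsto_qInf_of_tendsto_zero (hq : ‖q‖ < 1) {ι : Type*} {l : Filter ι} {f : ι → ℂ}
    (hf : Tendsto f l (𝓝 0)) : Tendsto (fun i => qInf q (f i)) l (𝓝 1) := by
  simpa [Function.comp_def] using ((continuous_qInf hq).tendsto 0).comp hf

end QInf

/-! ### Absolute bounds -/

section Bound

/-- The majorant `∏_{i ≥ 0} (1 + q^i r)` of `|(a)_∞|` for `|a| ≤ r`. -/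
noncomputable def qMaj (q r : ℝ) : ℝ := ∏' i : ℕ, (1 + q ^ i * r)

variable {q r : ℝ}

theorem norm_ofReal_lt_one (hq0 : 0 < q) (hq1 : q < 1) : ‖(q : ℂ)‖ < 1 := by
  simpa [abs_of_pos hq0] using hq1

theorem multipliable_qMaj (hq0 : 0 < q) (hq1 : q < 1) (r : ℝ) :
    Multipliable fun i : ℕ => 1 + q ^ i * r :=
  Real.multipliable_one_add_of_summable
    ((summable_geometric_of_lt_one hq0.le hq1).mul_right r)

theorem tendsto_qMaj (hq0 : 0 < q) (hq1 : q < 1) (r : ℝ) :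
    Tendsto (fun N => ∏ i ∈ Finset.range N, (1 + q ^ i * r)) atTop (𝓝 (qMaj q r)) :=
  (multipliable_qMaj hq0 hq1 r).hasProd.tendsto_prod_nat

theorem one_le_qMaj (hq0 : 0 < q) (hq1 : q < 1) (hr : 0 ≤ r) : 1 ≤ qMaj q r := by
  refine ge_of_tendsto' (tendsto_qMaj hq0 hq1 r) fun N => ?_
  have h := Finset.prod_le_prod (s := Finset.range N) (f := fun _ => (1 : ℝ))
    (g := fun i => 1 + q ^ i * r) (fun _ _ => zero_le_one)
    fun i _ => le_add_of_nonneg_right (by positivity)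
  simpa using h

theorem prod_mul_qMaj (hq0 : 0 < q) (hq1 : q < 1) (r : ℝ) (N : ℕ) :
    (∏ i ∈ Finset.range N, (1 + q ^ i * r)) * qMaj q (q ^ N * r) = qMaj q r := by
  have h := Multipliable.prod_mul_tprod_nat_mul' (f := fun i : ℕ => 1 + q ^ i * r) (k := N)
    (by simpa [pow_add, mul_assoc] using multipliable_qMaj hq0 hq1 (q ^ N * r))
  simpa [qMaj, pow_add, mul_assoc] using h

theorem qMaj_eq_mul (hq0 : 0 < q) (hq1 : q < 1) (r : ℝ) :
    qMaj q r = (1 + r) * qMaj q (q * r) := by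
  simpa using (prod_mul_qMaj hq0 hq1 r 1).symm

theorem norm_one_sub_le (hq0 : 0 < q) {a : ℂ} (h : ‖a‖ ≤ r) (i : ℕ) :
    ‖1 - (q : ℂ) ^ i * a‖ ≤ 1 + q ^ i * r := by
  refine (norm_sub_le _ _).trans ?_
  rw [norm_one, norm_mul, norm_pow, Complex.norm_real, Real.norm_of_nonneg hq0.le]
  gcongr

theorem norm_qInf_le (hq0 : 0 < q) (hq1 : q < 1) {a : ℂ} (h : ‖a‖ ≤ r) :
    ‖qInf q a‖ ≤ qMaj q r := by
  refine le_of_tendsto_of_tendsto' (tendsto_qFin (norm_ofReal_lt_one hq0 hq1) a).norm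
    (tendsto_qMaj hq0 hq1 r) fun N => ?_
  rw [qFin, norm_prod]
  exact Finset.prod_le_prod (fun _ _ => norm_nonneg _) fun i _ => norm_one_sub_le hq0 h i

end Bound

/-! ### Theta functions -/

section Theta

variable {q : ℂ}

theorem theta_q_mul (hq : ‖q‖ < 1) (hq0 : q ≠ 0) {a : ℂ} (ha : a ≠ 0) :
    theta q (q * a) = -a⁻¹ * theta q a := by
  have h1 := qInf_eq_one_sub_mul hq a
  have h2 := qInf_eq_one_sub_mul hq a⁻¹
  rw [theta, theta, h1, show q / (q * a) = a⁻¹ by field_simp, h2, div_eq_mul_inv]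
  field_simp
  ring

theorem theta_inv (hq : ‖q‖ < 1) {a : ℂ} (ha : a ≠ 0) : theta q a⁻¹ = -a⁻¹ * theta q a := by
  have h1 := qInf_eq_one_sub_mul hq a
  have h2 := qInf_eq_one_sub_mul hq a⁻¹
  rw [theta, theta, h1, show q / a⁻¹ = q * a by field_simp, h2, div_eq_mul_inv]
  field_simp
  ring

theorem theta_ne_zero (hq : ‖q‖ < 1) (hq0 : q ≠ 0) {a : ℂ} (ha : a ≠ 0)
    (h : ∀ m : ℤ, a * q ^ m ≠ 1) : theta q a ≠ 0 := by
  refine mul_ne_zero (qInf_ne_zero hq fun i hi => h i ?_) (qInf_ne_zero hq fun i hi => ?_)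
  · rw [zpow_natCast, mul_comm, hi]
  · refine h (-(i + 1 : ℕ)) ?_
    rw [zpow_neg, zpow_natCast, pow_succ]
    field_simp at hi ⊢
    exact hi.symm

theorem theta_pow_mul (hq : ‖q‖ < 1) (hq0 : q ≠ 0) {a : ℂ} (ha : a ≠ 0) (m : ℕ) :
    (-a) ^ m * q ^ (m.choose 2) * theta q (q ^ m * a) = theta q a := by
  induction m with
  | zero => simp
  | succ m ih =>
    have h := theta_q_mul hq hq0 (a := q ^ m * a) (mul_ne_zero (pow_ne_zero _ hq0) ha)
    have hc : (m + 1).choose 2 = m + m.choose 2 := by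
      rw [Nat.choose_succ_succ' m 1, Nat.choose_one_right]
    rw [pow_succ' q, mul_assoc q, h, hc, ← ih, pow_add, pow_succ]
    field_simp
    ring

theorem theta_eq_zero (hq : ‖q‖ < 1) (hq0 : q ≠ 0) {a : ℂ} {m : ℤ} (h : a * q ^ m = 1) :
    theta q a = 0 := by
  obtain ⟨i, rfl | rfl⟩ := m.eq_nat_or_neg
  · rw [theta, qInf_eq_zero hq (i := i) (by rw [mul_comm, ← h, zpow_natCast]), zero_mul]
  · rcases i with _ | i
    · rw [theta, qInf_eq_zero hq (i := 0) (by simpa using h), zero_mul]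
    · have ha : a = q ^ (i + 1) := by
        rw [zpow_neg, zpow_natCast] at h
        field_simp at h
        exact h
      rw [theta, qInf_eq_zero hq (a := q / a) (i := i) (by rw [ha, pow_succ]; field_simp), mul_zero]

end Theta

/-! ### Moments of the one-variable weight -/

/-- The one-variable weight `(q α₁ z)_∞ (q α₂ z)_∞ / ((b₁ z)_∞ (b₂ z)_∞)`, with `αᵢ` in the place
of `aᵢ⁻¹`, so that `αᵢ = 0` is allowed. -/
noncomputable def weight (q α₁ α₂ b₁ b₂ z : ℂ) : ℂ :=
  qInf q (q * α₁ * z) / qInf q (b₁ * z) * (qInf q (q * α₂ * z) / qInf q (b₂ * z))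

/-- The series `∑_{ν ∈ ℤ} w(x q^ν) (x q^ν)^k`, that is, up to the factor `1 - q`, the Jackson
integral of `w(z) z^(k-1)` over the lattice `x q^ℤ`. -/
noncomputable def latticeMoment (q α₁ α₂ b₁ b₂ x : ℂ) (k : ℕ) : ℂ :=
  ∑' ν : ℤ, weight q α₁ α₂ b₁ b₂ (x * q ^ ν) * (x * q ^ ν) ^ k

/-- The condition that the lattice `x q^ℤ` avoids the poles of the weight. -/
def Avoids (q x b : ℂ) : Prop := ∀ m : ℤ, x * b * q ^ m ≠ 1

/-- A majorant of `|w(z) z^k|` which only depends on `|α₁|` and `|α₂|`, monotonically. -/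
noncomputable def weightMaj (q r₁ r₂ : ℝ) (b₁ b₂ : ℂ) (k : ℕ) (z : ℂ) : ℝ :=
  qMaj q (q * r₁ * ‖z‖) * qMaj q (q * r₂ * ‖z‖) / (‖qInf q (b₁ * z)‖ * ‖qInf q (b₂ * z)‖) *
    ‖z‖ ^ k

section

variable {q : ℝ} {b₁ b₂ : ℂ}

theorem Avoids.qInf_ne_zero (hq0 : 0 < q) (hq1 : q < 1) {x b : ℂ} (h : Avoids q x b) (m : ℤ) :
    qInf q (b * (x * (q : ℂ) ^ m)) ≠ 0 := by
  have hq : (q : ℂ) ≠ 0 := by exact_mod_cast hq0.ne'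
  refine AskeyEvans.qInf_ne_zero (norm_ofReal_lt_one hq0 hq1) fun i hi => h (m + i) ?_
  rw [zpow_add₀ hq, zpow_natCast, ← hi]; ring

theorem norm_weight_mul_pow_le (hq0 : 0 < q) (hq1 : q < 1) {α₁ α₂ : ℂ} {r₁ r₂ : ℝ}
    (h₁ : ‖α₁‖ ≤ r₁) (h₂ : ‖α₂‖ ≤ r₂) (k : ℕ) (z : ℂ) :
    ‖weight q α₁ α₂ b₁ b₂ z * z ^ k‖ ≤ weightMaj q r₁ r₂ b₁ b₂ k z := by
  have key : ∀ {α : ℂ} {r : ℝ}, ‖α‖ ≤ r → ‖qInf q (q * α * z)‖ ≤ qMaj q (q * r * ‖z‖) := by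
    intro α r h
    refine norm_qInf_le hq0 hq1 ?_
    rw [norm_mul, norm_mul, Complex.norm_real, Real.norm_of_nonneg hq0.le]
    gcongr
  rw [weight, weightMaj, norm_mul, norm_mul, norm_div, norm_div, norm_pow, div_mul_div_comm]
  have := (norm_nonneg _).trans (key h₁)
  gcongr
  · exact key h₁
  · exact key h₂

theorem weightMaj_q_mul (hq0 : 0 < q) (hq1 : q < 1) {r₁ r₂ : ℝ} (k : ℕ) (z : ℂ)
    (h₁ : qInf q (b₁ * z) ≠ 0) (h₂ : qInf q (b₂ * z) ≠ 0) :
    weightMaj q r₁ r₂ b₁ b₂ k (q * z) * ((1 + q * r₁ * ‖z‖) * (1 + q * r₂ * ‖z‖)) =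
      weightMaj q r₁ r₂ b₁ b₂ k z * (‖1 - b₁ * z‖ * ‖1 - b₂ * z‖ * q ^ k) := by
  have hq := norm_ofReal_lt_one hq0 hq1
  have e₁ := qInf_eq_one_sub_mul hq (b₁ * z)
  have e₂ := qInf_eq_one_sub_mul hq (b₂ * z)
  rw [e₁] at h₁
  rw [e₂] at h₂
  have n₁ := norm_ne_zero_iff.2 (left_ne_zero_of_mul h₁)
  have n₂ := norm_ne_zero_iff.2 (left_ne_zero_of_mul h₂)
  have n₃ := norm_ne_zero_iff.2 (right_ne_zero_of_mul h₁)
  have n₄ := norm_ne_zero_iff.2 (right_ne_zero_of_mul h₂)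
  have f₁ := qMaj_eq_mul hq0 hq1 (q * r₁ * ‖z‖)
  have f₂ := qMaj_eq_mul hq0 hq1 (q * r₂ * ‖z‖)
  rw [weightMaj, weightMaj, e₁, e₂, f₁, f₂, mul_left_comm b₁, mul_left_comm b₂]
  simp only [norm_mul, Complex.norm_real, Real.norm_of_nonneg hq0.le, mul_pow]
  rw [show q * r₁ * (q * ‖z‖) = q * (q * r₁ * ‖z‖) by ring,
    show q * r₂ * (q * ‖z‖) = q * (q * r₂ * ‖z‖) by ring]
  generalize ‖1 - b₁ * z‖ = A at *
  generalize ‖1 - b₂ * z‖ = B at *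
  generalize ‖qInf q (q * (b₁ * z))‖ = C at *
  generalize ‖qInf q (q * (b₂ * z))‖ = D at *
  field_simp

theorem weightMaj_nonneg (hq0 : 0 < q) (hq1 : q < 1) {r₁ r₂ : ℝ} (h₁ : 0 ≤ r₁) (h₂ : 0 ≤ r₂)
    (k : ℕ) (z : ℂ) : 0 ≤ weightMaj q r₁ r₂ b₁ b₂ k z := by
  have := one_le_qMaj hq0 hq1 (r := q * r₁ * ‖z‖) (by positivity)
  have := one_le_qMaj hq0 hq1 (r := q * r₂ * ‖z‖) (by positivity)
  unfold weightMaj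
  positivity

theorem tendsto_mul_pow_zero (hq0 : 0 < q) (hq1 : q < 1) (x : ℂ) :
    Tendsto (fun n : ℕ => x * (q : ℂ) ^ n) atTop (𝓝 0) := by
  simpa using (tendsto_pow_atTop_nhds_zero_of_norm_lt_one
    (norm_ofReal_lt_one hq0 hq1)).const_mul x

/-- The ratio test on both ends of the lattice: towards `0` the terms decay like `q^(kν)`, towards
`∞` like the powers of `q² r₁ r₂ / (q^k |b₁ b₂|)`. -/
theorem summable_weightMaj (hq0 : 0 < q) (hq1 : q < 1) {r₁ r₂ : ℝ} (hr₁ : 0 ≤ r₁) (hr₂ : 0 ≤ r₂)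
    {x : ℂ} (hx : x ≠ 0) (h₁ : Avoids q x b₁) (h₂ : Avoids q x b₂) {k : ℕ} (hk : 1 ≤ k)
    (hconv : q ^ 2 * r₁ * r₂ < q ^ k * ‖b₁‖ * ‖b₂‖) :
    Summable fun ν : ℤ => weightMaj q r₁ r₂ b₁ b₂ k (x * (q : ℂ) ^ ν) := by
  have hq : (q : ℂ) ≠ 0 := by exact_mod_cast hq0.ne'
  have hb₁ : b₁ ≠ 0 := by
    rintro rfl
    have : 0 ≤ q ^ 2 * r₁ * r₂ := by positivity
    simp at hconv; linarith
  have hb₂ : b₂ ≠ 0 := by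
    rintro rfl
    have : 0 ≤ q ^ 2 * r₁ * r₂ := by positivity
    simp at hconv; linarith
  have hnn : ∀ z, 0 ≤ weightMaj q r₁ r₂ b₁ b₂ k z := weightMaj_nonneg hq0 hq1 hr₁ hr₂ k
  have hstep := fun m : ℤ => weightMaj_q_mul (r₁ := r₁) (r₂ := r₂) hq0 hq1 k (x * (q : ℂ) ^ m)
    (h₁.qInf_ne_zero hq0 hq1 m) (h₂.qInf_ne_zero hq0 hq1 m)
  refine Summable.of_nat_of_neg ?_ ?_
  · have hlim : Tendsto (fun n : ℕ => ‖1 - b₁ * (x * (q : ℂ) ^ n)‖ *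
        ‖1 - b₂ * (x * (q : ℂ) ^ n)‖ * q ^ k) atTop (𝓝 (q ^ k)) := by
      have hc : Continuous fun z : ℂ => ‖1 - b₁ * z‖ * ‖1 - b₂ * z‖ * q ^ k := by fun_prop
      simpa [Function.comp_def] using (hc.tendsto 0).comp (tendsto_mul_pow_zero hq0 hq1 x)
    obtain ⟨r, hr, hr'⟩ := exists_between (pow_lt_one₀ hq0.le hq1 (by omega : k ≠ 0))
    refine summable_of_ratio_norm_eventually_le hr' ?_
    filter_upwards [hlim.eventually_le_const hr] with n hn
    rw [Real.norm_of_nonneg (hnn _), Real.norm_of_nonneg (hnn _)]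
    have h := hstep n
    rw [zpow_natCast] at h
    rw [Nat.cast_succ, zpow_add_one₀ hq, zpow_natCast, ← mul_assoc,
      mul_comm (x * (q : ℂ) ^ n) (q : ℂ)]
    set z := x * (q : ℂ) ^ n
    calc weightMaj q r₁ r₂ b₁ b₂ k (q * z)
        ≤ weightMaj q r₁ r₂ b₁ b₂ k (q * z) * ((1 + q * r₁ * ‖z‖) * (1 + q * r₂ * ‖z‖)) := by
          refine le_mul_of_one_le_right (hnn _) (one_le_mul_of_one_le_of_one_le ?_ ?_) <;>
          exact le_add_of_nonneg_right (by positivity)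
      _ = _ := h
      _ ≤ r * weightMaj q r₁ r₂ b₁ b₂ k z := by
          rw [mul_comm r]; exact mul_le_mul_of_nonneg_left hn (hnn _)
  · -- in terms of `u = 1/z`, which tends to `0` at this end
    have hlim : Tendsto (fun n : ℕ => (‖x⁻¹ * (q : ℂ) ^ (n + 1)‖ + q * r₁) *
        (‖x⁻¹ * (q : ℂ) ^ (n + 1)‖ + q * r₂) / (‖x⁻¹ * (q : ℂ) ^ (n + 1) - b₁‖ *
        ‖x⁻¹ * (q : ℂ) ^ (n + 1) - b₂‖ * q ^ k)) atTop
        (𝓝 (q ^ 2 * r₁ * r₂ / (q ^ k * ‖b₁‖ * ‖b₂‖))) := by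
      have hc : ContinuousAt (fun u : ℂ => (‖u‖ + q * r₁) * (‖u‖ + q * r₂) /
          (‖u - b₁‖ * ‖u - b₂‖ * q ^ k)) 0 := by
        refine ContinuousAt.div (by fun_prop) (by fun_prop) ?_
        simp [hb₁, hb₂, hq0.ne']
      have := hc.tendsto.comp ((tendsto_mul_pow_zero hq0 hq1 x⁻¹).comp (tendsto_add_atTop_nat 1))
      simp only [Function.comp_def, norm_zero, zero_add, zero_sub, norm_neg] at this
      convert this using 2
      ring
    have hlt : q ^ 2 * r₁ * r₂ / (q ^ k * ‖b₁‖ * ‖b₂‖) < 1 := by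
      rw [div_lt_one]
      · exact hconv
      · positivity
    obtain ⟨r, hr, hr'⟩ := exists_between hlt
    refine summable_of_ratio_norm_eventually_le hr' ?_
    filter_upwards [hlim.eventually_le_const hr] with n hn
    rw [Real.norm_of_nonneg (hnn _), Real.norm_of_nonneg (hnn _)]
    have h := hstep (-((n + 1 : ℕ) : ℤ))
    rw [mul_left_comm (q : ℂ) x, ← zpow_one_add₀ hq,
      show (1 : ℤ) + -((n + 1 : ℕ) : ℤ) = -(n : ℤ) by push_cast; ring] at h
    have hp₁ : 1 - b₁ * (x * (q : ℂ) ^ (-((n + 1 : ℕ) : ℤ))) ≠ 0 := by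
      have := h₁.qInf_ne_zero hq0 hq1 (-((n + 1 : ℕ) : ℤ))
      rw [qInf_eq_one_sub_mul (norm_ofReal_lt_one hq0 hq1)] at this
      exact left_ne_zero_of_mul this
    have hp₂ : 1 - b₂ * (x * (q : ℂ) ^ (-((n + 1 : ℕ) : ℤ))) ≠ 0 := by
      have := h₂.qInf_ne_zero hq0 hq1 (-((n + 1 : ℕ) : ℤ))
      rw [qInf_eq_one_sub_mul (norm_ofReal_lt_one hq0 hq1)] at this
      exact left_ne_zero_of_mul this
    have hz : x * (q : ℂ) ^ (-((n + 1 : ℕ) : ℤ)) ≠ 0 := mul_ne_zero hx (zpow_ne_zero _ hq)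
    have hu : x⁻¹ * (q : ℂ) ^ (n + 1) = (x * (q : ℂ) ^ (-((n + 1 : ℕ) : ℤ)))⁻¹ := by
      rw [zpow_neg, zpow_natCast, mul_inv, inv_inv]
    rw [hu] at hn
    set z := x * (q : ℂ) ^ (-((n + 1 : ℕ) : ℤ))
    have hpos : 0 < ‖1 - b₁ * z‖ * ‖1 - b₂ * z‖ * q ^ k := by positivity
    have e : (‖z⁻¹‖ + q * r₁) * (‖z⁻¹‖ + q * r₂) / (‖z⁻¹ - b₁‖ * ‖z⁻¹ - b₂‖ * q ^ k) =
        ((1 + q * r₁ * ‖z‖) * (1 + q * r₂ * ‖z‖)) / (‖1 - b₁ * z‖ * ‖1 - b₂ * z‖ * q ^ k) := by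
      rw [show z⁻¹ - b₁ = z⁻¹ * (1 - b₁ * z) by field_simp,
        show z⁻¹ - b₂ = z⁻¹ * (1 - b₂ * z) by field_simp, norm_mul, norm_mul, norm_inv]
      have : ‖z‖ ≠ 0 := norm_ne_zero_iff.2 hz
      field_simp
    rw [e, div_le_iff₀ hpos] at hn
    refine le_of_mul_le_mul_right ?_ hpos
    rw [← h]
    calc _ ≤ weightMaj q r₁ r₂ b₁ b₂ k (x * (q : ℂ) ^ (-(n : ℤ))) *
          (r * (‖1 - b₁ * z‖ * ‖1 - b₂ * z‖ * q ^ k)) :=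
          mul_le_mul_of_nonneg_left hn (hnn _)
      _ = _ := by ring

theorem weight_q_mul (hq0 : 0 < q) (hq1 : q < 1) (α₁ α₂ : ℂ) {z : ℂ}
    (h₁ : qInf q (b₁ * z) ≠ 0) (h₂ : qInf q (b₂ * z) ≠ 0) :
    weight q α₁ α₂ b₁ b₂ (q * z) * ((1 - q * α₁ * z) * (1 - q * α₂ * z)) =
      weight q α₁ α₂ b₁ b₂ z * ((1 - b₁ * z) * (1 - b₂ * z)) := by
  have hq := norm_ofReal_lt_one hq0 hq1
  have e₁ := qInf_eq_one_sub_mul hq (b₁ * z)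
  have e₂ := qInf_eq_one_sub_mul hq (b₂ * z)
  have f₁ := qInf_eq_one_sub_mul hq (q * α₁ * z)
  have f₂ := qInf_eq_one_sub_mul hq (q * α₂ * z)
  rw [e₁] at h₁
  rw [e₂] at h₂
  have n₁ := left_ne_zero_of_mul h₁
  have n₂ := left_ne_zero_of_mul h₂
  have n₃ := right_ne_zero_of_mul h₁
  have n₄ := right_ne_zero_of_mul h₂
  rw [weight, weight, e₁, e₂, f₁, f₂, mul_left_comm b₁, mul_left_comm b₂,
    mul_left_comm (q * α₁), mul_left_comm (q * α₂)]
  generalize qInf q (q * (b₁ * z)) = C at *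
  generalize qInf q (q * (b₂ * z)) = D at *
  generalize hA : 1 - b₁ * z = A at *
  generalize hB : 1 - b₂ * z = B at *
  field_simp

/-- The series defining the moment of exponent `k` converges as soon as `q² |α₁ α₂| < q^k |b₁ b₂|`;
the condition is stated for some larger exponent `K`. -/
theorem summable_latticeMoment (hq0 : 0 < q) (hq1 : q < 1) {α₁ α₂ x : ℂ} (hx : x ≠ 0)
    (h₁ : Avoids q x b₁) (h₂ : Avoids q x b₂) {k K : ℕ} (hk : 1 ≤ k) (hkK : k ≤ K)
    (hconv : q ^ 2 * ‖α₁‖ * ‖α₂‖ < q ^ K * ‖b₁‖ * ‖b₂‖) :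
    Summable fun ν : ℤ => weight q α₁ α₂ b₁ b₂ (x * (q : ℂ) ^ ν) * (x * (q : ℂ) ^ ν) ^ k := by
  refine Summable.of_norm_bounded (summable_weightMaj hq0 hq1 (norm_nonneg α₁) (norm_nonneg α₂)
    hx h₁ h₂ hk (hconv.trans_le ?_)) fun ν => norm_weight_mul_pow_le hq0 hq1 le_rfl le_rfl k _
  have := pow_le_pow_of_le_one hq0.le hq1.le hkK
  gcongr

theorem tendsto_latticeMoment (hq0 : 0 < q) (hq1 : q < 1) {α₁ α₂ x : ℂ} (hx : x ≠ 0)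
    (h₁ : Avoids q x b₁) (h₂ : Avoids q x b₂) {k K : ℕ} (hk : 1 ≤ k) (hkK : k ≤ K)
    (hconv : q ^ 2 * ‖α₁‖ * ‖α₂‖ < q ^ K * ‖b₁‖ * ‖b₂‖) :
    Tendsto (fun N : ℕ => latticeMoment q (α₁ * (q : ℂ) ^ N) α₂ b₁ b₂ x k) atTop
      (𝓝 (latticeMoment q 0 α₂ b₁ b₂ x k)) := by
  have hpow := pow_le_pow_of_le_one hq0.le hq1.le hkK
  refine tendsto_tsum_of_dominated_convergence
    (summable_weightMaj hq0 hq1 (norm_nonneg α₁) (norm_nonneg α₂)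
      hx h₁ h₂ hk (hconv.trans_le ?_)) (fun ν => ?_) (Eventually.of_forall fun N ν => ?_)
  · gcongr
  · refine Tendsto.mul_const _ (Tendsto.mul_const _ (Tendsto.div_const ?_ _))
    refine ((continuous_qInf (norm_ofReal_lt_one hq0 hq1)).tendsto _).comp ?_
    exact ((tendsto_mul_pow_zero hq0 hq1 α₁).const_mul _).mul_const _
  · refine norm_weight_mul_pow_le hq0 hq1 ?_ le_rfl k _
    rw [norm_mul, norm_pow, Complex.norm_real, Real.norm_of_nonneg hq0.le]
    exact mul_le_of_le_one_right (norm_nonneg _) (pow_le_one₀ hq0.le hq1.le)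

theorem latticeMoment_swap (q α₁ α₂ b₁ b₂ x : ℂ) (k : ℕ) :
    latticeMoment q α₁ α₂ b₁ b₂ x k = latticeMoment q α₂ α₁ b₁ b₂ x k := by
  simp only [latticeMoment, weight]
  congr! 3 with ν
  ring

/-- Multiplying the weight with parameter `q α₁` by `1 - q α₁ z` turns it into `α₁`. -/
theorem weight_shift (hq0 : 0 < q) (hq1 : q < 1) (α₁ α₂ z : ℂ) :
    weight q α₁ α₂ b₁ b₂ z = weight q (α₁ * q) α₂ b₁ b₂ z * (1 - α₁ * q * z) := by
  rw [weight, weight, qInf_eq_one_sub_mul (norm_ofReal_lt_one hq0 hq1) (q * α₁ * z),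
    show (q : ℂ) * (α₁ * q) * z = q * (q * α₁ * z) by ring]
  ring

/-- Telescoping over a lattice, for positive exponents. -/
theorem latticeMoment_rel (hq0 : 0 < q) (hq1 : q < 1) {α₁ α₂ x : ℂ} (hx : x ≠ 0)
    (h₁ : Avoids q x b₁) (h₂ : Avoids q x b₂) {k : ℕ} (hk : 1 ≤ k)
    (hconv : q ^ 2 * ‖α₁‖ * ‖α₂‖ < q ^ (k + 2) * ‖b₁‖ * ‖b₂‖) :
    latticeMoment q α₁ α₂ b₁ b₂ x k - (α₁ + α₂) * latticeMoment q α₁ α₂ b₁ b₂ x (k + 1) +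
        α₁ * α₂ * latticeMoment q α₁ α₂ b₁ b₂ x (k + 2) =
      (q : ℂ) ^ k * (latticeMoment q α₁ α₂ b₁ b₂ x k -
        (b₁ + b₂) * latticeMoment q α₁ α₂ b₁ b₂ x (k + 1) +
        b₁ * b₂ * latticeMoment q α₁ α₂ b₁ b₂ x (k + 2)) := by
  have hq : (q : ℂ) ≠ 0 := by exact_mod_cast hq0.ne'
  have s : ∀ j ≤ 2, HasSum _ (latticeMoment q α₁ α₂ b₁ b₂ x (k + j)) := fun j hj =>
    (summable_latticeMoment hq0 hq1 hx h₁ h₂ (k := k + j) (by omega) (by omega) hconv).hasSum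
  have s0 := s 0 (by omega)
  have s1 := s 1 (by omega)
  have s2 := s 2 le_rfl
  rw [add_zero] at s0
  have hl := (s0.sub (s1.mul_left (α₁ + α₂))).add (s2.mul_left (α₁ * α₂))
  have hr := ((s0.sub (s1.mul_left (b₁ + b₂))).add (s2.mul_left (b₁ * b₂))).mul_left ((q : ℂ) ^ k)
  rw [← (Equiv.addRight (1 : ℤ)).hasSum_iff] at hl
  refine hl.unique (Eq.subst (motive := fun f => HasSum f _) (funext fun ν => ?_) hr)
  have hw := weight_q_mul hq0 hq1 α₁ α₂ (h₁.qInf_ne_zero hq0 hq1 ν) (h₂.qInf_ne_zero hq0 hq1 ν)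
  simp only [Function.comp_apply, Equiv.coe_addRight, zpow_add_one₀ hq]
  rw [← mul_assoc x, mul_comm (x * (q : ℂ) ^ ν) (q : ℂ)]
  set z := x * (q : ℂ) ^ ν
  linear_combination -(q * z) ^ k * hw

/-- Telescoping over a lattice, for the exponent zero: the boundary term at `0` contributes `1`,
whatever the lattice. -/
theorem latticeMoment_rel_zero (hq0 : 0 < q) (hq1 : q < 1) {α₁ α₂ x : ℂ} (hx : x ≠ 0)
    (h₁ : Avoids q x b₁) (h₂ : Avoids q x b₂)
    (hconv : q ^ 2 * ‖α₁‖ * ‖α₂‖ < q ^ 2 * ‖b₁‖ * ‖b₂‖) :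
    (b₁ + b₂ - α₁ - α₂) * latticeMoment q α₁ α₂ b₁ b₂ x 1 +
      (α₁ * α₂ - b₁ * b₂) * latticeMoment q α₁ α₂ b₁ b₂ x 2 = -1 := by
  have hq : (q : ℂ) ≠ 0 := by exact_mod_cast hq0.ne'
  have s1 := summable_latticeMoment hq0 hq1 hx h₁ h₂ (k := 1) le_rfl one_le_two hconv
  have s2 := summable_latticeMoment hq0 hq1 hx h₁ h₂ (k := 2) one_le_two le_rfl hconv
  set φ : ℤ → ℂ := fun ν => weight q α₁ α₂ b₁ b₂ (x * (q : ℂ) ^ ν) *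
    ((1 - α₁ * (x * (q : ℂ) ^ ν)) * (1 - α₂ * (x * (q : ℂ) ^ ν))) with hφ
  have hs := (s1.hasSum.mul_left (b₁ + b₂ - α₁ - α₂)).add
    (s2.hasSum.mul_left (α₁ * α₂ - b₁ * b₂))
  have hs' : HasSum (fun ν : ℤ => φ ν - φ (ν + 1))
      ((b₁ + b₂ - α₁ - α₂) * latticeMoment q α₁ α₂ b₁ b₂ x 1 +
      (α₁ * α₂ - b₁ * b₂) * latticeMoment q α₁ α₂ b₁ b₂ x 2) := by
    refine Eq.subst (motive := fun f => HasSum f _) (funext fun ν => ?_) hs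
    have hw := weight_q_mul hq0 hq1 α₁ α₂ (h₁.qInf_ne_zero hq0 hq1 ν) (h₂.qInf_ne_zero hq0 hq1 ν)
    simp only [hφ, zpow_add_one₀ hq]
    rw [← mul_assoc x, mul_comm (x * (q : ℂ) ^ ν) (q : ℂ)]
    set z := x * (q : ℂ) ^ ν
    linear_combination hw
  have hpos : Tendsto (fun N : ℕ => φ N) atTop (𝓝 1) := by
    have hz := tendsto_mul_pow_zero hq0 hq1 x
    have hq' := norm_ofReal_lt_one hq0 hq1
    have hf : ∀ c : ℂ, Tendsto (fun N : ℕ => qInf q (c * (x * (q : ℂ) ^ N))) atTop (𝓝 1) :=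
      fun c => tendsto_qInf_of_tendsto_zero hq' (by simpa using hz.const_mul c)
    have hg : ∀ c : ℂ, Tendsto (fun N : ℕ => 1 - c * (x * (q : ℂ) ^ N)) atTop (𝓝 1) :=
      fun c => by simpa using (hz.const_mul c).const_sub 1
    have := ((((hf (q * α₁)).div (hf b₁) one_ne_zero)).mul
      ((hf (q * α₂)).div (hf b₂) one_ne_zero)).mul ((hg α₁).mul (hg α₂))
    simpa [hφ, weight] using this
  have hneg : Tendsto (fun N : ℕ => φ (-(N : ℤ))) atTop (𝓝 0) := by
    have hc : Tendsto (fun N : ℕ => -(N : ℤ)) atTop cofinite :=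
      (Function.Injective.tendsto_cofinite (fun a b h => by simpa using h)).mono_left
        Nat.cofinite_eq_atTop.ge
    have t1 := s1.tendsto_cofinite_zero.comp hc
    have t2 := s2.tendsto_cofinite_zero.comp hc
    have hz := tendsto_mul_pow_zero hq0 hq1 x⁻¹
    have := (t1.mul (hz.sub_const (α₁ + α₂))).add (t2.const_mul (α₁ * α₂))
    simp only [zero_mul, mul_zero, add_zero] at this
    refine this.congr fun N => ?_
    have hN : x * (q : ℂ) ^ (-(N : ℤ)) ≠ 0 := mul_ne_zero hx (zpow_ne_zero _ hq)
    have hu : x⁻¹ * (q : ℂ) ^ N = (x * (q : ℂ) ^ (-(N : ℤ)))⁻¹ := by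
      rw [zpow_neg, zpow_natCast, mul_inv, inv_inv]
    simp only [hφ, Function.comp_apply, hu]
    set z := x * (q : ℂ) ^ (-(N : ℤ))
    field_simp
    ring
  have h1 := hs'.comp (Finset.tendsto_Ico_neg (R := ℤ))
  have h2 := hneg.sub hpos
  rw [zero_sub] at h2
  refine tendsto_nhds_unique (h1.congr fun N => ?_) h2
  exact Finset.sum_Ico_int_sub N φ

/-- The three-term relations between the moments of a linear functional, for the exponents `< K`:
they express that the functional vanishes on `q`-differences of the weight. -/
def MomentRel (q α₁ α₂ b₁ b₂ : ℂ) (K : ℕ) (μ : ℕ → ℂ) : Prop :=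
  ∀ k < K, μ k - (α₁ + α₂) * μ (k + 1) + α₁ * α₂ * μ (k + 2) =
    q ^ k * (μ k - (b₁ + b₂) * μ (k + 1) + b₁ * b₂ * μ (k + 2))

/-- The moments of the functional `z^(k-1) ↦ ∫_{x₁∞}^{x₂∞} w(z) z^(k-1) d_q z / (1 - q)`.
The exponent `k = 0` is outside the domain of convergence and gets the value `0`. -/
noncomputable def jacksonMoment (q α₁ α₂ b₁ b₂ x₁ x₂ : ℂ) (k : ℕ) : ℂ :=
  if k = 0 then 0 else latticeMoment q α₁ α₂ b₁ b₂ x₂ k - latticeMoment q α₁ α₂ b₁ b₂ x₁ k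

theorem jacksonMoment_of_pos (q α₁ α₂ b₁ b₂ x₁ x₂ : ℂ) {k : ℕ} (hk : k ≠ 0) :
    jacksonMoment q α₁ α₂ b₁ b₂ x₁ x₂ k =
      latticeMoment q α₁ α₂ b₁ b₂ x₂ k - latticeMoment q α₁ α₂ b₁ b₂ x₁ k := if_neg hk

/-- The difference of the two lattices removes the boundary term, so that the relations hold from
the exponent zero on. -/
theorem momentRel_jacksonMoment (hq0 : 0 < q) (hq1 : q < 1) {α₁ α₂ x₁ x₂ : ℂ}
    (hx₁ : x₁ ≠ 0) (hx₂ : x₂ ≠ 0) (h₁₁ : Avoids q x₁ b₁) (h₁₂ : Avoids q x₁ b₂)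
    (h₂₁ : Avoids q x₂ b₁) (h₂₂ : Avoids q x₂ b₂) {K : ℕ}
    (hconv : q ^ 2 * ‖α₁‖ * ‖α₂‖ < q ^ (K + 1) * ‖b₁‖ * ‖b₂‖) :
    MomentRel q α₁ α₂ b₁ b₂ K (jacksonMoment q α₁ α₂ b₁ b₂ x₁ x₂) := by
  intro k hk
  have hc : q ^ 2 * ‖α₁‖ * ‖α₂‖ < q ^ (k + 2) * ‖b₁‖ * ‖b₂‖ := by
    refine hconv.trans_le ?_
    have := pow_le_pow_of_le_one hq0.le hq1.le (show k + 2 ≤ K + 1 by omega)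
    gcongr
  rcases Nat.eq_zero_or_pos k with rfl | hk0
  · have r₁ := latticeMoment_rel_zero hq0 hq1 hx₁ h₁₁ h₁₂ hc
    have r₂ := latticeMoment_rel_zero hq0 hq1 hx₂ h₂₁ h₂₂ hc
    simp only [jacksonMoment, if_true, zero_add, one_ne_zero, two_ne_zero, if_false]
    linear_combination r₂ - r₁
  · have r₁ := latticeMoment_rel hq0 hq1 hx₁ h₁₁ h₁₂ hk0 hc
    have r₂ := latticeMoment_rel hq0 hq1 hx₂ h₂₁ h₂₂ hk0 hc
    simp only [jacksonMoment, hk0.ne', Nat.succ_ne_zero, if_false]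
    linear_combination r₂ - r₁

theorem jacksonMoment_shift (hq0 : 0 < q) (hq1 : q < 1) {α₁ α₂ x₁ x₂ : ℂ}
    (hx₁ : x₁ ≠ 0) (hx₂ : x₂ ≠ 0) (h₁₁ : Avoids q x₁ b₁) (h₁₂ : Avoids q x₁ b₂)
    (h₂₁ : Avoids q x₂ b₁) (h₂₂ : Avoids q x₂ b₂) {k : ℕ} (hk : k ≠ 0)
    (hconv : q ^ 2 * ‖α₁ * q‖ * ‖α₂‖ < q ^ (k + 1) * ‖b₁‖ * ‖b₂‖) :
    jacksonMoment q α₁ α₂ b₁ b₂ x₁ x₂ k = jacksonMoment q (α₁ * q) α₂ b₁ b₂ x₁ x₂ k -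
      α₁ * q * jacksonMoment q (α₁ * q) α₂ b₁ b₂ x₁ x₂ (k + 1) := by
  have key : ∀ {x : ℂ}, x ≠ 0 → Avoids q x b₁ → Avoids q x b₂ →
      latticeMoment q α₁ α₂ b₁ b₂ x k = latticeMoment q (α₁ * q) α₂ b₁ b₂ x k -
      α₁ * q * latticeMoment q (α₁ * q) α₂ b₁ b₂ x (k + 1) := by
    intro x hx h₁ h₂
    have s1 := summable_latticeMoment hq0 hq1 hx h₁ h₂ (k := k) (by omega) (by omega) hconv
    have s2 := summable_latticeMoment hq0 hq1 hx h₁ h₂ (k := k + 1) (by omega) le_rfl hconv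
    refine Eq.trans ?_ (s1.hasSum.sub (s2.hasSum.mul_left (α₁ * q))).tsum_eq
    refine tsum_congr fun ν => ?_
    rw [weight_shift hq0 hq1]
    ring
  rw [jacksonMoment_of_pos _ _ _ _ _ _ _ hk, jacksonMoment_of_pos _ _ _ _ _ _ _ hk,
    jacksonMoment_of_pos _ _ _ _ _ _ _ k.succ_ne_zero, key hx₁ h₁₁ h₁₂, key hx₂ h₂₁ h₂₂]
  ring

theorem tendsto_jacksonMoment (hq0 : 0 < q) (hq1 : q < 1) {α₁ α₂ x₁ x₂ : ℂ}
    (hx₁ : x₁ ≠ 0) (hx₂ : x₂ ≠ 0) (h₁₁ : Avoids q x₁ b₁) (h₁₂ : Avoids q x₁ b₂)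
    (h₂₁ : Avoids q x₂ b₁) (h₂₂ : Avoids q x₂ b₂) {k K : ℕ} (hkK : k ≤ K)
    (hconv : q ^ 2 * ‖α₁‖ * ‖α₂‖ < q ^ K * ‖b₁‖ * ‖b₂‖) :
    Tendsto (fun N : ℕ => jacksonMoment q (α₁ * (q : ℂ) ^ N) α₂ b₁ b₂ x₁ x₂ k) atTop
      (𝓝 (jacksonMoment q 0 α₂ b₁ b₂ x₁ x₂ k)) := by
  unfold jacksonMoment
  split_ifs with hk
  · exact tendsto_const_nhds
  · exact (tendsto_latticeMoment hq0 hq1 hx₂ h₂₁ h₂₂ (by omega) hkK hconv).sub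
      (tendsto_latticeMoment hq0 hq1 hx₁ h₁₁ h₁₂ (by omega) hkK hconv)

theorem jacksonMoment_swap (q α₁ α₂ b₁ b₂ x₁ x₂ : ℂ) :
    jacksonMoment q α₁ α₂ b₁ b₂ x₁ x₂ = jacksonMoment q α₂ α₁ b₁ b₂ x₁ x₂ := by
  funext k
  simp only [jacksonMoment, latticeMoment_swap q α₁]

theorem weight_swap_right (q α₁ α₂ b₁ b₂ z : ℂ) :
    weight q α₁ α₂ b₁ b₂ z = weight q α₁ α₂ b₂ b₁ z := by
  rw [weight, weight, div_mul_div_comm, div_mul_div_comm, mul_comm (qInf q (b₁ * z))]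

theorem jacksonMoment_swap_right (q α₁ α₂ b₁ b₂ x₁ x₂ : ℂ) :
    jacksonMoment q α₁ α₂ b₁ b₂ x₁ x₂ = jacksonMoment q α₁ α₂ b₂ b₁ x₁ x₂ := by
  funext k
  simp only [jacksonMoment, latticeMoment, weight_swap_right q α₁ α₂ b₁]

end

/-! ### Products over ordered pairs -/

section PairProd

variable {R : Type*} [CommRing R]

/-- The product of `f j k` over the pairs `j < k`. -/
def pairProd {n : ℕ} (f : Fin n → Fin n → R) : R := ∏ j, ∏ k ∈ Finset.Ioi j, f j k

theorem pairProd_eq_prod_ite {n : ℕ} (f : Fin n → Fin n → R) :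
    pairProd f = ∏ j, ∏ k, if j < k then f j k else 1 := by
  refine Finset.prod_congr rfl fun j _ => ?_
  rw [← Finset.prod_filter]
  congr 1
  ext k; simp

theorem pairProd_succ {n : ℕ} (f : Fin (n + 1) → Fin (n + 1) → R) :
    pairProd f = (∏ k : Fin n, f 0 k.succ) * pairProd fun j k => f j.succ k.succ := by
  simp only [pairProd_eq_prod_ite]
  rw [Fin.prod_univ_succ]
  simp [Fin.prod_univ_succ]

theorem pairProd_castSucc {n : ℕ} (f : Fin (n + 1) → Fin (n + 1) → R) :
    pairProd f = (∏ j : Fin n, f j.castSucc (Fin.last n)) *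
      pairProd fun j k => f j.castSucc k.castSucc := by
  simp only [pairProd_eq_prod_ite]
  rw [Fin.prod_univ_castSucc]
  simp [Fin.prod_univ_castSucc, Fin.castSucc_lt_last, Finset.prod_mul_distrib, mul_comm,
    (Fin.le_last _).not_gt]

theorem map_pairProd {S : Type*} [CommRing S] (φ : R →+* S) {n : ℕ} (f : Fin n → Fin n → R) :
    φ (pairProd f) = pairProd fun j k => φ (f j k) := by
  simp [pairProd, map_prod]

theorem pairProd_mul {n : ℕ} (f g : Fin n → Fin n → R) :
    pairProd (fun j k => f j k * g j k) = pairProd f * pairProd g := by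
  simp [pairProd, Finset.prod_mul_distrib]

theorem pairProd_congr {n : ℕ} {f g : Fin n → Fin n → R} (h : ∀ j k, j < k → f j k = g j k) :
    pairProd f = pairProd g :=
  Finset.prod_congr rfl fun j _ => Finset.prod_congr rfl fun k hk => h j k (Finset.mem_Ioi.1 hk)

theorem pairProd_pow_mul {n : ℕ} (x : Fin n → R) (τ : ℕ) :
    pairProd (fun j k => x j ^ τ * x k ^ τ) = ∏ i, x i ^ ((n - 1) * τ) := by
  induction n with
  | zero => simp [pairProd]
  | succ n ih =>
    rw [pairProd_succ, ih, Fin.prod_univ_succ, Finset.prod_mul_distrib, Finset.prod_const,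
      Finset.card_univ, Fintype.card_fin, ← pow_mul, mul_assoc, ← Finset.prod_mul_distrib]
    rcases n with _ | n
    · simp
    · simp [← pow_add, mul_comm τ, add_mul, add_comm]

/-- The pairs `j < k` other than the adjacent pair `(i, i + 1)` are permuted by the transposition
of `i` and `i + 1`. -/
theorem pairProd_adjacent {n : ℕ} (f : Fin (n + 1) → Fin (n + 1) → R) (i : Fin n) :
    ∃ S : Finset (Fin (n + 1) × Fin (n + 1)),
      (∀ g : Fin (n + 1) → Fin (n + 1) → R,
        pairProd g = g i.castSucc i.succ * ∏ p ∈ S, g p.1 p.2) ∧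
      ∏ p ∈ S, f (Equiv.swap i.castSucc i.succ p.1) (Equiv.swap i.castSucc i.succ p.2) =
        ∏ p ∈ S, f p.1 p.2 := by
  classical
  set s := Equiv.swap i.castSucc i.succ
  refine ⟨(Finset.univ.filter fun p : Fin (n + 1) × Fin (n + 1) => p.1 < p.2).erase
    (i.castSucc, i.succ), fun g => ?_, ?_⟩
  · have h := Finset.mul_prod_erase
      (Finset.univ.filter fun p : Fin (n + 1) × Fin (n + 1) => p.1 < p.2)
      (fun p : Fin (n + 1) × Fin (n + 1) => g p.1 p.2) (a := (i.castSucc, i.succ))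
      (by simp)
    rw [h, pairProd_eq_prod_ite, Finset.prod_filter, Fintype.prod_prod_type]
  · refine Finset.prod_equiv (Equiv.prodCongr s s) (fun p => ?_) (fun p _ => by simp)
    obtain ⟨j, k⟩ := p
    simp only [Finset.mem_erase, Finset.mem_filter, Finset.mem_univ, true_and, ne_eq,
      Prod.mk.injEq, Equiv.prodCongr_apply, Prod.map_apply, s, Equiv.swap_apply_def,
      Fin.ext_iff, Fin.lt_def, Fin.val_castSucc, Fin.val_succ]
    split_ifs <;> simp_all <;> omega

end PairProd

/-! ### The moment functional on polynomials -/

section Functional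

open MvPolynomial

variable {n : ℕ}

/-- The `n`-fold tensor power of the functional `z^k ↦ μ k`, on polynomials in `n` variables. -/
noncomputable def momentFunctional (μ : ℕ → ℂ) (n : ℕ) : MvPolynomial (Fin n) ℂ →ₗ[ℂ] ℂ :=
  (basisMonomials (Fin n) ℂ).constr ℂ fun d => ∏ i, μ (d i)

theorem momentFunctional_monomial (μ : ℕ → ℂ) (d : Fin n →₀ ℕ) (c : ℂ) :
    momentFunctional μ n (monomial d c) = c * ∏ i, μ (d i) := by
  have h : monomial d c = c • basisMonomials (Fin n) ℂ d := by
    simp [smul_monomial]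
  rw [h, map_smul, momentFunctional, Module.Basis.constr_basis, smul_eq_mul]

theorem monomial_eq_C_mul_prod (d : Fin n →₀ ℕ) (c : ℂ) :
    monomial d c = C c * ∏ i, (X i : MvPolynomial (Fin n) ℂ) ^ d i := by
  rw [monomial_eq, Finsupp.prod_fintype _ _ (by simp)]

theorem momentFunctional_C_mul_prod (μ : ℕ → ℂ) (c : ℂ) (e : Fin n → ℕ) :
    momentFunctional μ n (C c * ∏ i, X i ^ e i) = c * ∏ i, μ (e i) := by
  have := monomial_eq_C_mul_prod (Finsupp.equivFunOnFinite.symm e) c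
  simp only [Finsupp.equivFunOnFinite_symm_apply_apply] at this
  rw [← this, momentFunctional_monomial]
  simp

theorem momentFunctional_eq_sum (μ : ℕ → ℂ) (p : MvPolynomial (Fin n) ℂ) :
    momentFunctional μ n p = ∑ d ∈ p.support, p.coeff d * ∏ i, μ (d i) := by
  conv_lhs => rw [p.as_sum, map_sum]
  exact Finset.sum_congr rfl fun d _ => momentFunctional_monomial μ d _

theorem momentFunctional_rename (μ : ℕ → ℂ) (σ : Equiv.Perm (Fin n))
    (p : MvPolynomial (Fin n) ℂ) :
    momentFunctional μ n (rename σ p) = momentFunctional μ n p := by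
  induction p using MvPolynomial.induction_on' with
  | monomial d c =>
    rw [monomial_eq_C_mul_prod, map_mul, map_prod, rename_C]
    simp only [map_pow, rename_X]
    rw [← Equiv.prod_comp σ.symm]
    simp only [Equiv.apply_symm_apply]
    rw [momentFunctional_C_mul_prod, momentFunctional_C_mul_prod,
      ← Equiv.prod_comp σ.symm fun i => μ (d i)]
  | add p r hp hr => simp only [map_add, hp, hr]

theorem momentFunctional_eq_zero_of_antisymm (μ : ℕ → ℂ) (σ : Equiv.Perm (Fin n))
    {p : MvPolynomial (Fin n) ℂ} (h : rename σ p = -p) : momentFunctional μ n p = 0 := by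
  have := momentFunctional_rename μ σ p
  rw [h, map_neg] at this
  exact self_eq_neg.1 this.symm

/-- The affine rotation `g(z₁, …, z_n) ↦ g(q z_n, z₁, …, z_{n-1})`. -/
noncomputable def rotate (q : ℂ) (n : ℕ) :
    MvPolynomial (Fin (n + 1)) ℂ →ₐ[ℂ] MvPolynomial (Fin (n + 1)) ℂ :=
  aeval (Fin.cons (q • X (Fin.last n)) fun i : Fin n => X i.castSucc)

@[simp] theorem rotate_X_zero (q : ℂ) (n : ℕ) : rotate q n (X 0) = q • X (Fin.last n) := by
  simp [rotate]

@[simp] theorem rotate_X_succ (q : ℂ) (n : ℕ) (i : Fin n) :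
    rotate q n (X i.succ) = X i.castSucc := by
  simp [rotate]

theorem rotate_monomial (q c : ℂ) (d : Fin (n + 1) →₀ ℕ) :
    rotate q n (monomial d c) =
      C (c * q ^ d 0) * ((∏ i : Fin n, X i.castSucc ^ d i.succ) * X (Fin.last n) ^ d 0) := by
  rw [monomial_eq_C_mul_prod, Fin.prod_univ_succ, map_mul, map_mul, map_prod,
    show rotate q n (C c) = C c from (rotate q n).commutes c]
  simp only [map_pow, rotate_X_zero, rotate_X_succ, smul_eq_C_mul, mul_pow, C_mul]
  ring

/-- Summation by parts in the first variable, followed by a rotation of the variables. -/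
theorem momentFunctional_rotate {q α₁ α₂ b₁ b₂ : ℂ} {K : ℕ} {μ : ℕ → ℂ}
    (hμ : MomentRel q α₁ α₂ b₁ b₂ K μ) (g : MvPolynomial (Fin (n + 1)) ℂ)
    (hg : g.degreeOf 0 < K) :
    momentFunctional μ (n + 1) ((1 - C α₁ * X 0) * (1 - C α₂ * X 0) * g) =
      momentFunctional μ (n + 1)
        ((1 - C b₁ * X (Fin.last n)) * (1 - C b₂ * X (Fin.last n)) * rotate q n g) := by
  have expand : ∀ (a b : ℂ) (x y : MvPolynomial (Fin (n + 1)) ℂ),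
      (1 - C a * x) * (1 - C b * x) * y = y - (a + b) • (x * y) + (a * b) • (x ^ 2 * y) := by
    intro a b x y
    simp only [smul_eq_C_mul, C_add, C_mul]; ring
  rw [g.as_sum, map_sum, Finset.mul_sum, Finset.mul_sum, map_sum, map_sum]
  refine Finset.sum_congr rfl fun d hd => ?_
  have hd0 : d 0 < K := (monomial_le_degreeOf 0 hd).trans_lt hg
  generalize g.coeff d = c
  have key₁ : ∀ j : ℕ, momentFunctional μ (n + 1) (X 0 ^ j * monomial d c) =
      c * (μ (d 0 + j) * ∏ i : Fin n, μ (d i.succ)) := by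
    intro j
    have := momentFunctional_C_mul_prod μ c (Fin.cons (d 0 + j) fun i : Fin n => d i.succ)
    simp only [Fin.prod_univ_succ, Fin.cons_zero, Fin.cons_succ] at this
    rw [← this]
    refine congrArg _ ?_
    rw [monomial_eq_C_mul_prod, Fin.prod_univ_succ, pow_add]
    ring
  have key₂ : ∀ j : ℕ, momentFunctional μ (n + 1)
      (X (Fin.last n) ^ j * rotate q n (monomial d c)) =
      c * q ^ d 0 * (μ (d 0 + j) * ∏ i : Fin n, μ (d i.succ)) := by
    intro j
    have := momentFunctional_C_mul_prod μ (c * q ^ d 0)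
      (Fin.snoc (fun i : Fin n => d i.succ) (d 0 + j) : Fin (n + 1) → ℕ)
    simp only [Fin.prod_univ_castSucc, Fin.snoc_last, Fin.snoc_castSucc] at this
    rw [mul_comm (μ (d 0 + j)), ← this]
    refine congrArg _ ?_
    rw [rotate_monomial, pow_add]
    ring
  have h := hμ (d 0) hd0
  have k₁ := key₁ 0
  have k₂ := key₁ 1
  have k₃ := key₁ 2
  have l₁ := key₂ 0
  have l₂ := key₂ 1
  have l₃ := key₂ 2
  simp only [pow_zero, one_mul, pow_one, add_zero] at k₁ k₂ l₁ l₂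
  rw [expand, expand, map_add, map_sub, map_smul, map_smul, map_add, map_sub, map_smul, map_smul,
    k₁, k₂, k₃, l₁, l₂, l₃]
  simp only [smul_eq_mul]
  linear_combination (c * ∏ i : Fin n, μ (d i.succ)) * h

end Functional

/-! ### The Selberg-type kernel -/

section Kernel

variable {R S : Type*} [CommRing R] [Algebra ℂ R] [CommRing S] [Algebra ℂ S]

/-- The pair factor `x^τ y^τ (x/y)_τ (q y/x)_τ` of the kernel for ordered variables, written without
denominators. -/
noncomputable def ordPair (q : ℂ) (τ : ℕ) (x y : R) : R :=
  ∏ i ∈ Finset.range τ, (y - q ^ i • x) * (x - q ^ (i + 1) • y)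

/-- The symmetric pair factor `x^τ y^τ (x/y)_τ (y/x)_τ`, written without denominators. -/
noncomputable def symPair (q : ℂ) (τ : ℕ) (x y : R) : R :=
  ∏ i ∈ Finset.range τ, (y - q ^ i • x) * (x - q ^ i • y)

/-- The symmetric part common to `ordPair` and `symPair`. -/
noncomputable def pairCore (q : ℂ) (τ : ℕ) (x y : R) : R :=
  ∏ i ∈ Finset.range (τ - 1), (y - q ^ (i + 1) • x) * (x - q ^ (i + 1) • y)

theorem ordPair_eq {τ : ℕ} (hτ : 1 ≤ τ) (q : ℂ) (x y : R) :
    ordPair q τ x y = (x - q ^ τ • y) * (y - x) * pairCore q τ x y := by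
  obtain ⟨τ, rfl⟩ := Nat.exists_eq_add_of_le' hτ
  simp only [ordPair, pairCore, Finset.prod_mul_distrib, Nat.add_sub_cancel]
  rw [Finset.prod_range_succ' fun i => y - q ^ i • x, Finset.prod_range_succ]
  simp only [pow_zero, one_smul]
  ring

theorem symPair_eq {τ : ℕ} (hτ : 1 ≤ τ) (q : ℂ) (x y : R) :
    symPair q τ x y = (x - y) * (y - x) * pairCore q τ x y := by
  obtain ⟨τ, rfl⟩ := Nat.exists_eq_add_of_le' hτ
  simp only [symPair, pairCore, Finset.prod_mul_distrib, Nat.add_sub_cancel]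
  rw [Finset.prod_range_succ' fun i => y - q ^ i • x,
    Finset.prod_range_succ' fun i => x - q ^ i • y]
  simp only [pow_zero, one_smul]
  ring

theorem map_ordPair (φ : R →ₐ[ℂ] S) (q : ℂ) (τ : ℕ) (x y : R) :
    φ (ordPair q τ x y) = ordPair q τ (φ x) (φ y) := by
  simp [ordPair, map_prod]

theorem map_symPair (φ : R →ₐ[ℂ] S) (q : ℂ) (τ : ℕ) (x y : R) :
    φ (symPair q τ x y) = symPair q τ (φ x) (φ y) := by
  simp [symPair, map_prod]

theorem ordPair_smul_left (q : ℂ) (τ : ℕ) (x y : R) :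
    ordPair q τ (q • y) x = q ^ τ • ordPair q τ x y := by
  simp only [ordPair]
  have h : q ^ τ = ∏ _i ∈ Finset.range τ, q := by simp
  rw [h, Algebra.smul_def (∏ _i ∈ Finset.range τ, q), map_prod, ← Finset.prod_mul_distrib]
  refine Finset.prod_congr rfl fun i _ => ?_
  simp only [Algebra.smul_def, map_pow]
  ring

theorem symPair_comm (q : ℂ) (τ : ℕ) (x y : R) : symPair q τ x y = symPair q τ y x :=
  Finset.prod_congr rfl fun _ _ => mul_comm _ _

end Kernel

section Recursion

open MvPolynomial

variable {n : ℕ}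

/-- The polynomial `∏ᵢ zᵢ^((n-1)τ) ∏_{j<k} (z_j/z_k)_τ (q z_k/z_j)_τ`. -/
noncomputable def ordKernel (q : ℂ) (τ n : ℕ) : MvPolynomial (Fin n) ℂ :=
  pairProd fun j k => ordPair q τ (X j) (X k)

theorem rotate_ordKernel (q : ℂ) (τ n : ℕ) :
    rotate q n (ordKernel q τ (n + 1)) = (q ^ τ) ^ n • ordKernel q τ (n + 1) := by
  rw [ordKernel, ← AlgHom.coe_toRingHom, map_pairProd, pairProd_succ, pairProd_castSucc]
  simp only [AlgHom.coe_toRingHom, map_ordPair, rotate_X_zero, rotate_X_succ, ordPair_smul_left]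
  rw [← smul_mul_assoc]
  congr 1
  simp [Algebra.smul_def, Finset.prod_mul_distrib]

/-- Exchanging two adjacent variables in the kernel costs the ratio of the two linear factors;
hence the relation `z_{i+1} ≡ t z_i` under the functional, against functions symmetric in the two
variables. -/
theorem momentFunctional_adjacent (μ : ℕ → ℂ) {q : ℂ} {τ : ℕ} (hτ : 1 ≤ τ) (i : Fin n)
    {f : MvPolynomial (Fin (n + 1)) ℂ} (hf : rename (Equiv.swap i.castSucc i.succ) f = f) :
    momentFunctional μ (n + 1) (X i.succ * f * ordKernel q τ (n + 1)) =
      q ^ τ * momentFunctional μ (n + 1) (X i.castSucc * f * ordKernel q τ (n + 1)) := by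
  obtain ⟨S, hS, hS'⟩ := pairProd_adjacent
    (fun j k => ordPair q τ (X j : MvPolynomial (Fin (n + 1)) ℂ) (X k)) i
  have h := momentFunctional_eq_zero_of_antisymm μ (Equiv.swap i.castSucc i.succ)
    (p := (X i.succ - q ^ τ • X i.castSucc) * f * ordKernel q τ (n + 1)) ?_
  · rw [sub_mul, sub_mul, map_sub, smul_mul_assoc, smul_mul_assoc, map_smul, smul_eq_mul] at h
    exact sub_eq_zero.1 h
  · rw [ordKernel, hS, ordPair_eq hτ]
    simp only [map_mul, map_sub, map_smul, map_prod, map_ordPair, rename_X, hf,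
      Equiv.swap_apply_left, Equiv.swap_apply_right]
    rw [hS', show rename (Equiv.swap i.castSucc i.succ)
      (pairCore q τ (X i.castSucc) (X i.succ) : MvPolynomial (Fin (n + 1)) ℂ) =
      pairCore q τ (X i.castSucc) (X i.succ) by
        simp only [pairCore, map_prod, map_mul, map_sub, map_smul, rename_X,
          Equiv.swap_apply_left, Equiv.swap_apply_right]
        exact Finset.prod_congr rfl fun _ _ => mul_comm _ _]
    ring

theorem degreeOf_sub_smul_le {σ : Type*} {i : σ} {m : ℕ} (c : ℂ) {p r : MvPolynomial σ ℂ}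
    (hp : p.degreeOf i ≤ m) (hr : r.degreeOf i ≤ m) : (p - c • r).degreeOf i ≤ m := by
  rw [smul_eq_C_mul]
  exact (degreeOf_sub_le _ _ _).trans (max_le hp ((degreeOf_C_mul_le _ _ _).trans hr))

theorem degreeOf_pairProd_le {τ : ℕ} (i : Fin n) {f : Fin n → Fin n → MvPolynomial (Fin n) ℂ}
    (hf : ∀ j k, (f j k).degreeOf i ≤ 2 * τ * ((if j = i then 1 else 0) + if k = i then 1 else 0)) :
    (pairProd f).degreeOf i ≤ 2 * (n - 1) * τ := by
  refine (degreeOf_prod_le _ _ _).trans ((Finset.sum_le_sum fun j _ =>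
    (degreeOf_prod_le _ _ _).trans (Finset.sum_le_sum fun k _ => hf j k)).trans ?_)
  simp_rw [← Finset.mul_sum, Finset.sum_add_distrib]
  have h₁ : ∑ j, ∑ _k ∈ Finset.Ioi j, (if j = i then 1 else 0) = n - 1 - i := by
    simp [Finset.sum_ite_eq']
  have h₂ : ∑ j, ∑ k ∈ Finset.Ioi j, (if k = i then 1 else 0) = (i : ℕ) := by
    have : ∀ j, ∑ k ∈ Finset.Ioi j, (if k = i then 1 else 0) = if j ∈ Finset.Iio i then 1 else 0 :=
      fun j => by simp
    rw [Finset.sum_congr rfl fun j _ => this j, Finset.sum_ite_mem]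
    simp
  rw [h₁, h₂, show n - 1 - (i : ℕ) + i = n - 1 by omega]
  exact le_of_eq (by ring)

theorem degreeOf_ordPair_le (q : ℂ) (τ : ℕ) (i j k : Fin n) :
    (ordPair q τ (X j : MvPolynomial (Fin n) ℂ) (X k)).degreeOf i ≤
      2 * τ * ((if j = i then 1 else 0) + if k = i then 1 else 0) := by
  have hX : ∀ l : Fin n, (X l : MvPolynomial (Fin n) ℂ).degreeOf i = if l = i then 1 else 0 :=
    fun l => by rw [degreeOf_X]; simp [eq_comm]
  refine (degreeOf_prod_le _ _ _).trans ((Finset.sum_le_card_nsmul _ _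
    (2 * ((if j = i then 1 else 0) + if k = i then 1 else 0)) ?_).trans ?_)
  · intro l _
    rw [two_mul]
    refine (degreeOf_mul_le _ _ _).trans (Nat.add_le_add
      (degreeOf_sub_smul_le _ ?_ ?_) (degreeOf_sub_smul_le _ ?_ ?_)) <;> rw [hX] <;> omega
  · simp only [Finset.card_range, smul_eq_mul]
    exact le_of_eq (by ring)

theorem degreeOf_symPair_le (q : ℂ) (τ : ℕ) (i j k : Fin n) :
    (symPair q τ (X j : MvPolynomial (Fin n) ℂ) (X k)).degreeOf i ≤
      2 * τ * ((if j = i then 1 else 0) + if k = i then 1 else 0) := by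
  have hX : ∀ l : Fin n, (X l : MvPolynomial (Fin n) ℂ).degreeOf i = if l = i then 1 else 0 :=
    fun l => by rw [degreeOf_X]; simp [eq_comm]
  refine (degreeOf_prod_le _ _ _).trans ((Finset.sum_le_card_nsmul _ _
    (2 * ((if j = i then 1 else 0) + if k = i then 1 else 0)) ?_).trans ?_)
  · intro l _
    rw [two_mul]
    refine (degreeOf_mul_le _ _ _).trans (Nat.add_le_add
      (degreeOf_sub_smul_le _ ?_ ?_) (degreeOf_sub_smul_le _ ?_ ?_)) <;> rw [hX] <;> omega
  · simp only [Finset.card_range, smul_eq_mul]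
    exact le_of_eq (by ring)

theorem degreeOf_ordKernel_le (q : ℂ) (τ n : ℕ) (i : Fin n) :
    (ordKernel q τ n).degreeOf i ≤ 2 * (n - 1) * τ :=
  degreeOf_pairProd_le i (degreeOf_ordPair_le q τ i)

/-- The product of the linear factors `1 - α z_i` over the first `m` variables. -/
noncomputable def headProd (α : ℂ) (n m : ℕ) : MvPolynomial (Fin n) ℂ :=
  ∏ i : Fin n, if (i : ℕ) < m then 1 - C α * X i else 1

/-- The product of all the variables except `z_i`. -/
noncomputable def omitProd (n : ℕ) (i : Fin n) : MvPolynomial (Fin n) ℂ :=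
  ∏ j : Fin n, if j = i then 1 else X j

theorem X_mul_omitProd (i : Fin n) : X i * omitProd n i = ∏ j : Fin n, X j := by
  have : (X i : MvPolynomial (Fin n) ℂ) = ∏ j : Fin n, if j = i then X j else 1 := by simp
  rw [this, omitProd, ← Finset.prod_mul_distrib]
  exact Finset.prod_congr rfl fun j _ => by split_ifs <;> simp

theorem headProd_succ (α : ℂ) (m : Fin n) :
    headProd α n (m + 1) = (1 - C α * X m) * headProd α n m := by
  have : (1 - C α * X m : MvPolynomial (Fin n) ℂ) =
      ∏ j : Fin n, if j = m then 1 - C α * X j else 1 := by simp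
  rw [this, headProd, headProd, ← Finset.prod_mul_distrib]
  refine Finset.prod_congr rfl fun j _ => ?_
  rcases lt_trichotomy (j : ℕ) m with h | h | h
  · simp [h, h.trans (Nat.lt_succ_self _), Fin.ext_iff, h.ne]
  · simp [h, Fin.ext_iff]
  · simp [h.not_gt, Fin.ext_iff, h.ne', (show ¬ (j : ℕ) < m + 1 by omega)]

theorem rename_headProd (α : ℂ) (i : Fin n) {m : ℕ} (hm : m ≠ i + 1) :
    rename (Equiv.swap i.castSucc i.succ) (headProd α (n + 1) m) = headProd α (n + 1) m := by
  rw [headProd, map_prod]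
  refine Fintype.prod_equiv (Equiv.swap i.castSucc i.succ) _ _ fun j => ?_
  have : ((Equiv.swap i.castSucc i.succ j : Fin (n + 1)) : ℕ) < m ↔ (j : ℕ) < m := by
    rw [Equiv.swap_apply_def]
    split_ifs with h₁ h₂
    · subst h₁; simp; omega
    · subst h₂; simp; omega
    · rfl
  simp only [this]
  split_ifs <;> simp

/-- Moving the omitted variable one place to the right. -/
theorem momentFunctional_omitProd_step (μ : ℕ → ℂ) {q : ℂ} {τ : ℕ} (hτ : 1 ≤ τ) (i : Fin n)
    {f : MvPolynomial (Fin (n + 1)) ℂ} (hf : rename (Equiv.swap i.castSucc i.succ) f = f) :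
    momentFunctional μ (n + 1) (omitProd (n + 1) i.castSucc * f * ordKernel q τ (n + 1)) =
      q ^ τ * momentFunctional μ (n + 1) (omitProd (n + 1) i.succ * f * ordKernel q τ (n + 1)) := by
  set s := Equiv.swap i.castSucc i.succ
  set Q : MvPolynomial (Fin (n + 1)) ℂ :=
    ∏ j, if j = i.castSucc ∨ j = i.succ then 1 else X j with hQ
  have hne : i.castSucc ≠ i.succ := (Fin.castSucc_lt_succ).ne
  have e₁ : omitProd (n + 1) i.castSucc = X i.succ * Q := by
    have : (X i.succ : MvPolynomial (Fin (n + 1)) ℂ) = ∏ j, if j = i.succ then X j else 1 := by simp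
    rw [this, hQ, omitProd, ← Finset.prod_mul_distrib]
    refine Finset.prod_congr rfl fun j _ => ?_
    by_cases h₁ : j = i.castSucc
    · subst h₁; simp [hne]
    · by_cases h₂ : j = i.succ <;> simp [h₁, h₂, hne.symm]
  have e₂ : omitProd (n + 1) i.succ = X i.castSucc * Q := by
    have : (X i.castSucc : MvPolynomial (Fin (n + 1)) ℂ) =
      ∏ j, if j = i.castSucc then X j else 1 := by simp
    rw [this, hQ, omitProd, ← Finset.prod_mul_distrib]
    refine Finset.prod_congr rfl fun j _ => ?_
    by_cases h₁ : j = i.castSucc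
    · subst h₁; simp [hne]
    · by_cases h₂ : j = i.succ <;> simp [h₁, h₂, hne.symm]
  have hQs : rename s Q = Q := by
    rw [hQ, map_prod]
    refine Fintype.prod_equiv s _ _ fun j => ?_
    have : (s j = i.castSucc ∨ s j = i.succ) ↔ (j = i.castSucc ∨ j = i.succ) := by
      rw [← Equiv.eq_symm_apply, ← Equiv.eq_symm_apply]
      simp [s, Equiv.symm_swap, or_comm]
    simp only [this]
    split_ifs <;> simp
  rw [e₁, e₂, mul_assoc _ Q f, mul_assoc _ Q f]
  exact momentFunctional_adjacent μ hτ i (by rw [map_mul, hQs, hf])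

/-- Moving a factor `z_i` one place to the right. -/
theorem momentFunctional_prod_step (μ : ℕ → ℂ) {q : ℂ} {τ : ℕ} (hτ : 1 ≤ τ) (i : Fin n)
    {f : MvPolynomial (Fin (n + 1)) ℂ} (hf : rename (Equiv.swap i.castSucc i.succ) f = f) :
    momentFunctional μ (n + 1) (X i.succ * ((∏ j, X j) * f) * ordKernel q τ (n + 1)) =
      q ^ τ * momentFunctional μ (n + 1)
        (X i.castSucc * ((∏ j, X j) * f) * ordKernel q τ (n + 1)) := by
  refine momentFunctional_adjacent μ hτ i ?_
  rw [map_mul, map_prod, hf]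
  simp only [rename_X]
  rw [Equiv.prod_comp (Equiv.swap i.castSucc i.succ) fun j =>
    (X j : MvPolynomial (Fin (n + 1)) ℂ)]

/-- The average `∫ ∏_{i ≤ m} (1 - α z_i)` over the ordered kernel. -/
noncomputable def headAverage (μ : ℕ → ℂ) (q : ℂ) (τ : ℕ) (α : ℂ) (n m : ℕ) : ℂ :=
  momentFunctional μ n ((∏ j, X j) * headProd α n m * ordKernel q τ n)

theorem omitProd_zero_eq (n : ℕ) : omitProd (n + 1) 0 = ∏ i : Fin n, X i.succ := by
  rw [omitProd, Fin.prod_univ_succ]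
  simp

theorem omitProd_last_eq (n : ℕ) : omitProd (n + 1) (Fin.last n) = ∏ i : Fin n, X i.castSucc := by
  rw [omitProd, Fin.prod_univ_castSucc]
  simp

/-- Aomoto's recursion. Summation by parts in the first variable followed by a rotation compares
the averages of `∏_{i ≤ m} (1 - α₁ z_i)` and of `∏_{i ≤ m + 1} (1 - α₁ z_i)`; the terms with a
factor `z_i` or `1 / z_i` are reduced to these two by moving that factor to the place `m + 1`. -/
theorem headAverage_succ {q α₁ α₂ b₁ b₂ : ℂ} {τ K : ℕ} (hτ : 1 ≤ τ) {μ : ℕ → ℂ}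
    (hμ : MomentRel q α₁ α₂ b₁ b₂ K μ) (hK : 2 * n * τ < K) {m : ℕ} (hm : m ≤ n) :
    headAverage μ q τ α₁ (n + 1) (m + 1) * (b₁ * b₂ * (q ^ τ) ^ (2 * n - m) - α₁ * α₂) =
      (q ^ τ) ^ m * (α₁ - (q ^ τ) ^ (n - m) * b₁) * (α₁ - (q ^ τ) ^ (n - m) * b₂) *
        headAverage μ q τ α₁ (n + 1) m := by
  set t := q ^ τ with ht
  set E := momentFunctional μ (n + 1) with hE
  set Θ := ordKernel q τ (n + 1) with hΘ
  set h₀ := headProd α₁ (n + 1) m with hh₀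
  set h₁ := headProd α₁ (n + 1) (m + 1) with hh₁
  set Z : MvPolynomial (Fin (n + 1)) ℂ := ∏ j, X j with hZ
  set i₀ : Fin (n + 1) := ⟨m, by omega⟩ with hi₀
  have hstep : h₁ = (1 - C α₁ * X i₀) * h₀ := headProd_succ α₁ i₀
  -- from the place `m + 1` to the last one
  have right : ∀ d : ℕ, ∀ hd : m + d < n + 1,
      E (omitProd (n + 1) i₀ * h₀ * Θ) = t ^ d * E (omitProd (n + 1) ⟨m + d, hd⟩ * h₀ * Θ) ∧
      E (X ⟨m + d, hd⟩ * (Z * h₀) * Θ) = t ^ d * E (X i₀ * (Z * h₀) * Θ) := by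
    intro d
    induction d with
    | zero => intro hd; simp [hi₀]
    | succ d ih =>
      intro hd
      obtain ⟨r₁, r₂⟩ := ih (by omega)
      have hs := rename_headProd α₁ (⟨m + d, by omega⟩ : Fin n) (m := m) (by simp; omega)
      have s₁ := momentFunctional_omitProd_step μ (q := q) hτ (⟨m + d, by omega⟩ : Fin n) hs
      have s₂ := momentFunctional_prod_step μ (q := q) hτ (⟨m + d, by omega⟩ : Fin n) hs
      simp only [Fin.castSucc_mk, Fin.succ_mk] at s₁ s₂
      refine ⟨?_, ?_⟩
      · refine r₁.trans ((congrArg (t ^ d * ·) s₁).trans ?_)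
        rw [pow_succ]; exact (mul_assoc _ _ _).symm
      · refine s₂.trans ?_
        rw [r₂, pow_succ']; ring
  have left : ∀ d : ℕ, ∀ hd : d ≤ m,
      E (omitProd (n + 1) 0 * h₁ * Θ) = t ^ d * E (omitProd (n + 1) ⟨d, by omega⟩ * h₁ * Θ) := by
    intro d
    induction d with
    | zero => intro hd; simp
    | succ d ih =>
      intro hd
      have hs := rename_headProd α₁ (⟨d, by omega⟩ : Fin n) (m := m + 1) (by simp; omega)
      have s₁ := momentFunctional_omitProd_step μ (q := q) hτ (⟨d, by omega⟩ : Fin n) hs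
      simp only [Fin.castSucc_mk, Fin.succ_mk] at s₁
      refine (ih (by omega)).trans ((congrArg (t ^ d * ·) s₁).trans ?_)
      rw [pow_succ]; exact (mul_assoc _ _ _).symm
  obtain ⟨R₁, R₂⟩ := right (n - m) (by omega)
  have hlast : (⟨m + (n - m), by omega⟩ : Fin (n + 1)) = Fin.last n := by
    ext; simp; omega
  rw [hlast] at R₁ R₂
  have L := left m le_rfl
  rw [← hi₀] at L
  have M : E (omitProd (n + 1) i₀ * h₁ * Θ) =
      E (omitProd (n + 1) i₀ * h₀ * Θ) - α₁ * E (Z * h₀ * Θ) := by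
    rw [hstep, hZ, ← X_mul_omitProd i₀, ← smul_eq_mul α₁, ← map_smul, ← map_sub, smul_eq_C_mul]
    congr 1; ring
  have N : E (Z * h₁ * Θ) = E (Z * h₀ * Θ) - α₁ * E (X i₀ * (Z * h₀) * Θ) := by
    rw [hstep, ← smul_eq_mul α₁, ← map_smul, ← map_sub, smul_eq_C_mul]
    congr 1; ring
  -- summation by parts
  set g : MvPolynomial (Fin (n + 1)) ℂ :=
    (∏ i : Fin n, X i.succ) * (∏ i : Fin n, if (i : ℕ) < m then 1 - C α₁ * X i.succ else 1) * Θ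
  have hdeg : g.degreeOf 0 < K := by
    have hs : ∀ k : Fin n, (X k.succ : MvPolynomial (Fin (n + 1)) ℂ).degreeOf 0 = 0 := by
      intro k; rw [degreeOf_X, if_neg (Fin.succ_ne_zero k).symm]
    have d₁ : (∏ i : Fin n, (X i.succ : MvPolynomial (Fin (n + 1)) ℂ)).degreeOf 0 ≤ 0 :=
      (degreeOf_prod_le _ _ _).trans (Finset.sum_nonpos fun k _ => (hs k).le)
    have d₂ : (∏ i : Fin n, if (i : ℕ) < m then
        (1 - C α₁ * X i.succ : MvPolynomial (Fin (n + 1)) ℂ) else 1).degreeOf 0 ≤ 0 := by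
      refine (degreeOf_prod_le _ _ _).trans (Finset.sum_nonpos fun k _ => ?_)
      split_ifs
      · refine (degreeOf_sub_le _ _ _).trans (max_le (by simp) ?_)
        exact (degreeOf_C_mul_le _ _ _).trans (hs k).le
      · simp
    have d₃ := degreeOf_ordKernel_le q τ (n + 1) 0
    rw [Nat.add_sub_cancel] at d₃
    have d₄ := (degreeOf_mul_le 0 _ Θ).trans
      (Nat.add_le_add ((degreeOf_mul_le 0 _ _).trans (Nat.add_le_add d₁ d₂)) d₃)
    exact (d₄.trans (by omega)).trans_lt hK
  have B := momentFunctional_rotate hμ g hdeg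
  have B₁ : (1 - C α₁ * X 0) * (1 - C α₂ * X 0) * g =
      omitProd (n + 1) 0 * h₁ * Θ - α₂ • (Z * h₁ * Θ) := by
    have : h₁ = (1 - C α₁ * X 0) *
        ∏ i : Fin n, if (i : ℕ) < m then 1 - C α₁ * X i.succ else 1 := by
      rw [hh₁, headProd, Fin.prod_univ_succ]
      simp
    rw [this, hZ, ← X_mul_omitProd 0, omitProd_zero_eq, smul_eq_C_mul]
    ring
  have B₂ : (1 - C b₁ * X (Fin.last n)) * (1 - C b₂ * X (Fin.last n)) * rotate q n g =
      t ^ n • (omitProd (n + 1) (Fin.last n) * h₀ * Θ - (b₁ + b₂) • (Z * h₀ * Θ) +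
        (b₁ * b₂) • (X (Fin.last n) * (Z * h₀) * Θ)) := by
    have e₁ : h₀ = ∏ i : Fin n, if (i : ℕ) < m then 1 - C α₁ * X i.castSucc else 1 := by
      rw [hh₀, headProd, Fin.prod_univ_castSucc]
      simp [hm]
    have e₂ : rotate q n g = omitProd (n + 1) (Fin.last n) * h₀ * (t ^ n • Θ) := by
      rw [map_mul, map_mul, rotate_ordKernel, omitProd_last_eq, e₁, map_prod, map_prod]
      simp only [rotate_X_succ, apply_ite (rotate q n), map_sub, map_mul, map_one]
      rw [show rotate q n (C α₁) = C α₁ from (rotate q n).commutes α₁]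
    rw [e₂, hZ, ← X_mul_omitProd (Fin.last n)]
    simp only [smul_eq_C_mul, C_add, C_mul]
    ring
  rw [B₁, B₂] at B
  simp only [map_sub, map_add, map_smul, smul_eq_mul] at B
  have hA₀ : headAverage μ q τ α₁ (n + 1) m = E (Z * h₀ * Θ) := rfl
  have hA₁ : headAverage μ q τ α₁ (n + 1) (m + 1) = E (Z * h₁ * Θ) := rfl
  rw [hA₀, hA₁]
  rw [show 2 * n - m = n + (n - m) by omega, pow_add]
  have hn : t ^ n = t ^ m * t ^ (n - m) := by rw [← pow_add]; congr 1; omega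
  rw [← hE, L, M, R₁, R₂, hn] at B
  rw [hn]
  linear_combination α₁ * B + t ^ m * t ^ (n - m) * b₁ * b₂ * t ^ (n - m) * N

/-- The functional of a product of one-variable polynomials factors. -/
theorem momentFunctional_prod_sum {ι : Type*} (μ : ℕ → ℂ) (s : Finset ι) (c : Fin n → ι → ℂ)
    (e : Fin n → ι → ℕ) :
    momentFunctional μ n (∏ i, ∑ l ∈ s, C (c i l) * X i ^ e i l) =
      ∏ i, ∑ l ∈ s, c i l * μ (e i l) := by
  classical
  rw [Finset.prod_univ_sum, Finset.prod_univ_sum, map_sum]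
  refine Finset.sum_congr rfl fun p _ => ?_
  rw [Finset.prod_mul_distrib, ← map_prod, momentFunctional_C_mul_prod, Finset.prod_mul_distrib]

/-- Multiplying the weight by `1 - α z` multiplies the integrand by `∏ᵢ (1 - α zᵢ)`. -/
theorem momentFunctional_mul_prod {μ μ' : ℕ → ℂ} {α : ℂ} {D : ℕ}
    (h : ∀ k, k ≠ 0 → k ≤ D → μ' k = μ k - α * μ (k + 1)) (p : MvPolynomial (Fin n) ℂ)
    (hp : ∀ d ∈ p.support, ∀ i, d i ≠ 0 ∧ d i ≤ D) :
    momentFunctional μ' n p = momentFunctional μ n ((∏ i, (1 - C α * X i)) * p) := by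
  rw [p.as_sum, Finset.mul_sum, map_sum, map_sum]
  refine Finset.sum_congr rfl fun d hd => ?_
  rw [momentFunctional_monomial, monomial_eq_C_mul_prod, mul_left_comm, ← Finset.prod_mul_distrib,
    ← smul_eq_C_mul, map_smul, smul_eq_mul]
  have := momentFunctional_prod_sum μ (Finset.range 2) (fun (_ : Fin n) l => if l = 0 then 1 else -α)
    (fun i l => d i + l)
  simp only [Finset.sum_range_succ, Finset.sum_range_zero] at this
  congr 1
  refine Eq.trans (Finset.prod_congr rfl fun i _ => h (d i) (hp d hd i).1 (hp d hd i).2) ?_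
  refine Eq.trans (Finset.prod_congr rfl fun i _ => ?_) (this.symm.trans (congrArg _
    (Finset.prod_congr rfl fun i _ => ?_)))
  · simp; ring
  · simp [pow_succ]; ring

theorem support_prod_X_mul {p : MvPolynomial (Fin n) ℂ} {D : ℕ} (hp : ∀ i, p.degreeOf i ≤ D) :
    ∀ d ∈ ((∏ j, X j) * p).support, ∀ i, d i ≠ 0 ∧ d i ≤ D + 1 := by
  intro d hd i
  set s : Fin n →₀ ℕ := Finsupp.equivFunOnFinite.symm fun _ => 1 with hs
  have hX : (∏ j, X j : MvPolynomial (Fin n) ℂ) = monomial s 1 := by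
    rw [monomial_eq_C_mul_prod]; simp [hs]
  rw [hX, mem_support_iff, coeff_monomial_mul', one_mul] at hd
  split_ifs at hd with hle
  · have h₁ : 1 ≤ d i := by simpa [hs] using hle i
    have h₂ := (monomial_le_degreeOf i (mem_support_iff.2 hd)).trans (hp i)
    have h₃ : (d - s) i = d i - 1 := by simp [hs]
    omega
  · exact absurd rfl hd

theorem headAverage_shift {μ μ' : ℕ → ℂ} {α : ℂ} {q : ℂ} {τ : ℕ} (β : ℂ)
    (h : ∀ k, k ≠ 0 → k ≤ 2 * (n - 1) * τ + 1 → μ' k = μ k - α * μ (k + 1)) :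
    headAverage μ' q τ β n 0 = headAverage μ q τ α n n := by
  have h₀ : headProd β n 0 = 1 := by simp [headProd]
  have h₁ : headProd α n n = ∏ i, (1 - C α * X i) := by simp [headProd]
  rw [headAverage, headAverage, h₀, h₁, mul_one, momentFunctional_mul_prod h _
    (support_prod_X_mul (degreeOf_ordKernel_le q τ n))]
  congr 1; ring

/-- The integral of the ordered kernel. -/
noncomputable def ordIntegral (μ : ℕ → ℂ) (q : ℂ) (τ n : ℕ) : ℂ :=
  momentFunctional μ n ((∏ j, X j) * ordKernel q τ n)

theorem headAverage_zero (μ : ℕ → ℂ) (q : ℂ) (τ : ℕ) (α : ℂ) (n : ℕ) :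
    headAverage μ q τ α n 0 = ordIntegral μ q τ n := by
  simp [headAverage, headProd, ordIntegral]

theorem headAverage_full {q α₁ α₂ b₁ b₂ : ℂ} {τ K : ℕ} (hτ : 1 ≤ τ) {μ : ℕ → ℂ}
    (hμ : MomentRel q α₁ α₂ b₁ b₂ K μ) (hK : 2 * n * τ < K) :
    headAverage μ q τ α₁ (n + 1) (n + 1) *
        ∏ m ∈ Finset.range (n + 1), (b₁ * b₂ * (q ^ τ) ^ (2 * n - m) - α₁ * α₂) =
      (∏ m ∈ Finset.range (n + 1),
        (q ^ τ) ^ m * (α₁ - (q ^ τ) ^ (n - m) * b₁) * (α₁ - (q ^ τ) ^ (n - m) * b₂)) *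
        ordIntegral μ q τ (n + 1) := by
  have : ∀ N ≤ n + 1, headAverage μ q τ α₁ (n + 1) N *
        ∏ m ∈ Finset.range N, (b₁ * b₂ * (q ^ τ) ^ (2 * n - m) - α₁ * α₂) =
      (∏ m ∈ Finset.range N,
        (q ^ τ) ^ m * (α₁ - (q ^ τ) ^ (n - m) * b₁) * (α₁ - (q ^ τ) ^ (n - m) * b₂)) *
        ordIntegral μ q τ (n + 1) := by
    intro N
    induction N with
    | zero => intro _; simp [headAverage_zero]
    | succ N ih =>
      intro hN
      have h₁ := ih (by omega)
      have h₂ := headAverage_succ (n := n) hτ hμ hK (m := N) (by omega)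
      rw [Finset.prod_range_succ, Finset.prod_range_succ]
      set P := ∏ m ∈ Finset.range N, (b₁ * b₂ * (q ^ τ) ^ (2 * n - m) - α₁ * α₂)
      linear_combination P * h₂ +
        (q ^ τ) ^ N * (α₁ - (q ^ τ) ^ (n - N) * b₁) * (α₁ - (q ^ τ) ^ (n - N) * b₂) * h₁
  exact this _ le_rfl

end Recursion

/-! ### Symmetrization of the kernel -/

section Symmetrization

open Polynomial in
/-- Lagrange interpolation of `∏ (X - t z_k) - ∏ (X - z_k)` at the points `z_k`, evaluated at `0`. -/
theorem sum_prod_sub_mul_div {K : Type*} [Field K] (t : K) {n : ℕ} {z : Fin n → K}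
    (hz : Function.Injective z) (hz0 : ∀ i, z i ≠ 0) :
    (1 - t) * ∑ i, ∏ k ∈ Finset.univ.erase i, (z i - t * z k) / (z i - z k) = 1 - t ^ n := by
  classical
  set P : K[X] := ∏ k, (X - C (t * z k)) - ∏ k, (X - C (z k)) with hP
  have m₁ := monic_prod_X_sub_C (fun k => t * z k) (Finset.univ : Finset (Fin n))
  have m₂ := monic_prod_X_sub_C z (Finset.univ : Finset (Fin n))
  have d₁ : (∏ k, (X - C (t * z k)) : K[X]).degree = (n : WithBot ℕ) := by
    rw [degree_prod, Finset.sum_congr rfl fun k _ => degree_X_sub_C _]; simp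
  have d₂ : (∏ k, (X - C (z k)) : K[X]).degree = (n : WithBot ℕ) := by
    rw [degree_prod, Finset.sum_congr rfl fun k _ => degree_X_sub_C _]; simp
  have hdeg : P.degree < (Finset.univ : Finset (Fin n)).card := by
    rcases n with _ | n
    · simp [hP]
    · have := degree_sub_lt_left (d₁.trans d₂.symm) m₁.ne_zero (m₁.leadingCoeff.trans m₂.leadingCoeff.symm)
      rw [d₁] at this
      rwa [Finset.card_univ, Fintype.card_fin]
  have h := congrArg (eval 0) (Lagrange.eq_interpolate (s := Finset.univ) hz.injOn hdeg)
  have hPi : ∀ i, eval (z i) P = (1 - t) * z i * ∏ k ∈ Finset.univ.erase i, (z i - t * z k) := by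
    intro i
    have h0 : ∏ k, eval (z i) (X - C (z k)) = 0 :=
      Finset.prod_eq_zero (Finset.mem_univ i) (by simp)
    rw [hP, eval_sub, eval_prod, eval_prod, h0, sub_zero, ← Finset.mul_prod_erase _ _ (Finset.mem_univ i)]
    simp only [eval_sub, eval_X, eval_C]
    ring
  rw [Lagrange.interpolate_apply, eval_finsetSum] at h
  have hterm : ∀ i, eval 0 (C (eval (z i) P) * Lagrange.basis Finset.univ z i) =
      -((1 - t) * (∏ k, (-z k)) * ∏ k ∈ Finset.univ.erase i, (z i - t * z k) / (z i - z k)) := by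
    intro i
    rw [eval_mul, eval_C, hPi, Lagrange.basis, eval_prod,
      ← Finset.mul_prod_erase _ (fun k => -z k) (Finset.mem_univ i)]
    have : ∏ k ∈ Finset.univ.erase i, eval 0 (Lagrange.basisDivisor (z i) (z k)) =
        (∏ k ∈ Finset.univ.erase i, (-z k)) * ∏ k ∈ Finset.univ.erase i, (z i - z k)⁻¹ := by
      rw [← Finset.prod_mul_distrib]
      exact Finset.prod_congr rfl fun k _ => by simp [Lagrange.basisDivisor, mul_comm]
    rw [this]
    simp only [div_eq_mul_inv, Finset.prod_mul_distrib]
    ring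
  rw [Finset.sum_congr rfl fun i _ => hterm i, Finset.sum_neg_distrib, ← Finset.mul_sum, hP,
    eval_sub, eval_prod, eval_prod] at h
  simp only [eval_sub, eval_X, eval_C, zero_sub] at h
  have hprod : ∏ k, (-(t * z k)) = t ^ n * ∏ k, (-z k) := by
    simp_rw [← mul_neg]
    rw [Finset.prod_mul_distrib]; simp
  rw [hprod] at h
  have hne : ∏ k, (-z k) ≠ 0 := Finset.prod_ne_zero_iff.2 fun k _ => neg_ne_zero.2 (hz0 k)
  refine mul_left_cancel₀ hne ?_
  linear_combination h

/-- The symmetrization of `∏_{j<k} (z_j - t z_k) / (z_j - z_k)` is the `t`-factorial. -/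
theorem sum_perm_pairProd {K : Type*} [Field K] (t : K) {n : ℕ} {z : Fin n → K}
    (hz : Function.Injective z) (hz0 : ∀ i, z i ≠ 0) :
    (1 - t) ^ n * ∑ σ : Equiv.Perm (Fin n),
      pairProd (fun j k => (z (σ j) - t * z (σ k)) / (z (σ j) - z (σ k))) =
    ∏ k ∈ Finset.range n, (1 - t ^ (k + 1)) := by
  induction n with
  | zero => simp [pairProd]
  | succ n ih =>
    rw [← Equiv.sum_comp Equiv.Perm.decomposeFin.symm, Fintype.sum_prod_type]
    have inner : ∀ p : Fin (n + 1), (1 - t) ^ n * ∑ e : Equiv.Perm (Fin n),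
        pairProd (fun j k : Fin (n + 1) =>
          (z (Equiv.Perm.decomposeFin.symm (p, e) j) -
            t * z (Equiv.Perm.decomposeFin.symm (p, e) k)) /
          (z (Equiv.Perm.decomposeFin.symm (p, e) j) -
            z (Equiv.Perm.decomposeFin.symm (p, e) k))) =
        (∏ k ∈ Finset.univ.erase p, (z p - t * z k) / (z p - z k)) *
          ∏ k ∈ Finset.range n, (1 - t ^ (k + 1)) := by
      intro p
      set y : Fin n → K := fun k => z (Equiv.swap 0 p k.succ)
      have hy : Function.Injective y := fun a b hab =>
        Fin.succ_injective _ ((Equiv.swap 0 p).injective (hz hab))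
      rw [← ih hy fun i => hz0 _, mul_left_comm]
      congr 1
      rw [Finset.mul_sum]
      refine Finset.sum_congr rfl fun e _ => ?_
      rw [pairProd_succ]
      simp only [Equiv.Perm.decomposeFin_symm_apply_zero, Equiv.Perm.decomposeFin_symm_apply_succ]
      congr 1
      rw [Equiv.prod_comp e fun k => (z p - t * z (Equiv.swap 0 p k.succ)) /
        (z p - z (Equiv.swap 0 p k.succ))]
      refine Finset.prod_bij (fun k _ => Equiv.swap 0 p k.succ) (fun k _ => ?_)
        (fun a _ b _ hab => Fin.succ_injective _ ((Equiv.swap 0 p).injective hab))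
        (fun b hb => ?_) (fun k _ => rfl)
      · rw [Finset.mem_erase]
        refine ⟨fun h => Fin.succ_ne_zero k ?_, Finset.mem_univ _⟩
        rw [← Equiv.swap_apply_left 0 p] at h
        exact (Equiv.swap 0 p).injective h
      · have hb' : Equiv.swap 0 p b ≠ 0 := by
          intro h
          rw [Equiv.swap_apply_eq_iff, Equiv.swap_apply_left] at h
          exact (Finset.mem_erase.1 hb).1 h
        obtain ⟨k, hk⟩ := Fin.exists_succ_eq.2 hb'
        exact ⟨k, Finset.mem_univ _, by rw [hk, Equiv.swap_apply_self]⟩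
    rw [pow_succ, mul_assoc, mul_left_comm, Finset.mul_sum,
      Finset.sum_congr rfl fun p _ => inner p, ← Finset.sum_mul, ← mul_assoc,
      sum_prod_sub_mul_div t hz hz0, Finset.prod_range_succ, mul_comm]

open MvPolynomial

variable {n : ℕ}

/-- The polynomial `∏ᵢ zᵢ^((n-1)τ) ∏_{j<k} (z_j/z_k)_τ (z_k/z_j)_τ`. -/
noncomputable def symKernel (q : ℂ) (τ n : ℕ) : MvPolynomial (Fin n) ℂ :=
  pairProd fun j k => symPair q τ (X j) (X k)

theorem degreeOf_symKernel_le (q : ℂ) (τ n : ℕ) (i : Fin n) :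
    (symKernel q τ n).degreeOf i ≤ 2 * (n - 1) * τ :=
  degreeOf_pairProd_le i (degreeOf_symPair_le q τ i)

theorem rename_symKernel (q : ℂ) (τ n : ℕ) (σ : Equiv.Perm (Fin n)) :
    rename σ (symKernel q τ n) = symKernel q τ n := by
  have h₁ := Equiv.Perm.prod_Ioi_comp_eq_sign_mul_prod σ
    (f := fun j k => (X j - X k : MvPolynomial (Fin n) ℂ)) (fun i j => (neg_sub _ _).symm)
  have h₂ := Equiv.Perm.prod_Ioi_comp_eq_sign_mul_prod σ
    (f := fun j k => (X j - X k : MvPolynomial (Fin n) ℂ) * symPair q τ (X j) (X k))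
    (fun i j => by rw [symPair_comm]; ring)
  simp only [Finset.prod_mul_distrib] at h₂
  rw [h₁, mul_assoc] at h₂
  have hs : ((Equiv.Perm.sign σ : ℤ) : MvPolynomial (Fin n) ℂ) ≠ 0 := by
    rcases Int.units_eq_one_or (Equiv.Perm.sign σ) with h | h <;> simp [h]
  have hv : ∏ j : Fin n, ∏ k ∈ Finset.Ioi j, (X j - X k : MvPolynomial (Fin n) ℂ) ≠ 0 := by
    refine Finset.prod_ne_zero_iff.2 fun j _ => Finset.prod_ne_zero_iff.2 fun k hk => ?_
    rw [sub_ne_zero]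
    exact fun h => (Finset.mem_Ioi.1 hk).ne (X_injective h)
  have h := mul_left_cancel₀ hv (mul_left_cancel₀ hs h₂)
  rw [symKernel, ← AlgHom.coe_toRingHom, map_pairProd]
  simpa only [pairProd, AlgHom.coe_toRingHom, map_symPair, rename_X] using h

theorem ordPair_eq_div_mul {K : Type*} [Field K] [Algebra ℂ K] {τ : ℕ} (hτ : 1 ≤ τ) (q : ℂ)
    {x y : K} (hxy : x ≠ y) : ordPair q τ x y =
      (x - algebraMap ℂ K (q ^ τ) * y) / (x - y) * symPair q τ x y := by
  have := sub_ne_zero.2 hxy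
  rw [ordPair_eq hτ, symPair_eq hτ, Algebra.smul_def]
  field_simp

theorem sum_rename_ordKernel {τ : ℕ} (hτ : 1 ≤ τ) (q : ℂ) (n : ℕ) :
    (1 - C (q ^ τ)) ^ n * ∑ σ : Equiv.Perm (Fin n), rename σ (ordKernel q τ n) =
      (∏ k ∈ Finset.range n, (1 - C (q ^ τ) ^ (k + 1))) * symKernel q τ n := by
  set K := FractionRing (MvPolynomial (Fin n) ℂ)
  set φ : MvPolynomial (Fin n) ℂ →ₐ[ℂ] K := Algebra.algHom ℂ _ K
  have hφ : Function.Injective φ := FaithfulSMul.algebraMap_injective _ K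
  refine hφ ?_
  have hz : Function.Injective fun i => φ (X i) := hφ.comp X_injective
  have key := sum_perm_pairProd (φ (C (q ^ τ))) hz fun i => by
    rw [ne_eq, map_eq_zero_iff φ hφ]; exact X_ne_zero i
  have hord : ∀ x y : K, x ≠ y → ordPair q τ x y =
      (x - φ (C (q ^ τ)) * y) / (x - y) * symPair q τ x y := by
    intro x y hxy
    rw [ordPair_eq_div_mul hτ q hxy,
      show algebraMap ℂ K (q ^ τ) = φ (C (q ^ τ)) from (φ.commutes _).symm]
  have hσ : ∀ σ : Equiv.Perm (Fin n), φ (rename σ (ordKernel q τ n)) =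
      pairProd (fun j k => (φ (X (σ j)) - φ (C (q ^ τ)) * φ (X (σ k))) /
        (φ (X (σ j)) - φ (X (σ k)))) * φ (symKernel q τ n) := by
    intro σ
    rw [← rename_symKernel q τ n σ, ordKernel, symKernel]
    simp only [← AlgHom.coe_toRingHom, map_pairProd]
    simp only [AlgHom.coe_toRingHom, map_symPair, map_ordPair, rename_X]
    rw [← pairProd_mul]
    exact pairProd_congr fun j k hjk => hord _ _ fun h => hjk.ne (σ.injective (hz h))
  rw [map_mul, map_mul, map_sum, map_pow, map_prod, Finset.sum_congr rfl fun σ _ => hσ σ,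
    ← Finset.sum_mul, ← mul_assoc, map_sub, map_one, key]
  simp only [map_sub, map_one, map_pow]

/-- The integral of the symmetric kernel. -/
noncomputable def symIntegral (μ : ℕ → ℂ) (q : ℂ) (τ n : ℕ) : ℂ :=
  momentFunctional μ n ((∏ j, X j) * symKernel q τ n)

theorem symIntegral_eq {τ : ℕ} (hτ : 1 ≤ τ) (μ : ℕ → ℂ) (q : ℂ) (n : ℕ) :
    (∏ k ∈ Finset.range n, (1 - (q ^ τ) ^ (k + 1))) * symIntegral μ q τ n =
      n.factorial * (1 - q ^ τ) ^ n * ordIntegral μ q τ n := by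
  have h := congrArg (fun p => momentFunctional μ n ((∏ j, X j) * p)) (sum_rename_ordKernel hτ q n)
  have e₁ : (∏ j, X j) * ((1 - C (q ^ τ)) ^ n * ∑ σ : Equiv.Perm (Fin n),
      rename σ (ordKernel q τ n)) =
      (1 - q ^ τ) ^ n • ∑ σ : Equiv.Perm (Fin n), rename σ ((∏ j, X j) * ordKernel q τ n) := by
    have : ∀ σ : Equiv.Perm (Fin n), rename σ (∏ j, X j : MvPolynomial (Fin n) ℂ) = ∏ j, X j := by
      intro σ
      rw [map_prod]
      simp only [rename_X]
      rw [Equiv.prod_comp σ fun j => (X j : MvPolynomial (Fin n) ℂ)]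
    simp only [map_mul, this, ← Finset.mul_sum, smul_eq_C_mul, C_pow, C_sub, C_1]
    ring
  have e₂ : (∏ j, X j) * ((∏ k ∈ Finset.range n, (1 - C (q ^ τ) ^ (k + 1))) * symKernel q τ n) =
      (∏ k ∈ Finset.range n, (1 - (q ^ τ) ^ (k + 1))) • ((∏ j, X j) * symKernel q τ n) := by
    simp only [smul_eq_C_mul, map_prod, C_sub, C_1, C_pow]
    ring
  simp only [e₁, e₂, map_smul, map_sum, momentFunctional_rename, smul_eq_mul] at h
  rw [symIntegral, ordIntegral, ← h]
  simp [Fintype.card_perm]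
  ring

end Symmetrization

/-! ### Reduction to vanishing numerator parameters -/

/-- The standing assumptions on the base `q`, the lattices through `x₁` and `x₂`, and the poles of
the weight. -/
structure Admissible (q : ℝ) (b₁ b₂ x₁ x₂ : ℂ) : Prop where
  q_pos : 0 < q
  q_lt_one : q < 1
  x₁_ne_zero : x₁ ≠ 0
  x₂_ne_zero : x₂ ≠ 0
  avoids₁₁ : Avoids q x₁ b₁
  avoids₁₂ : Avoids q x₁ b₂
  avoids₂₁ : Avoids q x₂ b₁
  avoids₂₂ : Avoids q x₂ b₂

section

variable {q : ℝ} {b₁ b₂ x₁ x₂ : ℂ}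

theorem Admissible.norm_lt_one (h : Admissible q b₁ b₂ x₁ x₂) : ‖(q : ℂ)‖ < 1 :=
  norm_ofReal_lt_one h.q_pos h.q_lt_one

theorem Admissible.q_ne_zero (h : Admissible q b₁ b₂ x₁ x₂) : (q : ℂ) ≠ 0 := by
  exact_mod_cast h.q_pos.ne'

theorem Admissible.swap (h : Admissible q b₁ b₂ x₁ x₂) : Admissible q b₂ b₁ x₁ x₂ :=
  ⟨h.q_pos, h.q_lt_one, h.x₁_ne_zero, h.x₂_ne_zero, h.avoids₁₂, h.avoids₁₁, h.avoids₂₂, h.avoids₂₁⟩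

/-- The integral of the ordered kernel over the two lattices, without the factor `(1 - q)^n`. -/
noncomputable def ordJackson (q α₁ α₂ b₁ b₂ x₁ x₂ : ℂ) (τ n : ℕ) : ℂ :=
  ordIntegral (jacksonMoment q α₁ α₂ b₁ b₂ x₁ x₂) q τ n

theorem ordJackson_swap (q α₁ α₂ b₁ b₂ x₁ x₂ : ℂ) (τ n : ℕ) :
    ordJackson q α₁ α₂ b₁ b₂ x₁ x₂ τ n = ordJackson q α₂ α₁ b₁ b₂ x₁ x₂ τ n := by
  rw [ordJackson, ordJackson, jacksonMoment_swap]

theorem ordJackson_swap_right (q α₁ α₂ b₁ b₂ x₁ x₂ : ℂ) (τ n : ℕ) :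
    ordJackson q α₁ α₂ b₁ b₂ x₁ x₂ τ n = ordJackson q α₁ α₂ b₂ b₁ x₁ x₂ τ n := by
  rw [ordJackson, ordJackson, jacksonMoment_swap_right]

theorem ordJackson_step (h : Admissible q b₁ b₂ x₁ x₂) (hb₁ : b₁ ≠ 0) (hb₂ : b₂ ≠ 0)
    {τ : ℕ} (hτ : 1 ≤ τ) (n : ℕ) {α₁ α₂ : ℂ}
    (hconv : q ^ 2 * ‖α₁‖ * ‖α₂‖ < q ^ (2 * n * τ + 1) * ‖b₁‖ * ‖b₂‖) :
    ordJackson q α₁ α₂ b₁ b₂ x₁ x₂ τ (n + 1) * ∏ k ∈ Finset.range (n + 1),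
        (1 - q * α₁ * α₂ * b₁⁻¹ * b₂⁻¹ * (((q : ℂ) ^ τ) ^ (n + k))⁻¹) =
      (∏ k ∈ Finset.range (n + 1), (1 - q * α₁ * b₁⁻¹ * (((q : ℂ) ^ τ) ^ k)⁻¹) *
        (1 - q * α₁ * b₂⁻¹ * (((q : ℂ) ^ τ) ^ k)⁻¹)) *
        ordJackson q (α₁ * q) α₂ b₁ b₂ x₁ x₂ τ (n + 1) := by
  have hq0 := h.q_pos
  have ht : (q : ℂ) ^ τ ≠ 0 := pow_ne_zero _ h.q_ne_zero
  have hb : 0 < ‖b₁‖ * ‖b₂‖ := by positivity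
  have hc : ∀ k ≤ 2 * n * τ + 1,
      q ^ 2 * ‖α₁ * q‖ * ‖α₂‖ < q ^ (k + 1) * ‖b₁‖ * ‖b₂‖ := by
    intro k hk
    have e := pow_le_pow_of_le_one h.q_pos.le h.q_lt_one.le hk
    rw [norm_mul, Complex.norm_real, Real.norm_of_nonneg hq0.le, pow_succ]
    calc q ^ 2 * (‖α₁‖ * q) * ‖α₂‖ = q * (q ^ 2 * ‖α₁‖ * ‖α₂‖) := by ring
      _ < q * (q ^ (2 * n * τ + 1) * ‖b₁‖ * ‖b₂‖) := by gcongr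
      _ = q ^ (2 * n * τ + 1) * (q * (‖b₁‖ * ‖b₂‖)) := by ring
      _ ≤ q ^ k * (q * (‖b₁‖ * ‖b₂‖)) := by gcongr
      _ = q ^ k * q * ‖b₁‖ * ‖b₂‖ := by ring
  have hrel := momentRel_jacksonMoment h.q_pos h.q_lt_one h.x₁_ne_zero h.x₂_ne_zero h.avoids₁₁
    h.avoids₁₂ h.avoids₂₁ h.avoids₂₂ (hc (2 * n * τ + 1) le_rfl)
  have hshift := headAverage_shift (n := n + 1) (q := q) (τ := τ) (α₁ * q)
    (μ := jacksonMoment q (α₁ * q) α₂ b₁ b₂ x₁ x₂) (μ' := jacksonMoment q α₁ α₂ b₁ b₂ x₁ x₂)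
    (α := α₁ * q) fun k hk hk' =>
      jacksonMoment_shift h.q_pos h.q_lt_one h.x₁_ne_zero h.x₂_ne_zero h.avoids₁₁
        h.avoids₁₂ h.avoids₂₁ h.avoids₂₂ hk (hc k (by simpa using hk'))
  have hfull := headAverage_full hτ hrel (Nat.lt_succ_self _)
  rw [← hshift, headAverage_zero] at hfull
  set t := (q : ℂ) ^ τ with htdef
  have e₁ : ∏ m ∈ Finset.range (n + 1), (b₁ * b₂ * t ^ (2 * n - m) - α₁ * q * α₂) =
      (∏ k ∈ Finset.range (n + 1), b₁ * b₂ * t ^ (n + k)) * ∏ k ∈ Finset.range (n + 1),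
        (1 - q * α₁ * α₂ * b₁⁻¹ * b₂⁻¹ * (t ^ (n + k))⁻¹) := by
    rw [← Finset.prod_mul_distrib, ← Finset.prod_range_reflect]
    refine Finset.prod_congr rfl fun k hk => ?_
    have hk' := Finset.mem_range.1 hk
    rw [show 2 * n - (n + 1 - 1 - k) = n + k by omega]
    field_simp
  have e₂ : ∏ m ∈ Finset.range (n + 1),
      t ^ m * (α₁ * q - t ^ (n - m) * b₁) * (α₁ * q - t ^ (n - m) * b₂) =
      (∏ k ∈ Finset.range (n + 1), b₁ * b₂ * t ^ (n + k)) * ∏ k ∈ Finset.range (n + 1),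
        (1 - q * α₁ * b₁⁻¹ * (t ^ k)⁻¹) * (1 - q * α₁ * b₂⁻¹ * (t ^ k)⁻¹) := by
    rw [← Finset.prod_mul_distrib, ← Finset.prod_range_reflect]
    refine Finset.prod_congr rfl fun k hk => ?_
    have hk' := Finset.mem_range.1 hk
    rw [show n - (n + 1 - 1 - k) = k by omega, show n + k = (n + 1 - 1 - k) + k + k by omega,
      pow_add, pow_add]
    field_simp
    ring
  rw [e₁, e₂] at hfull
  have hne : ∏ k ∈ Finset.range (n + 1), b₁ * b₂ * t ^ (n + k) ≠ 0 :=
    Finset.prod_ne_zero_iff.2 fun k _ => mul_ne_zero (mul_ne_zero hb₁ hb₂) (pow_ne_zero _ ht)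
  refine mul_left_cancel₀ hne ?_
  rw [ordJackson, ordJackson]
  linear_combination hfull

theorem ordJackson_iterate (h : Admissible q b₁ b₂ x₁ x₂) (hb₁ : b₁ ≠ 0) (hb₂ : b₂ ≠ 0)
    {τ : ℕ} (hτ : 1 ≤ τ) (n : ℕ) {α₁ α₂ : ℂ}
    (hconv : q ^ 2 * ‖α₁‖ * ‖α₂‖ < q ^ (2 * n * τ + 1) * ‖b₁‖ * ‖b₂‖) (N : ℕ) :
    ordJackson q α₁ α₂ b₁ b₂ x₁ x₂ τ (n + 1) * ∏ k ∈ Finset.range (n + 1),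
        qFin q (q * α₁ * α₂ * b₁⁻¹ * b₂⁻¹ * (((q : ℂ) ^ τ) ^ (n + k))⁻¹) N =
      (∏ k ∈ Finset.range (n + 1), qFin q (q * α₁ * b₁⁻¹ * (((q : ℂ) ^ τ) ^ k)⁻¹) N *
        qFin q (q * α₁ * b₂⁻¹ * (((q : ℂ) ^ τ) ^ k)⁻¹) N) *
        ordJackson q (α₁ * (q : ℂ) ^ N) α₂ b₁ b₂ x₁ x₂ τ (n + 1) := by
  induction N with
  | zero => simp
  | succ N ih =>
    have hc : q ^ 2 * ‖α₁ * (q : ℂ) ^ N‖ * ‖α₂‖ < q ^ (2 * n * τ + 1) * ‖b₁‖ * ‖b₂‖ := by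
      refine lt_of_le_of_lt ?_ hconv
      have hq0 := h.q_pos
      rw [norm_mul, norm_pow, Complex.norm_real, Real.norm_of_nonneg hq0.le]
      have := mul_le_of_le_one_right (norm_nonneg α₁) (pow_le_one₀ hq0.le h.q_lt_one.le (n := N))
      gcongr
    have hs := ordJackson_step h hb₁ hb₂ hτ n hc
    simp only [qFin_succ, Finset.prod_mul_distrib] at hs ih ⊢
    rw [← mul_assoc, ih]
    have e₁ : ∀ c d : ℂ, (q : ℂ) * (α₁ * (q : ℂ) ^ N) * c * d = (q : ℂ) ^ N * (q * α₁ * c * d) :=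
      fun c d => by ring
    have e₂ : ∀ c d e f : ℂ, (q : ℂ) * (α₁ * (q : ℂ) ^ N) * c * d * e * f =
      (q : ℂ) ^ N * (q * α₁ * c * d * e * f) := fun c d e f => by ring
    simp only [e₂] at hs
    simp only [e₁] at hs
    rw [pow_succ (q : ℂ) N, ← mul_assoc α₁]
    linear_combination (∏ k ∈ Finset.range (n + 1), qFin q (q * α₁ * b₁⁻¹ * (((q : ℂ) ^ τ) ^ k)⁻¹) N)
      * (∏ k ∈ Finset.range (n + 1), qFin q (q * α₁ * b₂⁻¹ * (((q : ℂ) ^ τ) ^ k)⁻¹) N) * hs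

theorem tendsto_momentFunctional {ι : Type*} {l : Filter ι} {μ : ι → ℕ → ℂ} {ν : ℕ → ℂ} {n : ℕ}
    (p : MvPolynomial (Fin n) ℂ)
    (h : ∀ d ∈ p.support, ∀ i, Tendsto (fun N => μ N (d i)) l (𝓝 (ν (d i)))) :
    Tendsto (fun N => momentFunctional (μ N) n p) l (𝓝 (momentFunctional ν n p)) := by
  simp only [momentFunctional_eq_sum]
  exact tendsto_finsetSum _ fun d hd => (tendsto_finsetProd _ fun i _ => h d hd i).const_mul _

/-- The dependence on `α₁`: the recursion is iterated along `α₁ q^N → 0`. -/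
theorem ordJackson_reduce_left (h : Admissible q b₁ b₂ x₁ x₂) (hb₁ : b₁ ≠ 0) (hb₂ : b₂ ≠ 0)
    {τ : ℕ} (hτ : 1 ≤ τ) (n : ℕ) {α₁ α₂ : ℂ}
    (hconv : q ^ 2 * ‖α₁‖ * ‖α₂‖ < q ^ (2 * n * τ + 1) * ‖b₁‖ * ‖b₂‖) :
    ordJackson q α₁ α₂ b₁ b₂ x₁ x₂ τ (n + 1) * ∏ k ∈ Finset.range (n + 1),
        qInf q (q * α₁ * α₂ * b₁⁻¹ * b₂⁻¹ * (((q : ℂ) ^ τ) ^ (n + k))⁻¹) =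
      (∏ k ∈ Finset.range (n + 1), qInf q (q * α₁ * b₁⁻¹ * (((q : ℂ) ^ τ) ^ k)⁻¹) *
        qInf q (q * α₁ * b₂⁻¹ * (((q : ℂ) ^ τ) ^ k)⁻¹)) *
        ordJackson q 0 α₂ b₁ b₂ x₁ x₂ τ (n + 1) := by
  have hF := fun c : ℂ => tendsto_qFin h.norm_lt_one c
  have hlim : Tendsto (fun N : ℕ => ordJackson q (α₁ * (q : ℂ) ^ N) α₂ b₁ b₂ x₁ x₂ τ (n + 1)) atTop
      (𝓝 (ordJackson q 0 α₂ b₁ b₂ x₁ x₂ τ (n + 1))) := by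
    refine tendsto_momentFunctional _ fun d hd i => ?_
    have hdi := support_prod_X_mul (degreeOf_ordKernel_le (q : ℂ) τ (n + 1)) d hd i
    exact tendsto_jacksonMoment h.q_pos h.q_lt_one h.x₁_ne_zero h.x₂_ne_zero h.avoids₁₁
      h.avoids₁₂ h.avoids₂₁ h.avoids₂₂ hdi.2 hconv
  have l := (tendsto_finsetProd (Finset.range (n + 1)) fun k _ =>
    hF (q * α₁ * α₂ * b₁⁻¹ * b₂⁻¹ * (((q : ℂ) ^ τ) ^ (n + k))⁻¹)).const_mul
      (ordJackson q α₁ α₂ b₁ b₂ x₁ x₂ τ (n + 1))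
  have r := (tendsto_finsetProd (Finset.range (n + 1)) fun k _ =>
    (hF (q * α₁ * b₁⁻¹ * (((q : ℂ) ^ τ) ^ k)⁻¹)).mul
      (hF (q * α₁ * b₂⁻¹ * (((q : ℂ) ^ τ) ^ k)⁻¹))).mul hlim
  exact tendsto_nhds_unique (l.congr fun N => ordJackson_iterate h hb₁ hb₂ hτ n hconv N) r

/-- The dependence of the integral on the numerator parameters `α₁, α₂`. -/
theorem ordJackson_reduce (h : Admissible q b₁ b₂ x₁ x₂) (hb₁ : b₁ ≠ 0) (hb₂ : b₂ ≠ 0)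
    {τ : ℕ} (hτ : 1 ≤ τ) (n : ℕ) {α₁ α₂ : ℂ}
    (hconv : q ^ 2 * ‖α₁‖ * ‖α₂‖ < q ^ (2 * n * τ + 1) * ‖b₁‖ * ‖b₂‖) :
    ordJackson q α₁ α₂ b₁ b₂ x₁ x₂ τ (n + 1) * ∏ k ∈ Finset.range (n + 1),
        qInf q (q * α₁ * α₂ * b₁⁻¹ * b₂⁻¹ * (((q : ℂ) ^ τ) ^ (n + k))⁻¹) =
      (∏ k ∈ Finset.range (n + 1), (qInf q (q * α₁ * b₁⁻¹ * (((q : ℂ) ^ τ) ^ k)⁻¹) *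
        qInf q (q * α₁ * b₂⁻¹ * (((q : ℂ) ^ τ) ^ k)⁻¹) *
        qInf q (q * α₂ * b₁⁻¹ * (((q : ℂ) ^ τ) ^ k)⁻¹) *
        qInf q (q * α₂ * b₂⁻¹ * (((q : ℂ) ^ τ) ^ k)⁻¹))) *
        ordJackson q 0 0 b₁ b₂ x₁ x₂ τ (n + 1) := by
  have h₁ := ordJackson_reduce_left h hb₁ hb₂ hτ n hconv
  have hq0 := h.q_pos
  have h₂ := ordJackson_reduce_left h hb₁ hb₂ hτ n (α₁ := α₂) (α₂ := 0)
    (by rw [norm_zero, mul_zero]; positivity)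
  rw [ordJackson_swap q 0 α₂] at h₁
  simp only [mul_zero, zero_mul, qInf_zero, Finset.prod_const_one, mul_one] at h₂
  rw [h₁, h₂]
  simp only [Finset.prod_mul_distrib]
  ring

end

/-! ### A finite solution of the moment relations -/

section FiniteMoment

/-- The weights of the finite functional which corresponds to the numerator parameters
`(b₁ q^M, 0)`: up to normalization these are the residues of `1 / ((b₁ z)_{M+1} (b₂ z)_∞)` at the
points `q^{-i} / b₁`, with `ε = b₁ / b₂`. -/
noncomputable def nodeWeight (q ε : ℂ) (M i : ℕ) : ℂ :=
  qFin q q M * (ε ^ i * q ^ (i * (i + 1))) / (qFin q q (M - i) * (qFin q q i * qFin q (q * ε) i))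

/-- The moments of the finite functional supported on the points `q^{-i} / b`, for `i ≤ M`. -/
noncomputable def nodeMoment (q ε b : ℂ) (M k : ℕ) : ℂ :=
  ∑ i ∈ Finset.range (M + 1), nodeWeight q ε M i * ((q ^ i)⁻¹ * b⁻¹) ^ k

variable {q ε : ℂ}

theorem one_sub_pow_ne_zero (hq : ‖q‖ < 1) {k : ℕ} (hk : k ≠ 0) : 1 - q ^ k ≠ 0 := by
  refine sub_ne_zero.2 fun h => ?_
  have := pow_lt_one₀ (norm_nonneg q) hq hk
  rw [← norm_pow, ← h, norm_one] at this
  exact lt_irrefl _ this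

theorem qFin_self_ne_zero (hq : ‖q‖ < 1) (N : ℕ) : qFin q q N ≠ 0 :=
  qFin_ne_zero_of_qInf hq (qInf_ne_zero_of_norm_lt_one hq hq) N

theorem norm_mul_lt_one (hq : ‖q‖ < 1) (hε : ‖ε‖ ≤ 1) : ‖q * ε‖ < 1 := by
  rw [norm_mul]
  exact (mul_le_of_le_one_right (norm_nonneg _) hε).trans_lt hq

theorem qFin_mul_ne_zero (hq : ‖q‖ < 1) (hε : ‖ε‖ ≤ 1) (N : ℕ) : qFin q (q * ε) N ≠ 0 :=
  qFin_ne_zero_of_qInf hq (qInf_ne_zero_of_norm_lt_one hq (norm_mul_lt_one hq hε)) N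

theorem nodeWeight_succ (hq : ‖q‖ < 1) (hε : ‖ε‖ ≤ 1) {M i : ℕ} (hi : i < M) :
    nodeWeight q ε M (i + 1) * ((1 - q ^ (i + 1)) * (1 - ε * q ^ (i + 1))) =
      nodeWeight q ε M i * ((1 - q ^ (M - i)) * (ε * q ^ (2 * (i + 1)))) := by
  obtain ⟨m, rfl⟩ := Nat.exists_eq_add_of_lt hi
  have e₁ : qFin q q (m + 1) = qFin q q m * (1 - q ^ (m + 1)) := by rw [qFin_succ, pow_succ]
  have e₂ : qFin q q (i + 1) = qFin q q i * (1 - q ^ (i + 1)) := by rw [qFin_succ, pow_succ]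
  have e₃ : qFin q (q * ε) (i + 1) = qFin q (q * ε) i * (1 - ε * q ^ (i + 1)) := by
    rw [qFin_succ, pow_succ]; ring
  have n₁ := qFin_self_ne_zero hq (m + 1)
  have n₂ := qFin_self_ne_zero hq (i + 1)
  have n₃ := qFin_mul_ne_zero hq hε (i + 1)
  rw [e₁] at n₁
  rw [e₂] at n₂
  rw [e₃] at n₃
  rw [nodeWeight, nodeWeight, show i + m + 1 - (i + 1) = m by omega,
    show i + m + 1 - i = m + 1 by omega, e₁, e₂, e₃]
  have a₁ := left_ne_zero_of_mul n₁
  have a₂ := right_ne_zero_of_mul n₁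
  have a₃ := left_ne_zero_of_mul n₂
  have a₄ := right_ne_zero_of_mul n₂
  have a₅ := left_ne_zero_of_mul n₃
  have a₆ := right_ne_zero_of_mul n₃
  generalize qFin q q (i + m + 1) = Q
  generalize qFin q q m = A at *
  generalize qFin q q i = B at *
  generalize qFin q (q * ε) i = D at *
  rw [show (i + 1) * (i + 1 + 1) = i * (i + 1) + 2 * (i + 1) by ring, pow_add, pow_succ ε]
  generalize 1 - q ^ (m + 1) = x at *
  generalize 1 - q ^ (i + 1) = y at *
  generalize 1 - ε * q ^ (i + 1) = z at *
  field_simp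
  ring

/-- The relations hold term by term, after a shift of the summation index; the boundary terms vanish
because of a zero of `1 - b₁ z` at the first point and a zero of `1 - b₁ q^M z` at the last. -/
theorem momentRel_nodeMoment (hq : ‖q‖ < 1) (hq0 : q ≠ 0) {b₁ b₂ : ℂ} (hb₁ : b₁ ≠ 0)
    (hb₂ : b₂ ≠ 0) (hε : ‖b₁ / b₂‖ ≤ 1) (M K : ℕ) :
    MomentRel q (b₁ * q ^ M) 0 b₁ b₂ K (nodeMoment q (b₁ / b₂) b₁ M) := by
  intro k _
  set d := nodeWeight q (b₁ / b₂) M with hd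
  set P : ℕ → ℂ := fun i => (q ^ i)⁻¹ * b₁⁻¹ with hP
  have hm : ∀ j, nodeMoment q (b₁ / b₂) b₁ M j = ∑ i ∈ Finset.range (M + 1), d i * P i ^ j :=
    fun j => rfl
  have hl : nodeMoment q (b₁ / b₂) b₁ M k -
      (b₁ * q ^ M + 0) * nodeMoment q (b₁ / b₂) b₁ M (k + 1) +
      b₁ * q ^ M * 0 * nodeMoment q (b₁ / b₂) b₁ M (k + 2) =
      ∑ i ∈ Finset.range (M + 1), d i * P i ^ k * (1 - b₁ * q ^ M * P i) := by
    rw [mul_zero, zero_mul, add_zero, add_zero, hm, hm, Finset.mul_sum, ← Finset.sum_sub_distrib]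
    exact Finset.sum_congr rfl fun i _ => by ring
  have hr : q ^ k * (nodeMoment q (b₁ / b₂) b₁ M k -
      (b₁ + b₂) * nodeMoment q (b₁ / b₂) b₁ M (k + 1) +
      b₁ * b₂ * nodeMoment q (b₁ / b₂) b₁ M (k + 2)) =
      ∑ i ∈ Finset.range (M + 1), q ^ k * (d i * P i ^ k * ((1 - b₁ * P i) * (1 - b₂ * P i))) := by
    rw [hm, hm, hm, Finset.mul_sum, Finset.mul_sum, ← Finset.sum_sub_distrib,
      ← Finset.sum_add_distrib, Finset.mul_sum]
    exact Finset.sum_congr rfl fun i _ => by ring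
  have h0 : 1 - b₁ * P 0 = 0 := by simp [hP, hb₁]
  have hM : 1 - b₁ * q ^ M * P M = 0 := by
    have := pow_ne_zero M hq0
    simp only [hP]; field_simp; ring
  rw [hl, hr, Finset.sum_range_succ, hM, Finset.sum_range_succ', h0]
  simp only [mul_zero, zero_mul, add_zero]
  refine Finset.sum_congr rfl fun i hi => ?_
  have hi' := Finset.mem_range.1 hi
  have hs := nodeWeight_succ hq hε hi'
  have hqi := pow_ne_zero (i + 1) hq0
  obtain ⟨m, rfl⟩ := Nat.exists_eq_add_of_le hi'.le
  rw [Nat.add_sub_cancel_left] at hs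
  have e₁ : 1 - b₁ * q ^ (i + m) * P i = 1 - q ^ m := by
    have := pow_ne_zero i hq0
    simp only [hP, pow_add]; field_simp
  have e₂ : P (i + 1) = q⁻¹ * P i := by
    simp only [hP, pow_succ, mul_inv]; ring
  have e₃ : (1 - b₁ * P (i + 1)) * (1 - b₂ * P (i + 1)) * (b₁ / b₂ * q ^ (2 * (i + 1))) =
      (1 - q ^ (i + 1)) * (1 - b₁ / b₂ * q ^ (i + 1)) := by
    simp only [hP]
    rw [pow_mul']
    generalize q ^ (i + 1) = w at *
    field_simp
    ring
  have hc : b₁ / b₂ * q ^ (2 * (i + 1)) ≠ 0 :=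
    mul_ne_zero (div_ne_zero hb₁ hb₂) (pow_ne_zero _ hq0)
  have key : d (i + 1) * ((1 - b₁ * P (i + 1)) * (1 - b₂ * P (i + 1))) = d i * (1 - q ^ m) := by
    refine mul_right_cancel₀ hc ?_
    rw [mul_assoc (d (i + 1)), e₃, hs]
    ring
  have hpk : q ^ k * P (i + 1) ^ k = P i ^ k := by
    rw [e₂, mul_pow, inv_pow, mul_inv_cancel_left₀ (pow_ne_zero k hq0)]
  rw [e₁, ← hpk]
  linear_combination -q ^ k * P (i + 1) ^ k * key

/-- The total mass of the finite functional `z^(k-1) ↦ nodeMoment k`. Multiplying by `1 - b₁ q^M z`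
lowers `M`, and the relation of exponent zero expresses the result by the total mass. -/
theorem nodeMoment_one (hq : ‖q‖ < 1) (hq0 : q ≠ 0) {b₁ b₂ : ℂ} (hb₁ : b₁ ≠ 0)
    (hb₂ : b₂ ≠ 0) (hε : ‖b₁ / b₂‖ ≤ 1) (M : ℕ) :
    nodeMoment q (b₁ / b₂) b₁ M 1 * qFin q (q * (b₁ / b₂)) M = b₁⁻¹ := by
  induction M with
  | zero => simp [nodeMoment, nodeWeight]
  | succ M ih =>
    have hrel := momentRel_nodeMoment hq hq0 hb₁ hb₂ hε (M + 1) 1 0 zero_lt_one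
    simp only [zero_add, pow_zero, one_mul, add_zero, mul_zero, zero_mul] at hrel
    have hlow : nodeMoment q (b₁ / b₂) b₁ (M + 1) 1 -
        b₁ * q ^ (M + 1) * nodeMoment q (b₁ / b₂) b₁ (M + 1) 2 =
        (1 - q ^ (M + 1)) * nodeMoment q (b₁ / b₂) b₁ M 1 := by
      simp only [nodeMoment]
      rw [Finset.mul_sum, ← Finset.sum_sub_distrib, Finset.sum_range_succ _ (M + 1), Finset.mul_sum]
      have : nodeWeight q (b₁ / b₂) (M + 1) (M + 1) * ((q ^ (M + 1))⁻¹ * b₁⁻¹) ^ 1 -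
          b₁ * q ^ (M + 1) * (nodeWeight q (b₁ / b₂) (M + 1) (M + 1) *
          ((q ^ (M + 1))⁻¹ * b₁⁻¹) ^ 2) = 0 := by
        have := pow_ne_zero (M + 1) hq0
        generalize nodeWeight q (b₁ / b₂) (M + 1) (M + 1) = w
        field_simp; ring
      rw [this, add_zero]
      refine Finset.sum_congr rfl fun i hi => ?_
      obtain ⟨m, rfl⟩ := Nat.exists_eq_add_of_le (Nat.lt_succ_iff.1 (Finset.mem_range.1 hi))
      have hw : nodeWeight q (b₁ / b₂) (i + m + 1) i * (1 - q ^ (m + 1)) =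
          (1 - q ^ (i + m + 1)) * nodeWeight q (b₁ / b₂) (i + m) i := by
        have n₁ := qFin_self_ne_zero hq (m + 1)
        have n₂ := qFin_self_ne_zero hq i
        have n₃ := qFin_mul_ne_zero hq hε i
        have e₁ : qFin q q (m + 1) = qFin q q m * (1 - q ^ (m + 1)) := by rw [qFin_succ, pow_succ]
        have e₂ : qFin q q (i + m + 1) = qFin q q (i + m) * (1 - q ^ (i + m + 1)) := by
          rw [qFin_succ, pow_succ]
        rw [e₁] at n₁
        rw [nodeWeight, nodeWeight, show i + m + 1 - i = m + 1 by omega,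
          show i + m - i = m by omega, e₁, e₂]
        have a₁ := left_ne_zero_of_mul n₁
        have a₂ := right_ne_zero_of_mul n₁
        generalize 1 - q ^ (m + 1) = x at *
        generalize 1 - q ^ (i + m + 1) = y at *
        field_simp
      have hP : 1 - b₁ * q ^ (i + m + 1) * ((q ^ i)⁻¹ * b₁⁻¹) = 1 - q ^ (m + 1) := by
        have := pow_ne_zero i hq0
        rw [add_assoc, pow_add]; field_simp
      rw [← hP] at hw
      linear_combination ((q ^ i)⁻¹ * b₁⁻¹) * hw
    have h1 := one_sub_pow_ne_zero hq (Nat.succ_ne_zero M)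
    have hstep : nodeMoment q (b₁ / b₂) b₁ (M + 1) 1 * (1 - q ^ M * (q * (b₁ / b₂))) =
        nodeMoment q (b₁ / b₂) b₁ M 1 := by
      refine mul_left_cancel₀ h1 ?_
      rw [← hlow, Nat.succ_eq_add_one]
      have hm2 : nodeMoment q (b₁ / b₂) b₁ (M + 1) 2 = (b₁ + b₂ - b₁ * q ^ (M + 1)) *
          nodeMoment q (b₁ / b₂) b₁ (M + 1) 1 / (b₁ * b₂) := by
        rw [eq_div_iff (mul_ne_zero hb₁ hb₂)]
        linear_combination -hrel
      rw [hm2, pow_succ]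
      field_simp
      ring
    rw [qFin_succ, ← ih, ← hstep]
    ring

/-- Two solutions of the moment relations are proportional in positive exponents. -/
theorem MomentRel.proportional {α₁ α₂ b₁ b₂ : ℂ} {K : ℕ} {μ ν : ℕ → ℂ}
    (hμ : MomentRel q α₁ α₂ b₁ b₂ K μ) (hν : MomentRel q α₁ α₂ b₁ b₂ K ν)
    (hne : ∀ k < K, α₁ * α₂ ≠ q ^ k * (b₁ * b₂)) :
    ∀ k, k ≠ 0 → k ≤ K + 1 → ν 1 * μ k = μ 1 * ν k := by
  intro k
  induction k using Nat.strong_induction_on with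
  | _ k ih =>
    intro hk hkK
    rcases k with _ | _ | k
    · exact absurd rfl hk
    · ring
    · have hkK' : k < K := by omega
      refine mul_left_cancel₀ (sub_ne_zero.2 (hne k hkK')) ?_
      have r₁ := hμ k hkK'
      have r₂ := hν k hkK'
      have i₁ := ih (k + 1) (by omega) (by omega) (by omega)
      -- the exponent `0`, which is not covered by the induction, enters with the coefficient zero
      have i₀ : (1 - q ^ k) * (ν 1 * μ k) = (1 - q ^ k) * (μ 1 * ν k) := by
        rcases k with _ | k
        · simp
        · rw [ih (k + 1) (by omega) (by omega) (by omega)]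
      linear_combination ν 1 * r₁ - μ 1 * r₂ - i₀ + ((α₁ + α₂) - q ^ k * (b₁ + b₂)) * i₁

theorem MomentRel.ordIntegral_proportional {α₁ α₂ b₁ b₂ : ℂ} {τ n K : ℕ} {μ ν : ℕ → ℂ}
    (hμ : MomentRel q α₁ α₂ b₁ b₂ K μ) (hν : MomentRel q α₁ α₂ b₁ b₂ K ν)
    (hne : ∀ k < K, α₁ * α₂ ≠ q ^ k * (b₁ * b₂)) (hK : 2 * (n - 1) * τ ≤ K) :
    ν 1 ^ n * ordIntegral μ q τ n = μ 1 ^ n * ordIntegral ν q τ n := by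
  rw [ordIntegral, ordIntegral, momentFunctional_eq_sum, momentFunctional_eq_sum, Finset.mul_sum,
    Finset.mul_sum]
  refine Finset.sum_congr rfl fun d hd => ?_
  have h := support_prod_X_mul (degreeOf_ordKernel_le q τ n) d hd
  have e : ∀ (c : ℂ) (f : Fin n → ℂ), c ^ n * ∏ i, f i = ∏ i, c * f i := fun c f => by
    rw [Finset.prod_mul_distrib]; simp
  rw [mul_left_comm, mul_left_comm (μ 1 ^ n), e, e]
  congr 1
  exact Finset.prod_congr rfl fun i _ =>
    hμ.proportional hν hne _ (h i).1 ((h i).2.trans (by omega))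

end FiniteMoment

/-! ### Evaluation of the kernel integral for the finite functional -/

section Evaluation

open MvPolynomial

/-- A tensor power of a finite combination of point evaluations. -/
theorem momentFunctional_eq_sum_eval {ι : Type*} [DecidableEq ι] {n : ℕ} {s : Finset ι}
    {c P : ι → ℂ} {μ : ℕ → ℂ} (hμ : ∀ k, μ k = ∑ i ∈ s, c i * P i ^ k)
    (p : MvPolynomial (Fin n) ℂ) :
    momentFunctional μ n p = ∑ f ∈ Fintype.piFinset fun _ : Fin n => s,
      (∏ j, c (f j)) * eval (fun j => P (f j)) p := by
  induction p using MvPolynomial.induction_on' with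
  | monomial d a =>
    rw [momentFunctional_monomial]
    simp only [hμ, Finset.prod_univ_sum, eval_monomial, Finset.mul_sum]
    refine Finset.sum_congr rfl fun f _ => ?_
    rw [Finset.prod_mul_distrib, Finsupp.prod_fintype _ _ (by simp)]
    ring
  | add p r hp hr =>
    rw [map_add, hp, hr, ← Finset.sum_add_distrib]
    exact Finset.sum_congr rfl fun f _ => by rw [map_add, mul_add]

theorem eval_ordKernel (q : ℂ) (τ n : ℕ) (z : Fin n → ℂ) :
    eval z (ordKernel q τ n) = pairProd fun j k => ordPair q τ (z j) (z k) := by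
  rw [ordKernel, map_pairProd]
  congr! 3 with j k
  have := map_ordPair (aeval z) q τ (X j) (X k)
  rw [← coe_aeval_eq_eval]
  simpa using this

/-- `n + 1` points in `{0, …, n τ}` at mutual distance at least `τ`, where the distance `τ` is only
allowed in decreasing order, are the multiples of `τ` in decreasing order. -/
theorem eq_of_separated {n τ : ℕ} (hτ : 1 ≤ τ) {f : Fin (n + 1) → ℕ} (hf : ∀ j, f j ≤ n * τ)
    (hsep : ∀ j k, j < k → f k + τ ≤ f j ∨ f j + τ < f k) (j : Fin (n + 1)) :
    f j = (n - j) * τ := by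
  have hdist : ∀ j k, j ≠ k → f k + τ ≤ f j ∨ f j + τ ≤ f k := by
    intro j k hjk
    rcases lt_or_gt_of_ne hjk with h | h
    · rcases hsep j k h with h | h <;> omega
    · rcases hsep k j h with h | h <;> omega
  -- the floors `f j / τ` run through `0, …, n`, and `g` lists the points in increasing order
  let σ₀ : Fin (n + 1) → Fin (n + 1) := fun j =>
    ⟨f j / τ, Nat.lt_succ_of_le (Nat.div_le_of_le_mul (by rw [mul_comm]; exact hf j))⟩
  have hinj : Function.Injective σ₀ := by
    intro j k hjk
    by_contra hne
    have h : f j / τ = f k / τ := by simpa [σ₀] using hjk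
    have h₁ := Nat.div_add_mod (f j) τ
    have h₂ := Nat.div_add_mod (f k) τ
    have h₃ := Nat.mod_lt (f j) hτ
    have h₄ := Nat.mod_lt (f k) hτ
    rw [h] at h₁
    rcases hdist j k hne with h | h <;> omega
  let σ : Equiv.Perm (Fin (n + 1)) := Equiv.ofBijective σ₀ hinj.bijective_of_finite
  set g := σ.symm
  have hg : ∀ s, f (g s) / τ = s := fun s => congrArg Fin.val (σ.apply_symm_apply s)
  have hstep : ∀ s : Fin n, f (g s.castSucc) + τ ≤ f (g s.succ) := by
    intro s
    have h₁ := hg s.castSucc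
    have h₂ := hg s.succ
    have hlt : f (g s.castSucc) < f (g s.succ) := by
      by_contra h
      have := Nat.div_le_div_right (c := τ) (not_lt.1 h)
      rw [h₁, h₂] at this
      simp at this
    rcases hdist (g s.castSucc) (g s.succ)
      (g.injective.ne (Fin.castSucc_lt_succ).ne) with h | h <;> omega
  have hlow : ∀ s : Fin (n + 1), (s : ℕ) * τ ≤ f (g s) := fun s => by
    conv_lhs => rw [← hg s]
    exact Nat.div_mul_le_self _ _
  have hup : ∀ s : Fin (n + 1), f (g s) ≤ s * τ := by
    intro s
    induction s using Fin.reverseInduction with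
    | last => simpa using hf _
    | cast s ih =>
      have := hstep s
      simp only [Fin.val_succ, Fin.val_castSucc, add_mul, one_mul] at ih ⊢
      omega
  have heq : ∀ s : Fin (n + 1), f (g s) = s * τ := fun s => le_antisymm (hup s) (hlow s)
  have hanti : StrictAnti g := by
    refine Fin.strictAnti_iff_succ_lt.2 fun s => ?_
    by_contra h
    have hlt := lt_of_le_of_ne (not_lt.1 h) (g.injective.ne (Fin.castSucc_lt_succ).ne)
    have := hsep _ _ hlt
    rw [heq, heq] at this
    simp only [Fin.val_succ, Fin.val_castSucc, add_mul, one_mul] at this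
    omega
  have hrev : ∀ s, g s = Fin.rev s := by
    have hmono : StrictMono fun s => g (Fin.rev s) := fun a b hab => hanti (Fin.rev_lt_rev.2 hab)
    have := (hmono.range_inj strictMono_id).1
      ((g.surjective.comp Fin.rev_surjective).range_eq.trans Set.range_id.symm)
    intro s
    have h := congrFun this (Fin.rev s)
    simpa using h
  have h := heq (Fin.rev j)
  rw [hrev, Fin.rev_rev, Fin.val_rev] at h
  rw [h]
  congr 1
  omega

/-- The configuration `(t^{-(n-1)}, …, t^{-1}, 1) / b`. -/
noncomputable def geomPoint (t b : ℂ) (n : ℕ) (j : Fin n) : ℂ := (t ^ (n - 1 - j))⁻¹ * b⁻¹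

variable {q : ℂ}

/-- Only one configuration of nodes contributes to the integral of the kernel. -/
theorem ordIntegral_nodeMoment (hq0 : q ≠ 0) (hq : ‖q‖ < 1) {b : ℂ} (hb : b ≠ 0) (ε : ℂ)
    {τ : ℕ} (hτ : 1 ≤ τ) (n : ℕ) :
    ordIntegral (nodeMoment q ε b (n * τ)) q τ (n + 1) =
      (∏ k ∈ Finset.range (n + 1), nodeWeight q ε (n * τ) (k * τ) * (((q ^ τ) ^ k)⁻¹ * b⁻¹)) *
        pairProd fun j k => ordPair q τ (geomPoint (q ^ τ) b (n + 1) j)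
          (geomPoint (q ^ τ) b (n + 1) k) := by
  classical
  set P : ℕ → ℂ := fun i => (q ^ i)⁻¹ * b⁻¹ with hP
  rw [ordIntegral, momentFunctional_eq_sum_eval (s := Finset.range (n * τ + 1))
    (c := nodeWeight q ε (n * τ)) (P := P) (μ := nodeMoment q ε b (n * τ)) fun k => rfl]
  have hpow : Function.Injective fun i : ℕ => q ^ i := by
    intro i j hij
    by_contra hne
    wlog h : i < j generalizing i j
    · exact this hij.symm (Ne.symm hne) (by omega)
    · refine one_sub_pow_ne_zero hq (k := j - i) (by omega) ?_
      have : q ^ i * q ^ (j - i) = q ^ i := by rw [← pow_add, Nat.add_sub_cancel' h.le]; exact hij.symm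
      rw [mul_eq_left₀ (pow_ne_zero _ hq0)] at this
      rw [this, sub_self]
  -- two nodes in the wrong distance make a factor vanish
  have hzero : ∀ l m i : ℕ, l = m + i → P m - q ^ i * P l = 0 := by
    rintro l m i rfl
    have := pow_ne_zero m hq0
    have := pow_ne_zero i hq0
    simp only [hP, pow_add]
    field_simp
    ring
  set f₀ : Fin (n + 1) → ℕ := fun j => (n - j) * τ with hf₀
  rw [Finset.sum_eq_single f₀]
  · rw [map_mul, map_prod, eval_ordKernel]
    simp only [eval_X]
    rw [← mul_assoc, ← Finset.prod_mul_distrib]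
    congr 1
    · rw [← Finset.prod_range_reflect, ← Fin.prod_univ_eq_prod_range (fun k =>
        nodeWeight q ε (n * τ) ((n + 1 - 1 - k) * τ) * (((q ^ τ) ^ (n + 1 - 1 - k))⁻¹ * b⁻¹))]
      refine Finset.prod_congr rfl fun j _ => ?_
      rw [hP, hf₀, ← pow_mul, mul_comm τ, Nat.add_sub_cancel]
    · have : ∀ j, P (f₀ j) = geomPoint (q ^ τ) b (n + 1) j := fun j => by
        rw [hP, hf₀, geomPoint, ← pow_mul, mul_comm τ, Nat.add_sub_cancel]
      simp only [this]
  · intro f hf hne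
    have hfle : ∀ j, f j ≤ n * τ := fun j =>
      Nat.lt_succ_iff.1 (Finset.mem_range.1 (Fintype.mem_piFinset.1 hf j))
    have : ¬ ∀ j k, j < k → f k + τ ≤ f j ∨ f j + τ < f k := fun h =>
      hne (funext (eq_of_separated hτ hfle h))
    push Not at this
    obtain ⟨j, k, hjk, h₁, h₂⟩ := this
    rw [map_mul, eval_ordKernel]
    have : ordPair q τ (P (f j)) (P (f k)) = 0 := by
      rcases le_or_gt (f k) (f j) with h | h
      · refine Finset.prod_eq_zero (i := f j - f k) (Finset.mem_range.2 (by omega)) ?_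
        rw [smul_eq_mul, hzero _ _ _ (show f j = f k + (f j - f k) by omega), zero_mul]
      · refine Finset.prod_eq_zero (i := f k - f j - 1) (Finset.mem_range.2 (by omega)) ?_
        rw [smul_eq_mul, smul_eq_mul,
          hzero _ _ _ (show f k = f j + (f k - f j - 1 + 1) by omega), mul_zero]
    have hz : (pairProd fun j k => ordPair q τ (P (f j)) (P (f k))) = 0 :=
      Finset.prod_eq_zero (Finset.mem_univ j) (Finset.prod_eq_zero (Finset.mem_Ioi.2 hjk) this)
    rw [hz, mul_zero, mul_zero]
  · intro h
    refine absurd (Fintype.mem_piFinset.2 fun j => Finset.mem_range.2 ?_) h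
    exact Nat.lt_succ_of_le (Nat.mul_le_mul_right _ (Nat.sub_le _ _))

theorem ordPair_geomPoint (hq0 : q ≠ 0) {b : ℂ} (hb : b ≠ 0) (τ r k : ℕ) :
    ordPair q τ (((q ^ τ) ^ (r + k + 1))⁻¹ * b⁻¹) (((q ^ τ) ^ r)⁻¹ * b⁻¹) *
        (qFin q q (k * τ) * (b ^ 2 * (q ^ τ) ^ (2 * (r + k + 1))) ^ τ) =
      (-1) ^ τ * q ^ τ.choose 2 * qFin q q ((k + 2) * τ) := by
  set t := q ^ τ with ht
  have ht0 : t ≠ 0 := pow_ne_zero _ hq0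
  have hfac : ∀ i ∈ Finset.range τ,
      (((t ^ r)⁻¹ * b⁻¹ - q ^ i • ((t ^ (r + k + 1))⁻¹ * b⁻¹)) *
        ((t ^ (r + k + 1))⁻¹ * b⁻¹ - q ^ (i + 1) • ((t ^ r)⁻¹ * b⁻¹))) *
        (b ^ 2 * t ^ (2 * (r + k + 1))) =
      (-1) * q ^ i * (1 - q ^ (τ - 1 - i) * (q ^ (k * τ) * q)) *
        (1 - q ^ i * (q ^ ((k + 1) * τ) * q)) := by
    intro i hi
    have hi' := Finset.mem_range.1 hi
    have e₁ : q ^ i * (q ^ (τ - 1 - i) * (q ^ (k * τ) * q)) = t ^ (k + 1) := by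
      rw [ht, ← pow_mul, ← pow_succ, ← pow_add, ← pow_add]
      congr 1
      rw [mul_add, mul_one, mul_comm τ k]
      omega
    have e₂ : q ^ ((k + 1) * τ) = t ^ (k + 1) := by rw [ht, ← pow_mul, mul_comm]
    rw [e₂, show r + k + 1 = r + (k + 1) by ring, pow_mul', pow_add t r, pow_succ q i, ← e₁]
    have hR : t ^ r ≠ 0 := pow_ne_zero _ ht0
    have hD : t ^ (k + 1) ≠ 0 := pow_ne_zero _ ht0
    rw [← e₁] at hD
    simp only [smul_eq_mul]
    have hu := left_ne_zero_of_mul hD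
    have hw := right_ne_zero_of_mul hD
    generalize t ^ r = R at *
    generalize q ^ (τ - 1 - i) * (q ^ (k * τ) * q) = w at *
    generalize q ^ i = u at *
    field_simp
    ring
  have hprod := Finset.prod_congr rfl hfac
  rw [Finset.prod_mul_distrib, Finset.prod_const, Finset.card_range] at hprod
  rw [ordPair, mul_left_comm, hprod]
  simp only [Finset.prod_mul_distrib, Finset.prod_const, Finset.card_range]
  rw [Finset.prod_range_reflect (fun i => 1 - q ^ i * (q ^ (k * τ) * q)) τ,
    Finset.prod_pow_eq_pow_sum, Finset.sum_range_id, ← Nat.choose_two_right,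
    show (k + 2) * τ = k * τ + τ + τ by ring, qFin_add q q (k * τ + τ), qFin_add q q (k * τ),
    show (k + 1) * τ = k * τ + τ by ring]
  simp only [qFin]
  ring

theorem prod_range_shift_two {R : Type*} [CommMonoid R] (g : ℕ → R) (n : ℕ) :
    (∏ k ∈ Finset.range n, g (k + 2)) * (g 0 * g 1) =
      (∏ k ∈ Finset.range n, g k) * (g n * g (n + 1)) := by
  rw [← mul_assoc, ← mul_assoc, ← Finset.prod_range_succ, ← Finset.prod_range_succ,
    Finset.prod_range_succ', Finset.prod_range_succ']
  simp only [zero_add, mul_assoc, mul_comm (g 0)]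

/-- The kernel at the configuration `geomPoint`, by induction on the number of points; the factors
which involve the first point telescope. -/
theorem pairProd_geomPoint_succ (hq0 : q ≠ 0) (hq : ‖q‖ < 1) {b : ℂ} (hb : b ≠ 0) (τ n : ℕ) :
    (pairProd fun j k => ordPair q τ (geomPoint (q ^ τ) b (n + 1) j)
        (geomPoint (q ^ τ) b (n + 1) k)) * ((b ^ 2 * (q ^ τ) ^ (2 * n)) ^ (n * τ) * qFin q q τ) =
      (-1) ^ (n * τ) * q ^ (n * τ.choose 2) * (qFin q q (n * τ) * qFin q q ((n + 1) * τ)) *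
        pairProd fun j k => ordPair q τ (geomPoint (q ^ τ) b n j) (geomPoint (q ^ τ) b n k) := by
  have hsucc : ∀ j : Fin n, geomPoint (q ^ τ) b (n + 1) j.succ = geomPoint (q ^ τ) b n j := by
    intro j
    rw [geomPoint, geomPoint, Fin.val_succ, show n + 1 - 1 - (j + 1) = n - 1 - j by omega]
  rw [pairProd_succ]
  simp only [hsucc]
  set W := pairProd fun j k => ordPair q τ (geomPoint (q ^ τ) b n j) (geomPoint (q ^ τ) b n k)
  have hpair := Finset.prod_congr (s₁ := Finset.univ) rfl fun (k : Fin n) _ =>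
    ordPair_geomPoint hq0 hb τ (n - 1 - k) k
  have hk : ∀ k : Fin n, n - 1 - (k : ℕ) + k + 1 = n := fun k => by omega
  have h0 : geomPoint (q ^ τ) b (n + 1) 0 = ((q ^ τ) ^ n)⁻¹ * b⁻¹ := by simp [geomPoint]
  simp only [hk, Finset.prod_mul_distrib, Finset.prod_const, Finset.card_univ,
    Fintype.card_fin] at hpair
  have hpow : ∀ x : ℂ, (x ^ τ) ^ n = x ^ (n * τ) := fun x => by rw [← pow_mul, mul_comm]
  rw [Fin.prod_univ_eq_prod_range (fun k => qFin q q (k * τ)),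
    Fin.prod_univ_eq_prod_range (fun k => qFin q q ((k + 2) * τ)), hpow (-1),
    hpow (b ^ 2 * (q ^ τ) ^ (2 * n)), ← pow_mul q (τ.choose 2), mul_comm (τ.choose 2)] at hpair
  have htel := prod_range_shift_two (fun k => qFin q q (k * τ)) n
  simp only [zero_mul, qFin_zero, one_mul] at htel
  have hne : ∏ k ∈ Finset.range n, qFin q q (k * τ) ≠ 0 :=
    Finset.prod_ne_zero_iff.2 fun k _ => qFin_self_ne_zero hq _
  have hg : ∏ k : Fin n, ordPair q τ (geomPoint (q ^ τ) b (n + 1) 0) (geomPoint (q ^ τ) b n k) =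
      ∏ k : Fin n, ordPair q τ (((q ^ τ) ^ n)⁻¹ * b⁻¹) (((q ^ τ) ^ (n - 1 - (k : ℕ)))⁻¹ * b⁻¹) := by
    rw [h0]; rfl
  rw [hg]
  refine mul_left_cancel₀ hne ?_
  linear_combination W * qFin q q τ * hpair + W * (-1) ^ (n * τ) * q ^ (n * τ.choose 2) * htel

/-- The kernel at the configuration `geomPoint`, together with the weights of the nodes. -/
theorem prod_mul_pairProd_geomPoint (hq0 : q ≠ 0) (hq : ‖q‖ < 1) {b₁ b₂ : ℂ} (hb₁ : b₁ ≠ 0)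
    (hb₂ : b₂ ≠ 0) (τ n : ℕ) :
    (∏ k ∈ Finset.range n, (b₁ / b₂) ^ (k * τ) * q ^ (k * τ * (k * τ)) / qFin q q (k * τ)) *
      (pairProd fun j k => ordPair q τ (geomPoint (q ^ τ) b₁ n j) (geomPoint (q ^ τ) b₁ n k)) =
    ∏ k ∈ Finset.range n, (-1) ^ (k * τ) * q ^ (k * τ.choose 2) * qFin q q ((k + 1) * τ) /
      ((b₁ * b₂ * (q ^ τ) ^ k) ^ (k * τ) * qFin q q τ) := by
  induction n with
  | zero => simp [pairProd]
  | succ n ih =>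
    rw [Finset.prod_range_succ, Finset.prod_range_succ, ← ih]
    have h := pairProd_geomPoint_succ hq0 hq hb₁ τ n
    have n₁ := qFin_self_ne_zero hq τ
    have n₂ := qFin_self_ne_zero hq (n * τ)
    have ht : (q ^ τ) ^ n ≠ 0 := pow_ne_zero _ (pow_ne_zero _ hq0)
    set W := pairProd fun j k => ordPair q τ (geomPoint (q ^ τ) b₁ n j) (geomPoint (q ^ τ) b₁ n k)
    set W' := pairProd fun j k => ordPair q τ (geomPoint (q ^ τ) b₁ (n + 1) j)
      (geomPoint (q ^ τ) b₁ (n + 1) k)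
    have e : q ^ (n * τ * (n * τ)) = ((q ^ τ) ^ n) ^ (n * τ) := by
      rw [← pow_mul, ← pow_mul]; congr 1; ring
    have e₂ : (b₁ ^ 2 * (q ^ τ) ^ (2 * n)) ^ (n * τ) =
        (b₁ ^ (n * τ) * ((q ^ τ) ^ n) ^ (n * τ)) ^ 2 := by
      have : b₁ ^ 2 * (q ^ τ) ^ (2 * n) = (b₁ * (q ^ τ) ^ n) ^ 2 := by
        rw [mul_pow, ← pow_mul (q ^ τ) n 2, mul_comm n]
      rw [this, ← mul_pow, ← pow_mul (b₁ * (q ^ τ) ^ n), ← pow_mul (b₁ * (q ^ τ) ^ n),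
        mul_comm 2]
    rw [e₂] at h
    rw [e, div_pow, mul_pow (b₁ * b₂), mul_pow b₁]
    have hb₁' := pow_ne_zero (n * τ) hb₁
    have hb₂' := pow_ne_zero (n * τ) hb₂
    have hT := pow_ne_zero (n * τ) ht
    generalize b₁ ^ (n * τ) = B₁ at *
    generalize b₂ ^ (n * τ) = B₂ at *
    generalize ((q ^ τ) ^ n) ^ (n * τ) = T at *
    rw [mul_assoc, mul_assoc]
    congr 1
    field_simp
    linear_combination h

end Evaluation

/-! ### The integral for vanishing numerator parameters -/

section Base

variable {q : ℝ} {b₁ b₂ x₁ x₂ : ℂ}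

theorem ordIntegral_one (μ : ℕ → ℂ) (q : ℂ) (τ : ℕ) : ordIntegral μ q τ 1 = μ 1 := by
  have := momentFunctional_C_mul_prod (n := 1) μ 1 fun _ => 1
  simpa [ordIntegral, ordKernel, pairProd] using this

/-- For `|b₁| ≤ |b₂|` the integral is compared with the finite functional at `α₁ = b₁ t^(n-1)`. -/
theorem ordJackson_zero_of_norm_le (h : Admissible q b₁ b₂ x₁ x₂) (hb₁ : b₁ ≠ 0) (hb₂ : b₂ ≠ 0)
    (hle : ‖b₁‖ ≤ ‖b₂‖) {τ : ℕ} (hτ : 1 ≤ τ) (n : ℕ) :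
    ordJackson q 0 0 b₁ b₂ x₁ x₂ τ (n + 1) =
      (∏ k ∈ Finset.range (n + 1), (-1) ^ (k * τ) * (q : ℂ) ^ (k * τ.choose 2) *
        qFin q q ((k + 1) * τ) / ((b₁ * b₂ * ((q : ℂ) ^ τ) ^ k) ^ (k * τ) * qFin q q τ)) *
      jacksonMoment q 0 0 b₁ b₂ x₁ x₂ 1 ^ (n + 1) := by
  have hq := h.norm_lt_one
  have hq0 := h.q_ne_zero
  have hq0' := h.q_pos
  have hb := mul_ne_zero hb₁ hb₂
  set ε := b₁ / b₂ with hεdef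
  have hε : ‖ε‖ ≤ 1 := by
    rw [hεdef, norm_div]
    exact div_le_one_of_le₀ hle (norm_nonneg _)
  set M := n * τ with hM
  set α := b₁ * (q : ℂ) ^ M with hα
  -- the reduction to `α = 0`, for `n + 1` variables and for one variable
  have red := ordJackson_reduce h hb₁ hb₂ hτ n (α₁ := α) (α₂ := 0)
    (by rw [norm_zero, mul_zero]; positivity)
  have red₁ := ordJackson_reduce h hb₁ hb₂ hτ 0 (α₁ := α) (α₂ := 0)
    (by rw [norm_zero, mul_zero]; positivity)
  simp only [mul_zero, zero_mul, qInf_zero, Finset.prod_const_one, mul_one, zero_add,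
    Finset.prod_range_one, pow_zero, inv_one, ordJackson, ordIntegral_one] at red red₁
  have hrel := momentRel_jacksonMoment h.q_pos h.q_lt_one h.x₁_ne_zero h.x₂_ne_zero h.avoids₁₁
    h.avoids₁₂ h.avoids₂₁ h.avoids₂₂ (K := 2 * n * τ) (α₁ := α) (α₂ := 0)
    (by rw [norm_zero, mul_zero]; positivity)
  have hprop := hrel.ordIntegral_proportional (τ := τ) (n := n + 1)
    (momentRel_nodeMoment hq hq0 hb₁ hb₂ hε M _)
    (fun k _ => by rw [mul_zero]; exact (mul_ne_zero (pow_ne_zero _ hq0) hb).symm) le_rfl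
  rw [red, red₁, ordIntegral_nodeMoment hq0 hq hb₁ ε hτ n] at hprop
  have hone := nodeMoment_one hq hq0 hb₁ hb₂ hε M
  have hgeom := prod_mul_pairProd_geomPoint hq0 hq hb₁ hb₂ τ (n + 1)
  rw [ordJackson, ← hgeom]
  set W := pairProd fun j k => ordPair (q : ℂ) τ (geomPoint ((q : ℂ) ^ τ) b₁ (n + 1) j)
    (geomPoint ((q : ℂ) ^ τ) b₁ (n + 1) k)
  set J := jacksonMoment q 0 0 b₁ b₂ x₁ x₂ 1
  have a₁ : (q : ℂ) * α * b₁⁻¹ = q * (q : ℂ) ^ M := by rw [hα]; field_simp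
  have a₂ : (q : ℂ) * α * b₂⁻¹ = q ^ M * (q * ε) := by rw [hα, hεdef]; field_simp
  have hQ : qInf (q : ℂ) q ≠ 0 := qInf_ne_zero_of_norm_lt_one hq hq
  have hE : qInf (q : ℂ) (q * ε) ≠ 0 := qInf_ne_zero_of_norm_lt_one hq (norm_mul_lt_one hq hε)
  have hQm := qFin_mul_qInf hq (q : ℂ)
  have hEm := qFin_mul_qInf hq ((q : ℂ) * ε)
  have hsplit : ∀ k ∈ Finset.range (n + 1), ∃ m, n = k + m := fun k hk =>
    Nat.exists_eq_add_of_le (Nat.lt_succ_iff.1 (Finset.mem_range.1 hk))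
  have b₁' : ∏ k ∈ Finset.range (n + 1), qInf (q : ℂ) (q * α * b₁⁻¹ * (((q : ℂ) ^ τ) ^ k)⁻¹) *
      qInf q (q * α * b₂⁻¹ * (((q : ℂ) ^ τ) ^ k)⁻¹) =
      ∏ k ∈ Finset.range (n + 1), qInf (q : ℂ) ((q : ℂ) ^ (k * τ) * q) *
        qInf q ((q : ℂ) ^ (k * τ) * (q * ε)) := by
    rw [← Finset.prod_range_reflect]
    refine Finset.prod_congr rfl fun k hk => ?_
    obtain ⟨m, rfl⟩ := hsplit k hk
    have := pow_ne_zero (m * τ) hq0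
    rw [a₁, a₂, hM, add_mul, pow_add, show k + m + 1 - 1 - k = m by omega, ← pow_mul, mul_comm τ m]
    congr 2 <;> field_simp
  set m₁ := nodeMoment (q : ℂ) ε b₁ M 1
  set A : ℕ → ℂ := fun k => qInf (q : ℂ) ((q : ℂ) ^ (k * τ) * q) *
    qInf q ((q : ℂ) ^ (k * τ) * (q * ε)) with hA
  have hA0 : ∀ k, A k ≠ 0 := fun k => mul_ne_zero
    (right_ne_zero_of_mul ((hQm (k * τ)).trans_ne hQ))
    (right_ne_zero_of_mul ((hEm (k * τ)).trans_ne hE))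
  have hm₁ : m₁ ≠ 0 := left_ne_zero_of_mul (hone.trans_ne (inv_ne_zero hb₁))
  rw [b₁', a₁, a₂, mul_comm (q : ℂ) ((q : ℂ) ^ M)] at hprop
  change _ * ((∏ k ∈ Finset.range (n + 1), A k) * _) = (A n * J) ^ (n + 1) * _ at hprop
  clear_value A
  have hnode : ∏ k ∈ Finset.range (n + 1),
      (A n * (nodeWeight q ε M (k * τ) * ((((q : ℂ) ^ τ) ^ k)⁻¹ * b₁⁻¹))) =
      ∏ k ∈ Finset.range (n + 1), m₁ * A k *
        (ε ^ (k * τ) * (q : ℂ) ^ (k * τ * (k * τ)) / qFin q q ((n - k) * τ)) := by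
    refine Finset.prod_congr rfl fun k hk => ?_
    have hMk : M - k * τ = (n - k) * τ := by rw [hM, Nat.sub_mul]
    have n₁ := qFin_self_ne_zero hq (k * τ)
    have n₂ := qFin_self_ne_zero hq ((n - k) * τ)
    have n₃ := qFin_mul_ne_zero hq hε (k * τ)
    have n₄ := pow_ne_zero (k * τ) hq0
    have c₁ := (hQm M).trans (hQm (k * τ)).symm
    have c₂ := (hEm M).trans (hEm (k * τ)).symm
    rw [nodeWeight, hMk, ← hone, ← pow_mul, mul_comm τ k, mul_add, mul_one, pow_add]
    simp only [hA, ← hM]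
    generalize qInf (q : ℂ) ((q : ℂ) ^ (k * τ) * q) = X₁ at *
    generalize qInf (q : ℂ) ((q : ℂ) ^ (k * τ) * (q * ε)) = X₂ at *
    generalize qInf (q : ℂ) ((q : ℂ) ^ M * q) = Y₁ at *
    generalize qInf (q : ℂ) ((q : ℂ) ^ M * (q * ε)) = Y₂ at *
    generalize qFin (q : ℂ) q (k * τ) = Z₁ at *
    generalize qFin (q : ℂ) (q * ε) (k * τ) = Z₂ at *
    generalize qFin (q : ℂ) q M = V₁ at *
    generalize qFin (q : ℂ) (q * ε) M = V₂ at *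
    generalize (q : ℂ) ^ (k * τ) = w at *
    generalize (q : ℂ) ^ (k * τ * (k * τ)) = w' at *
    generalize ε ^ (k * τ) = e at *
    clear_value m₁
    field_simp
    linear_combination e * w' * (V₂ * Y₂ * c₁ + Z₁ * X₁ * c₂)
  have hconst : ∀ (c : ℂ) (w : ℕ → ℂ), ∏ k ∈ Finset.range (n + 1), c * w k =
      c ^ (n + 1) * ∏ k ∈ Finset.range (n + 1), w k := fun c w => by
    rw [Finset.prod_mul_distrib, Finset.prod_const, Finset.card_range]
  simp only [mul_assoc m₁, hconst] at hnode
  rw [Finset.prod_mul_distrib (f := A), Finset.prod_div_distrib] at hnode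
  have hrefl : ∏ k ∈ Finset.range (n + 1), qFin (q : ℂ) q ((n - k) * τ) =
      ∏ k ∈ Finset.range (n + 1), qFin (q : ℂ) q (k * τ) := by
    rw [← Finset.prod_range_reflect]
    refine Finset.prod_congr rfl fun k hk => ?_
    obtain ⟨m, rfl⟩ := hsplit k hk
    congr 2
    omega
  rw [hrefl, ← Finset.prod_div_distrib] at hnode
  have hne : m₁ ^ (n + 1) * ∏ k ∈ Finset.range (n + 1), A k ≠ 0 :=
    mul_ne_zero (pow_ne_zero _ hm₁) (Finset.prod_ne_zero_iff.2 fun k _ => hA0 k)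
  refine mul_left_cancel₀ hne ?_
  rw [mul_assoc, hprop, mul_pow]
  linear_combination J ^ (n + 1) * W * hnode

/-- The integral without numerator parameters is a multiple of a power of the one-dimensional one. -/
theorem ordJackson_zero (h : Admissible q b₁ b₂ x₁ x₂) (hb₁ : b₁ ≠ 0) (hb₂ : b₂ ≠ 0)
    {τ : ℕ} (hτ : 1 ≤ τ) (n : ℕ) :
    ordJackson q 0 0 b₁ b₂ x₁ x₂ τ (n + 1) =
      (∏ k ∈ Finset.range (n + 1), (-1) ^ (k * τ) * (q : ℂ) ^ (k * τ.choose 2) *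
        qFin q q ((k + 1) * τ) / ((b₁ * b₂ * ((q : ℂ) ^ τ) ^ k) ^ (k * τ) * qFin q q τ)) *
      jacksonMoment q 0 0 b₁ b₂ x₁ x₂ 1 ^ (n + 1) := by
  rcases le_total ‖b₁‖ ‖b₂‖ with hle | hle
  · exact ordJackson_zero_of_norm_le h hb₁ hb₂ hle hτ n
  · rw [ordJackson_swap_right, jacksonMoment_swap_right, mul_comm b₁]
    exact ordJackson_zero_of_norm_le h.swap hb₂ hb₁ hle hτ n

end Base

/-! ### Theta functions are determined by their multiplier -/

section Laurent

open Complex Metric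

/-- The Laurent coefficient of index `n` on the circle of radius `r`, up to the factor `2 π i`. -/
noncomputable def laurentCoeff (E : ℂ → ℂ) (n : ℤ) (r : ℝ) : ℂ := ∮ z in C(0, r), E z * z ^ (-n - 1)

theorem continuousOn_mul_zpow {E : ℂ → ℂ} (hE : DifferentiableOn ℂ E {0}ᶜ) (n : ℤ) :
    ContinuousOn (fun z => E z * z ^ (-n - 1)) {0}ᶜ :=
  hE.continuousOn.mul fun _ hz => (continuousAt_zpow₀ _ _ (Or.inl hz)).continuousWithinAt

theorem laurentCoeff_eq_of_le {E : ℂ → ℂ} (hE : DifferentiableOn ℂ E {0}ᶜ) (n : ℤ) {r R : ℝ}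
    (hr : 0 < r) (hrR : r ≤ R) : laurentCoeff E n R = laurentCoeff E n r := by
  refine circleIntegral_eq_of_differentiable_on_annulus_off_countable hr hrR Set.countable_empty
    ((continuousOn_mul_zpow hE n).mono fun z hz => ?_) fun z hz => ?_
  · rintro rfl
    exact hz.2 (mem_ball_self hr)
  · have hz0 : z ≠ 0 := by
      rintro rfl
      exact hz.1.2 (mem_closedBall_self hr.le)
    exact (hE.differentiableAt (isOpen_compl_singleton.mem_nhds hz0)).mul
      (differentiableAt_zpow.2 (Or.inl hz0))

theorem laurentCoeff_mul_radius {E : ℂ → ℂ} {q : ℝ} (hq0 : 0 < q) (n : ℤ) (r : ℝ) :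
    laurentCoeff E n (q * r) = (q : ℂ) ^ (-n) * laurentCoeff (fun z => E (q * z)) n r := by
  have hq : (q : ℂ) ≠ 0 := by exact_mod_cast hq0.ne'
  rw [laurentCoeff, laurentCoeff, circleIntegral, circleIntegral,
    ← intervalIntegral.integral_const_mul]
  refine intervalIntegral.integral_congr fun θ _ => ?_
  have hc : circleMap 0 (q * r) θ = q * circleMap 0 r θ := by
    simp [circleMap, mul_assoc]
  simp only [deriv_circleMap, hc, smul_eq_mul, mul_zpow]
  rw [show -n = (-n - 1) + 1 by ring, zpow_add_one₀ hq, add_sub_cancel_right]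
  ring

/-- A continuous function on a circle whose Laurent coefficients vanish is zero. -/
theorem eq_zero_of_laurentCoeff_eq_zero {E : ℂ → ℂ} (hE : ContinuousOn E {0}ᶜ) {r : ℝ}
    (hr : 0 < r) (h : ∀ n, laurentCoeff E n r = 0) {z : ℂ} (hz : ‖z‖ = r) : E z = 0 := by
  have : Fact (0 < 2 * Real.pi) := ⟨Real.two_pi_pos⟩
  have hr0 : (r : ℂ) ≠ 0 := by exact_mod_cast hr.ne'
  let f : C(AddCircle (2 * Real.pi), ℂ) := ⟨fun x => E (r * AddCircle.toCircle x), by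
    refine hE.comp_continuous (continuous_const.mul
      (continuous_subtype_val.comp AddCircle.continuous_toCircle)) fun x => ?_
    exact mul_ne_zero hr0 (Circle.coe_ne_zero _)⟩
  have hcircle : ∀ θ : ℝ, (r : ℂ) * AddCircle.toCircle (θ : AddCircle (2 * Real.pi)) =
      circleMap 0 r θ := by
    intro θ
    rw [AddCircle.toCircle_apply_mk, Circle.coe_exp, circleMap, zero_add]
    congr 3
    push_cast
    field_simp
  have hcoeff : ∀ n, fourierCoeff f n = 0 := by
    intro n
    have hint : laurentCoeff E n r = (I * (r : ℂ) ^ (-n)) *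
        ∫ θ : ℝ in (0 : ℝ)..0 + 2 * Real.pi, (fourier (-n)) (θ : AddCircle (2 * Real.pi)) •
          f (θ : AddCircle (2 * Real.pi)) := by
      rw [zero_add, laurentCoeff, circleIntegral, ← intervalIntegral.integral_const_mul]
      refine intervalIntegral.integral_congr fun θ _ => ?_
      have hc := circleMap_ne_center (c := (0 : ℂ)) (θ := θ) hr.ne'
      have hfour : (fourier (-n)) (θ : AddCircle (2 * Real.pi)) =
          (AddCircle.toCircle (θ : AddCircle (2 * Real.pi)) : ℂ) ^ (-n) := by
        rw [fourier_apply, AddCircle.toCircle_zsmul, Circle.coe_zpow]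
      have hf : f (θ : AddCircle (2 * Real.pi)) = E (circleMap 0 r θ) := by
        rw [← hcircle]; rfl
      simp only [deriv_circleMap, smul_eq_mul]
      rw [hf, hfour, mul_assoc I, ← mul_assoc ((r : ℂ) ^ (-n)), ← mul_zpow, hcircle,
        show -n = (-n - 1) + 1 by ring, zpow_add_one₀ hc, add_sub_cancel_right]
      ring
    rw [h] at hint
    rw [fourierCoeff_eq_intervalIntegral f n 0]
    have := (mul_eq_zero.1 hint.symm).resolve_left (mul_ne_zero I_ne_zero (zpow_ne_zero _ hr0))
    rw [this, smul_zero]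
  have hfun : fourierCoeff f = fun _ => 0 := funext hcoeff
  have hs := has_pointwise_sum_fourier_series_of_summable (f := f) (by rw [hfun]; exact summable_zero)
  have hf0 : ∀ x, f x = 0 := fun x => by
    have := hs x
    simp only [hcoeff, zero_smul] at this
    exact this.unique hasSum_zero
  have := hf0 ((z.arg : ℝ) : AddCircle (2 * Real.pi))
  change E _ = 0 at this
  rw [hcircle, circleMap, zero_add, ← hz, Complex.norm_mul_exp_arg_mul_I] at this
  exact this

/-- A function on `ℂ ∖ {0}` with the multiplier `-1 / (c z)` under `z ↦ q z` is determined by a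
single Laurent coefficient, because the multiplier relates each coefficient to the next one. -/
theorem eq_zero_of_multiplier {E : ℂ → ℂ} (hE : DifferentiableOn ℂ E {0}ᶜ) {q : ℝ} (hq0 : 0 < q)
    {c : ℂ} (hc : c ≠ 0) (hmul : ∀ z, z ≠ 0 → E (q * z) = -(c * z)⁻¹ * E z)
    (h0 : laurentCoeff E 0 1 = 0) {z : ℂ} (hz : z ≠ 0) : E z = 0 := by
  have hq : (q : ℂ) ≠ 0 := by exact_mod_cast hq0.ne'
  have hrad : ∀ n {r : ℝ}, 0 < r → laurentCoeff E n r = laurentCoeff E n 1 := by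
    intro n r hr
    rcases le_total r 1 with h | h
    · exact (laurentCoeff_eq_of_le hE n hr h).symm
    · exact laurentCoeff_eq_of_le hE n one_pos h
  have hrec : ∀ n, laurentCoeff E n 1 = (q : ℂ) ^ (-n) * (-c⁻¹ * laurentCoeff E (n + 1) 1) := by
    intro n
    rw [← hrad n (show 0 < q * 1 by linarith), laurentCoeff_mul_radius hq0]
    congr 1
    rw [laurentCoeff, laurentCoeff, circleIntegral, circleIntegral,
      ← intervalIntegral.integral_const_mul]
    refine intervalIntegral.integral_congr fun θ _ => ?_
    have hc0 := circleMap_ne_center (c := (0 : ℂ)) (θ := θ) one_ne_zero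
    simp only [smul_eq_mul]
    rw [hmul _ hc0, show -n - 1 = (-(n + 1) - 1) + 1 by ring, zpow_add_one₀ hc0]
    field_simp
  have hall : ∀ n, laurentCoeff E n 1 = 0 := by
    intro n
    induction n using Int.induction_on with
    | zero => exact h0
    | succ n ih =>
      rw [hrec, mul_eq_zero, mul_eq_zero] at ih
      rcases ih with h | h | h
      · exact absurd h (zpow_ne_zero _ hq)
      · exact absurd h (neg_ne_zero.2 (inv_ne_zero hc))
      · exact h
    | pred n ih => rw [hrec, sub_add_cancel, ih]; simp
  exact eq_zero_of_laurentCoeff_eq_zero hE.continuousOn (norm_pos_iff.2 hz)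
    (fun n => (hrad n (norm_pos_iff.2 hz)).trans (hall n)) rfl

theorem differentiableAt_theta {q : ℂ} (hq : ‖q‖ < 1) {a : ℂ} (ha : a ≠ 0) :
    DifferentiableAt ℂ (theta q) a :=
  (differentiable_qInf hq a).mul
    ((differentiable_qInf hq (q / a)).comp a ((differentiableAt_const q).div differentiableAt_id ha))

/-- Two functions with the multiplier of `z ↦ θ(c z)` are proportional to that function. -/
theorem mul_theta_eq_of_multiplier {G : ℂ → ℂ} (hG : DifferentiableOn ℂ G {0}ᶜ) {q : ℝ}
    (hq0 : 0 < q) (hq1 : q < 1) {c : ℂ} (hc : c ≠ 0)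
    (hmul : ∀ z, z ≠ 0 → G (q * z) = -(c * z)⁻¹ * G z) {w z : ℂ} (hw : w ≠ 0) (hz : z ≠ 0) :
    G z * theta q (c * w) = G w * theta q (c * z) := by
  have hq := norm_ofReal_lt_one hq0 hq1
  have hq' : (q : ℂ) ≠ 0 := by exact_mod_cast hq0.ne'
  by_cases htw : theta q (c * w) = 0 ∧ theta q (c * z) = 0
  · rw [htw.1, htw.2, mul_zero, mul_zero]
  set Θ : ℂ → ℂ := fun z => theta q (c * z) with hΘ
  have hΘd : DifferentiableOn ℂ Θ {0}ᶜ := fun z hz =>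
    ((differentiableAt_theta hq (mul_ne_zero hc hz)).comp z
      ((differentiableAt_const c).mul differentiableAt_id)).differentiableWithinAt
  have hΘm : ∀ z, z ≠ 0 → Θ (q * z) = -(c * z)⁻¹ * Θ z := fun z hz => by
    simp only [hΘ]
    rw [mul_left_comm, theta_q_mul hq hq' (mul_ne_zero hc hz)]
  have hint : ∀ {E : ℂ → ℂ}, DifferentiableOn ℂ E {0}ᶜ →
      CircleIntegrable (fun z => E z * z ^ (-(0 : ℤ) - 1)) 0 1 := fun hE =>
    ((continuousOn_mul_zpow hE 0).mono fun z hz => by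
      rintro rfl; simp at hz).circleIntegrable zero_le_one
  set g := laurentCoeff G 0 1
  set ϑ := laurentCoeff Θ 0 1
  have hϑ : ϑ ≠ 0 := by
    intro h
    exact htw ⟨eq_zero_of_multiplier hΘd hq0 hc hΘm h hw,
      eq_zero_of_multiplier hΘd hq0 hc hΘm h hz⟩
  have hE : ∀ z, z ≠ 0 → ϑ * G z - g * Θ z = 0 := by
    intro z hz
    refine eq_zero_of_multiplier (E := fun z => ϑ * G z - g * Θ z)
      ((hG.const_mul ϑ).sub (hΘd.const_mul g)) hq0 hc (fun z hz => ?_) ?_ hz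
    · rw [hmul z hz, hΘm z hz]; ring
    · have : laurentCoeff (fun z => ϑ * G z - g * Θ z) 0 1 = ϑ * g - g * ϑ := by
        simp only [laurentCoeff, sub_mul, mul_assoc]
        rw [circleIntegral.integral_sub]
        · rw [circleIntegral.integral_const_mul, circleIntegral.integral_const_mul]; rfl
        · exact (hint hG).const_fun_smul (a := ϑ)
        · exact (hint hΘd).const_fun_smul (a := g)
      rw [this]; ring
  refine mul_left_cancel₀ hϑ ?_
  linear_combination Θ w * hE z hz - Θ z * hE w hw

end Laurent

/-! ### The one-dimensional integral -/

section ThetaQuot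

/-- The function `θ(a) / (a q^ν)_∞`, continued to its removable singularities. -/
noncomputable def thetaQuot (q a : ℂ) : ℤ → ℂ
  | Int.ofNat i => qFin q a i * qInf q (q / a)
  | Int.negSucc i => ((-a) ^ (i + 1))⁻¹ * q ^ ((i + 2).choose 2) * qInf q (q ^ (i + 2) / a)

theorem thetaQuot_natCast (q a : ℂ) (i : ℕ) :
    thetaQuot q a (i : ℤ) = qFin q a i * qInf q (q / a) := rfl

theorem thetaQuot_neg (q a : ℂ) (j : ℕ) : thetaQuot q a (-(j : ℤ)) =
    ((-a) ^ j)⁻¹ * q ^ ((j + 1).choose 2) * qInf q (q ^ (j + 1) / a) := by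
  rcases j with _ | i
  · simpa using thetaQuot_natCast q a 0
  · rfl

theorem choose_two_add (j : ℕ) : (j + 1).choose 2 + j.choose 2 = j * j := by
  induction j with
  | zero => rfl
  | succ j ih =>
    have h₁ : (j + 2).choose 2 = j + 1 + (j + 1).choose 2 := by
      rw [Nat.choose_succ_succ' (j + 1) 1, Nat.choose_one_right]
    have h₂ : (j + 1).choose 2 = j + j.choose 2 := by
      rw [Nat.choose_succ_succ' j 1, Nat.choose_one_right]
    linarith

theorem thetaQuot_mul_qInf {q : ℂ} (hq : ‖q‖ < 1) (hq0 : q ≠ 0) {a : ℂ} (ha : a ≠ 0) (ν : ℤ) :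
    thetaQuot q a ν * qInf q (a * q ^ ν) = theta q a := by
  obtain ⟨j, rfl | rfl⟩ := ν.eq_nat_or_neg
  · rw [thetaQuot_natCast, zpow_natCast, mul_right_comm, mul_comm a, qFin_mul_qInf hq, theta]
  · have hj := pow_ne_zero j hq0
    have h := theta_pow_mul hq hq0 (a := a * (q ^ j)⁻¹) (mul_ne_zero ha (inv_ne_zero hj)) j
    rw [mul_left_comm, mul_inv_cancel₀ hj, mul_one, theta, theta,
      show q / (a * (q ^ j)⁻¹) = q ^ (j + 1) / a by rw [pow_succ]; field_simp] at h
    have hc := choose_two_add j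
    rw [thetaQuot_neg, zpow_neg, zpow_natCast, mul_assoc, mul_comm (qInf q (q ^ (j + 1) / a)), ← h,
      theta, ← neg_mul, mul_pow, inv_pow, ← pow_mul, ← hc, pow_add]
    have h1 := pow_ne_zero j (neg_ne_zero.2 ha)
    have h2 := pow_ne_zero (j.choose 2) hq0
    have h3 := pow_ne_zero ((j + 1).choose 2) hq0
    field_simp

theorem differentiableAt_thetaQuot {q : ℂ} (hq : ‖q‖ < 1) {a : ℂ} (ha : a ≠ 0) (ν : ℤ) :
    DifferentiableAt ℂ (fun a => thetaQuot q a ν) a := by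
  have hdiv : ∀ c : ℂ, DifferentiableAt ℂ (fun a => qInf q (c / a)) a := fun c =>
    (differentiable_qInf hq (c / a)).comp a ((differentiableAt_const c).div differentiableAt_id ha)
  obtain ⟨j, rfl | rfl⟩ := ν.eq_nat_or_neg
  · simp only [thetaQuot_natCast]
    refine DifferentiableAt.mul ?_ (hdiv q)
    unfold qFin
    fun_prop
  · simp only [thetaQuot_neg]
    refine (DifferentiableAt.mul_const (DifferentiableAt.inv (by fun_prop) ?_) _).mul (hdiv _)
    exact pow_ne_zero _ (neg_ne_zero.2 ha)

/-- A bound for `thetaQuot` on annuli, uniform in the index. -/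
theorem norm_thetaQuot_le {q : ℝ} (hq0 : 0 < q) (hq1 : q < 1) {a : ℂ} {r R : ℝ} (hr : 0 < r)
    (hra : r ≤ ‖a‖) (haR : ‖a‖ ≤ R) (ν : ℤ) :
    ‖thetaQuot q a ν‖ ≤ qMaj q R * qMaj q r⁻¹ + qMaj q r⁻¹ * qMaj q r⁻¹ := by
  have ha : 0 < ‖a‖ := hr.trans_le hra
  have hR : 0 < R := ha.trans_le haR
  have hrinv : 0 < r⁻¹ := inv_pos.2 hr
  have hM := one_le_qMaj hq0 hq1 hrinv.le
  have hM' := one_le_qMaj hq0 hq1 hR.le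
  have hainv : ‖a‖⁻¹ ≤ r⁻¹ := inv_anti₀ hr hra
  have hqn : ‖(q : ℂ)‖ = q := by rw [Complex.norm_real, Real.norm_of_nonneg hq0.le]
  have htail : ∀ j : ℕ, ‖qInf (q : ℂ) ((q : ℂ) ^ j / a)‖ ≤ qMaj q r⁻¹ := by
    intro j
    refine norm_qInf_le hq0 hq1 ?_
    rw [norm_div, norm_pow, hqn, div_eq_mul_inv]
    exact (mul_le_of_le_one_left (by positivity) (pow_le_one₀ hq0.le hq1.le)).trans hainv
  have hprod : ∀ (s : ℝ) (N : ℕ), 0 ≤ s →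
      ∏ i ∈ Finset.range N, (1 + q ^ i * s) ≤ qMaj q s := by
    intro s N hs
    rw [← prod_mul_qMaj hq0 hq1 s N]
    exact le_mul_of_one_le_right (Finset.prod_nonneg fun i _ => by positivity)
      (one_le_qMaj hq0 hq1 (by positivity))
  obtain ⟨j, rfl | rfl⟩ := ν.eq_nat_or_neg
  · refine le_trans ?_ (le_add_of_nonneg_right (by positivity))
    rw [thetaQuot_natCast, norm_mul]
    refine mul_le_mul ?_ (by simpa using htail 1) (norm_nonneg _) (by positivity)
    rw [qFin, norm_prod]
    exact (Finset.prod_le_prod (fun _ _ => norm_nonneg _)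
      fun i _ => norm_one_sub_le hq0 haR i).trans (hprod R j hR.le)
  · refine le_trans ?_ (le_add_of_nonneg_left (by positivity))
    rw [thetaQuot_neg, norm_mul]
    refine mul_le_mul ?_ (htail _) (norm_nonneg _) (by positivity)
    have e : ‖((-a) ^ j)⁻¹ * (q : ℂ) ^ ((j + 1).choose 2)‖ =
        ∏ i ∈ Finset.range j, q ^ (i + 1) * ‖a‖⁻¹ := by
      rw [Finset.prod_mul_distrib, Finset.prod_pow_eq_pow_sum, Finset.prod_const, Finset.card_range,
        norm_mul, norm_inv, norm_pow, norm_pow, norm_neg, hqn, inv_pow, mul_comm]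
      congr 2
      have := Finset.sum_range_succ' (fun i => i) j
      rw [add_zero] at this
      rw [← this, Finset.sum_range_id, Nat.choose_two_right]
    rw [e]
    refine (Finset.prod_le_prod (fun i _ => by positivity) fun i _ => ?_).trans (hprod r⁻¹ j hrinv.le)
    have : q ^ (i + 1) ≤ q ^ i := pow_le_pow_of_le_one hq0.le hq1.le (Nat.le_succ i)
    calc q ^ (i + 1) * ‖a‖⁻¹ ≤ q ^ i * r⁻¹ := by gcongr
      _ ≤ 1 + q ^ i * r⁻¹ := by linarith

end ThetaQuot

section Durfee

variable {q : ℝ}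

/-- The terms of the series in `durfee_sum`. -/
noncomputable def durfeeTerm (q w : ℂ) (i : ℕ) : ℂ :=
  q ^ (i * i) * w ^ i * (qInf q (q ^ (i + 1)) * qInf q (q ^ (i + 1) * w))

theorem norm_durfeeTerm_le (hq0 : 0 < q) (hq1 : q < 1) {w : ℂ} {R : ℝ} (hw : ‖w‖ ≤ R) (i : ℕ) :
    ‖durfeeTerm q w i‖ ≤ q ^ (i * i) * R ^ i * (qMaj q 1 * qMaj q R) := by
  have hR : 0 ≤ R := (norm_nonneg w).trans hw
  have hqn : ‖(q : ℂ)‖ = q := by rw [Complex.norm_real, Real.norm_of_nonneg hq0.le]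
  have hp := pow_le_one₀ (n := i + 1) hq0.le hq1.le
  have h1 := one_le_qMaj hq0 hq1 zero_le_one
  rw [durfeeTerm, norm_mul, norm_mul, norm_mul, norm_pow, norm_pow, hqn]
  gcongr
  · exact norm_qInf_le hq0 hq1 (by rw [norm_pow, hqn]; exact hp)
  · refine norm_qInf_le hq0 hq1 ?_
    rw [norm_mul, norm_pow, hqn]
    exact (mul_le_of_le_one_left (norm_nonneg _) hp).trans hw

theorem summable_pow_mul_self (hq0 : 0 < q) (hq1 : q < 1) {R : ℝ} (hR : 0 < R) :
    Summable fun i : ℕ => q ^ (i * i) * R ^ i := by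
  refine summable_of_ratio_test_tendsto_lt_one zero_lt_one
    (Eventually.of_forall fun i => by positivity) ?_
  have hlim : Tendsto (fun i : ℕ => (q ^ i) * (q ^ i) * (q * R)) atTop (𝓝 (0 * 0 * (q * R))) :=
    ((tendsto_pow_atTop_nhds_zero_of_lt_one hq0.le hq1).mul
      (tendsto_pow_atTop_nhds_zero_of_lt_one hq0.le hq1)).mul_const _
  rw [zero_mul, zero_mul] at hlim
  refine hlim.congr fun i => ?_
  rw [Real.norm_of_nonneg (by positivity), Real.norm_of_nonneg (by positivity), eq_div_iff (by positivity),
    show (i + 1) * (i + 1) = i * i + i + i + 1 by ring]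
  ring

theorem summable_durfeeTerm (hq0 : 0 < q) (hq1 : q < 1) (w : ℂ) : Summable (durfeeTerm q w) := by
  refine Summable.of_norm_bounded ((summable_pow_mul_self hq0 hq1
    (R := ‖w‖ + 1) (by positivity)).mul_right _) fun i =>
    norm_durfeeTerm_le hq0 hq1 (by linarith : ‖w‖ ≤ ‖w‖ + 1) i

/-- The sum of `durfeeTerm` is invariant under `w ↦ q w`: the difference of the terms telescopes. -/
theorem tsum_durfeeTerm_q_mul (hq0 : 0 < q) (hq1 : q < 1) (w : ℂ) :
    ∑' i, durfeeTerm q w i = ∑' i, durfeeTerm q (q * w) i := by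
  have hq := norm_ofReal_lt_one hq0 hq1
  set g : ℕ → ℂ := fun i => -((q : ℂ) ^ (i * i) * w ^ i *
    (qInf q ((q : ℂ) ^ i) * qInf q ((q : ℂ) ^ (i + 1) * w))) with hg
  have hstep : ∀ i, durfeeTerm q w i - durfeeTerm q (q * w) i = g (i + 1) - g i := by
    intro i
    have h₁ := qInf_eq_one_sub_mul hq ((q : ℂ) ^ i)
    have h₂ := qInf_eq_one_sub_mul hq ((q : ℂ) ^ (i + 1) * w)
    rw [← pow_succ'] at h₁
    rw [← mul_assoc, ← pow_succ'] at h₂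
    simp only [durfeeTerm, hg]
    rw [h₁, h₂, ← mul_assoc ((q : ℂ) ^ (i + 1)) (q : ℂ) w, ← pow_succ, mul_pow,
      show (i + 1) * (i + 1) = i * i + i + i + 1 by ring]
    generalize qInf (q : ℂ) ((q : ℂ) ^ (i + 1)) = X
    generalize qInf (q : ℂ) ((q : ℂ) ^ (i + 1 + 1) * w) = Y
    ring
  have hg0 : g 0 = 0 := by
    simp only [hg]
    rw [qInf_eq_zero hq (a := (q : ℂ) ^ 0) (i := 0) (by simp)]
    simp
  have hlim : Tendsto g atTop (𝓝 0) := by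
    have hq' := (summable_pow_mul_self hq0 hq1 (R := ‖w‖ + 1)
      (by positivity)).tendsto_atTop_zero.mul_const (qMaj q 1 * qMaj q (‖w‖ + 1))
    rw [zero_mul] at hq'
    refine squeeze_zero_norm (fun i => ?_) hq'
    have hqn : ‖(q : ℂ)‖ = q := by rw [Complex.norm_real, Real.norm_of_nonneg hq0.le]
    have h1 := one_le_qMaj hq0 hq1 zero_le_one
    simp only [hg]
    rw [norm_neg, norm_mul, norm_mul, norm_mul, norm_pow, norm_pow, hqn]
    gcongr
    · linarith
    · exact norm_qInf_le hq0 hq1 (by rw [norm_pow, hqn]; exact pow_le_one₀ hq0.le hq1.le)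
    · refine norm_qInf_le hq0 hq1 ?_
      rw [norm_mul, norm_pow, hqn]
      exact (mul_le_of_le_one_left (norm_nonneg _) (pow_le_one₀ hq0.le hq1.le)).trans (by linarith)
  have hs := (summable_durfeeTerm hq0 hq1 w).hasSum.sub
    (summable_durfeeTerm hq0 hq1 (q * w)).hasSum
  simp only [hstep] at hs
  have h := hs.tendsto_sum_nat
  simp only [Finset.sum_range_sub, hg0, sub_zero] at h
  exact sub_eq_zero.1 (tendsto_nhds_unique h hlim)

/-- A form of Cauchy's identity `∑ q^{i²} w^i / ((q)_i (q w)_i) = 1 / (q w)_∞`. -/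
theorem durfee_sum (hq0 : 0 < q) (hq1 : q < 1) (w : ℂ) :
    ∑' i, durfeeTerm q w i = qInf q q := by
  have hq := norm_ofReal_lt_one hq0 hq1
  have hconst : ∀ N : ℕ, ∑' i, durfeeTerm q (w * (q : ℂ) ^ N) i = ∑' i, durfeeTerm q w i := by
    intro N
    induction N with
    | zero => simp
    | succ N ih => rw [pow_succ, ← mul_assoc, mul_comm _ (q : ℂ), ← tsum_durfeeTerm_q_mul hq0 hq1, ih]
  have hlim : Tendsto (fun N : ℕ => ∑' i, durfeeTerm q (w * (q : ℂ) ^ N) i) atTop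
      (𝓝 (∑' i, durfeeTerm q 0 i)) := by
    refine tendsto_tsum_of_dominated_convergence ((summable_pow_mul_self hq0 hq1
      (R := ‖w‖ + 1) (by positivity)).mul_right (qMaj q 1 * qMaj q (‖w‖ + 1))) (fun i => ?_)
      (Eventually.of_forall fun N i => norm_durfeeTerm_le hq0 hq1 ?_ i)
    · have hc : Continuous fun w : ℂ => durfeeTerm q w i := by
        have := continuous_qInf hq
        unfold durfeeTerm
        fun_prop
      exact (hc.tendsto 0).comp (tendsto_mul_pow_zero hq0 hq1 w)
    · rw [norm_mul, norm_pow, Complex.norm_real, Real.norm_of_nonneg hq0.le]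
      exact (mul_le_of_le_one_right (norm_nonneg _) (pow_le_one₀ hq0.le hq1.le)).trans (by linarith)
  simp only [hconst] at hlim
  rw [tendsto_nhds_unique tendsto_const_nhds hlim, tsum_eq_single 0]
  · simp [durfeeTerm]
  · intro i hi
    simp [durfeeTerm, hi]

end Durfee

section ThetaFormula

variable {q : ℝ} {b b₂ x x₁ x₂ : ℂ}

/-- The product of `θ(x b)` and of the moment of exponent one of the weight `1 / ((b z)_∞ (b₂ z)_∞)`,
continued to its removable singularities in `b`. -/
noncomputable def thetaMoment (q b₂ x b : ℂ) : ℂ :=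
  ∑' ν : ℤ, weight q 0 (b₂ / q) b₂ b₂ (x * q ^ ν) * (x * q ^ ν) * thetaQuot q (x * b) ν

theorem weight_cancel (hq0 : 0 < q) (hq1 : q < 1) (h₂ : Avoids q x b₂) (ν : ℤ) :
    weight q 0 (b₂ / q) b₂ b₂ (x * (q : ℂ) ^ ν) * qInf q (b₂ * (x * (q : ℂ) ^ ν)) = 1 := by
  have hq : (q : ℂ) ≠ 0 := by exact_mod_cast hq0.ne'
  have h := h₂.qInf_ne_zero hq0 hq1 ν
  rw [weight, mul_div_cancel₀ _ hq, div_self h, mul_zero, zero_mul, qInf_zero,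
    mul_one, one_div_mul_cancel h]

theorem summable_weight_cancel (hq0 : 0 < q) (hq1 : q < 1) (hx : x ≠ 0) (hb₂ : b₂ ≠ 0)
    (h₂ : Avoids q x b₂) : Summable fun ν : ℤ =>
      ‖weight q 0 (b₂ / q) b₂ b₂ (x * (q : ℂ) ^ ν) * (x * (q : ℂ) ^ ν)‖ := by
  have h := summable_latticeMoment hq0 hq1 (α₁ := 0) (α₂ := b₂ / q) hx h₂ h₂ (k := 1) (K := 1)
    le_rfl le_rfl (by rw [norm_zero, mul_zero, zero_mul]; positivity)
  simpa only [pow_one] using h.norm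

theorem thetaMoment_eq (hq0 : 0 < q) (hq1 : q < 1) (hx : x ≠ 0) (hb : b ≠ 0)
    (h₁ : Avoids q x b) (h₂ : Avoids q x b₂) :
    thetaMoment q b₂ x b = theta q (x * b) * latticeMoment q 0 0 b b₂ x 1 := by
  have hq : (q : ℂ) ≠ 0 := by exact_mod_cast hq0.ne'
  rw [thetaMoment, latticeMoment, ← tsum_mul_left]
  refine tsum_congr fun ν => ?_
  rw [← thetaQuot_mul_qInf (norm_ofReal_lt_one hq0 hq1) hq (mul_ne_zero hx hb) ν, pow_one,
    eq_div_of_mul_eq (h₂.qInf_ne_zero hq0 hq1 ν) (weight_cancel hq0 hq1 h₂ ν), weight, mul_zero,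
    zero_mul, qInf_zero, show x * b * (q : ℂ) ^ ν = b * (x * (q : ℂ) ^ ν) by ring]
  have := h₁.qInf_ne_zero hq0 hq1 ν
  generalize qInf (q : ℂ) (b * (x * (q : ℂ) ^ ν)) = A at *
  field_simp

theorem differentiableAt_thetaMoment (hq0 : 0 < q) (hq1 : q < 1) (hx : x ≠ 0) (hb₂ : b₂ ≠ 0)
    (h₂ : Avoids q x b₂) (hb : b ≠ 0) : DifferentiableAt ℂ (thetaMoment q b₂ x) b := by
  have hq := norm_ofReal_lt_one hq0 hq1
  set a := ‖x * b‖ with ha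
  have ha0 : 0 < a := norm_pos_iff.2 (mul_ne_zero hx hb)
  set U : Set ℂ := {w | a / 2 < ‖x * w‖ ∧ ‖x * w‖ < 2 * a} with hU
  have hUo : IsOpen U := by
    have hc : Continuous fun w : ℂ => ‖x * w‖ := by fun_prop
    exact (isOpen_lt continuous_const hc).inter (isOpen_lt hc continuous_const)
  have hbU : b ∈ U := ⟨by linarith, by linarith⟩
  refine (Complex.differentiableOn_tsum_of_summable_norm
    ((summable_weight_cancel hq0 hq1 hx hb₂ h₂).mul_right
      (qMaj q (2 * a) * qMaj q (a / 2)⁻¹ + qMaj q (a / 2)⁻¹ * qMaj q (a / 2)⁻¹))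
    (fun ν w hw => ?_) hUo fun ν w hw => ?_).differentiableAt (hUo.mem_nhds hbU)
  · have hxw : x * w ≠ 0 := norm_pos_iff.1 ((half_pos ha0).trans hw.1)
    refine DifferentiableAt.differentiableWithinAt (DifferentiableAt.const_mul ?_ _)
    exact (differentiableAt_thetaQuot hq hxw ν).comp w
      ((differentiableAt_const x).mul differentiableAt_id)
  · rw [norm_mul]
    exact mul_le_mul_of_nonneg_left
      (norm_thetaQuot_le hq0 hq1 (half_pos ha0) hw.1.le hw.2.le ν) (norm_nonneg _)

/-- At the pole `b = 1 / x` only the terms with `ν ≤ 0` remain, which gives a Durfee type sum. -/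
theorem theta_mul_thetaMoment_inv (hq0 : 0 < q) (hq1 : q < 1) (hx : x ≠ 0) (hb₂ : b₂ ≠ 0)
    (h₂ : Avoids q x b₂) :
    theta q (x * b₂) * thetaMoment q b₂ x x⁻¹ = x * qInf q q := by
  have hq := norm_ofReal_lt_one hq0 hq1
  have hq' : (q : ℂ) ≠ 0 := by exact_mod_cast hq0.ne'
  have hy := mul_ne_zero hx hb₂
  have hterm : ∀ ν : ℤ, theta q (x * b₂) * (weight q 0 (b₂ / q) b₂ b₂ (x * (q : ℂ) ^ ν) *
      (x * (q : ℂ) ^ ν) * thetaQuot q (x * x⁻¹) ν) =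
      x * (q : ℂ) ^ ν * (thetaQuot q (x * b₂) ν * thetaQuot q 1 ν) := by
    intro ν
    rw [← thetaQuot_mul_qInf hq hq' hy ν, mul_inv_cancel₀ hx,
      show x * b₂ * (q : ℂ) ^ ν = b₂ * (x * (q : ℂ) ^ ν) by ring]
    linear_combination (thetaQuot q (x * b₂) ν * thetaQuot q 1 ν * (x * (q : ℂ) ^ ν)) *
      weight_cancel hq0 hq1 h₂ ν
  rw [thetaMoment, ← tsum_mul_left, tsum_congr hterm, ← durfee_sum hq0 hq1 (x * b₂)⁻¹,
    ← tsum_mul_left]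
  have hinj : Function.Injective fun j : ℕ => -(j : ℤ) := fun i j h => by simpa using h
  rw [← hinj.tsum_eq]
  · refine tsum_congr fun j => ?_
    rw [thetaQuot_neg, thetaQuot_neg, durfeeTerm, zpow_neg, zpow_natCast, neg_pow (x * b₂),
      neg_pow (1 : ℂ), one_pow, mul_one, div_one, ← div_eq_mul_inv ((q : ℂ) ^ (j + 1)), inv_pow,
      ← choose_two_add j, show (j + 1).choose 2 = j + j.choose 2 by
        rw [Nat.choose_succ_succ' j 1, Nat.choose_one_right]]
    have hs : ((-1 : ℂ) ^ j) * (-1) ^ j = 1 := by rw [← mul_pow]; simp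
    have hj := pow_ne_zero j hq'
    have hyj := pow_ne_zero j hy
    have h1 : ((-1 : ℂ) ^ j) ≠ 0 := pow_ne_zero _ (by norm_num)
    generalize qInf (q : ℂ) ((q : ℂ) ^ (j + 1) / (x * b₂)) = X
    generalize qInf (q : ℂ) ((q : ℂ) ^ (j + 1)) = Y
    generalize (x * b₂) ^ j = Z at *
    rw [pow_add, pow_add, pow_add]
    generalize (-1 : ℂ) ^ j = s at *
    generalize (q : ℂ) ^ j = w at *
    generalize (q : ℂ) ^ (j.choose 2) = v at *
    have hs' : s⁻¹ = s := inv_eq_of_mul_eq_one_left hs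
    rw [mul_inv, hs']
    field_simp
    linear_combination (v ^ 2 * X * Y) * hs
  · intro ν hν
    obtain ⟨j, rfl | rfl⟩ := ν.eq_nat_or_neg
    · rcases j with _ | j
      · exact ⟨0, rfl⟩
      · refine absurd ?_ hν
        have : thetaQuot (q : ℂ) 1 ((j + 1 : ℕ) : ℤ) = 0 := by
          rw [thetaQuot_natCast, qFin_succ', sub_self, zero_mul, zero_mul]
        beta_reduce
        rw [this, mul_zero, mul_zero]
    · exact ⟨j, rfl⟩

theorem Avoids.q_mul (hq0 : 0 < q) (h : Avoids q x b) : Avoids q x (q * b) := by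
  have hq : (q : ℂ) ≠ 0 := by exact_mod_cast hq0.ne'
  intro m hm
  refine h (m + 1) ?_
  rw [zpow_add_one₀ hq, ← hm]
  ring

/-- The moment of exponent one under `b₁ ↦ q b₁`; the boundary terms of the two lattices cancel. -/
theorem jacksonMoment_q_mul (h : Admissible q b b₂ x₁ x₂) (hb : b ≠ 0) (hb₂ : b₂ ≠ 0) :
    jacksonMoment q 0 0 (q * b) b₂ x₁ x₂ 1 = -(b / b₂) * jacksonMoment q 0 0 b b₂ x₁ x₂ 1 := by
  have hq := h.norm_lt_one
  have hq0 := h.q_pos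
  have hc : q ^ 2 * ‖(0 : ℂ)‖ * ‖(0 : ℂ)‖ < q ^ 2 * ‖b‖ * ‖b₂‖ := by
    rw [norm_zero, mul_zero]; positivity
  have key : ∀ {x : ℂ}, x ≠ 0 → Avoids q x b → Avoids q x b₂ →
      latticeMoment q 0 0 (q * b) b₂ x 1 =
        -(b / b₂) * latticeMoment q 0 0 b b₂ x 1 - b₂⁻¹ := by
    intro x hx h₁ h₂
    have s1 := summable_latticeMoment hq0 h.q_lt_one hx h₁ h₂ (k := 1) le_rfl one_le_two hc
    have s2 := summable_latticeMoment hq0 h.q_lt_one hx h₁ h₂ (k := 2) one_le_two le_rfl hc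
    have e : latticeMoment q 0 0 (q * b) b₂ x 1 =
        latticeMoment q 0 0 b b₂ x 1 - b * latticeMoment q 0 0 b b₂ x 2 := by
      refine Eq.trans ?_ (s1.hasSum.sub (s2.hasSum.mul_left b)).tsum_eq
      refine tsum_congr fun ν => ?_
      have hne := h₁.qInf_ne_zero hq0 h.q_lt_one ν
      have hne₂ := h₂.qInf_ne_zero hq0 h.q_lt_one ν
      have hz := qInf_eq_one_sub_mul hq (b * (x * (q : ℂ) ^ ν))
      rw [hz] at hne
      have n₁ := left_ne_zero_of_mul hne
      have n₂ := right_ne_zero_of_mul hne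
      rw [weight, weight, hz, mul_assoc (q : ℂ) b]
      simp only [mul_zero, zero_mul, qInf_zero]
      set z := x * (q : ℂ) ^ ν
      generalize qInf (q : ℂ) (q * (b * z)) = A at *
      generalize qInf (q : ℂ) (b₂ * z) = B at *
      generalize hC : 1 - b * z = C at *
      field_simp
      linear_combination -z * hC
    have r := latticeMoment_rel_zero hq0 h.q_lt_one hx h₁ h₂ hc
    rw [e]
    field_simp
    linear_combination r
  rw [jacksonMoment_of_pos _ _ _ _ _ _ _ one_ne_zero, jacksonMoment_of_pos _ _ _ _ _ _ _ one_ne_zero,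
    key h.x₁_ne_zero h.avoids₁₁ h.avoids₁₂, key h.x₂_ne_zero h.avoids₂₁ h.avoids₂₂]
  ring

theorem countable_not_avoids (hq0 : 0 < q) (x : ℂ) : {b : ℂ | ¬ Avoids q x b}.Countable := by
  have hq : (q : ℂ) ≠ 0 := by exact_mod_cast hq0.ne'
  refine (Set.countable_range fun m : ℤ => (x * (q : ℂ) ^ m)⁻¹).mono fun b hb => ?_
  simp only [Avoids, Set.mem_ofPred_eq, not_forall, not_not] at hb
  obtain ⟨m, hm⟩ := hb
  refine ⟨m, ?_⟩
  rw [inv_eq_iff_eq_inv]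
  exact eq_inv_of_mul_eq_one_left (by rw [← hm]; ring)

/-- The one-dimensional integral without numerator parameters. As a function of `b₁` both sides,
freed from their poles, are analytic on `ℂ ∖ {0}` and have the multiplier of a theta function, so
that it is enough to compare them at `b₁ = 1 / x₁`. -/
theorem jacksonMoment_one_mul_theta {b₁ : ℂ} (h : Admissible q b₁ b₂ x₁ x₂) (hb₁ : b₁ ≠ 0)
    (hb₂ : b₂ ≠ 0) :
    jacksonMoment q 0 0 b₁ b₂ x₁ x₂ 1 * (theta q (x₁ * b₁) * theta q (x₁ * b₂) *
      theta q (x₂ * b₁) * theta q (x₂ * b₂)) =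
    qInf q q * x₂ * theta q (x₁ / x₂) * theta q (x₁ * x₂ * b₁ * b₂) := by
  have hq := h.norm_lt_one
  have hq' := h.q_ne_zero
  have hq0 := h.q_pos
  have hq1 := h.q_lt_one
  have hx₁ := h.x₁_ne_zero
  have hx₂ := h.x₂_ne_zero
  set G : ℂ → ℂ := fun b => theta q (x₁ * b) * thetaMoment q b₂ x₂ b -
    theta q (x₂ * b) * thetaMoment q b₂ x₁ b with hG
  have hGeq : ∀ b, b ≠ 0 → Avoids q x₁ b → Avoids q x₂ b →
      G b = theta q (x₁ * b) * theta q (x₂ * b) * jacksonMoment q 0 0 b b₂ x₁ x₂ 1 := by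
    intro b hb h₁ h₂
    simp only [hG]
    rw [thetaMoment_eq hq0 hq1 hx₁ hb h₁ h.avoids₁₂, thetaMoment_eq hq0 hq1 hx₂ hb h₂ h.avoids₂₂,
      jacksonMoment_of_pos _ _ _ _ _ _ _ one_ne_zero]
    ring
  have hθ : ∀ {x b : ℂ}, x ≠ 0 → b ≠ 0 → DifferentiableAt ℂ (fun b => theta q (x * b)) b :=
    fun hx hb => (differentiableAt_theta hq (mul_ne_zero hx hb)).comp _
      ((differentiableAt_const _).mul differentiableAt_id)
  have hGd : ∀ b, b ≠ 0 → DifferentiableAt ℂ G b := fun b hb =>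
    ((hθ hx₁ hb).mul (differentiableAt_thetaMoment hq0 hq1 hx₂ hb₂ h.avoids₂₂ hb)).sub
      ((hθ hx₂ hb).mul (differentiableAt_thetaMoment hq0 hq1 hx₁ hb₂ h.avoids₁₂ hb))
  set c := x₁ * x₂ * b₂ with hc
  have hc0 : c ≠ 0 := mul_ne_zero (mul_ne_zero hx₁ hx₂) hb₂
  -- the multiplier is found away from the poles and extends by continuity
  have hmul : ∀ b, b ≠ 0 → G (q * b) = -(c * b)⁻¹ * G b := by
    set S : Set ℂ := ({0} ∪ {b | ¬ Avoids q x₁ b} ∪ {b | ¬ Avoids q x₂ b})ᶜ with hS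
    have hdense : Dense S := (((Set.countable_singleton 0).union
      (countable_not_avoids hq0 x₁)).union (countable_not_avoids hq0 x₂)).dense_compl ℂ
    intro b hb
    have : (𝓝[S] b).NeBot := mem_closure_iff_nhdsWithin_neBot.1 (hdense b)
    have hl : Tendsto (fun b => G (q * b)) (𝓝[S] b) (𝓝 (G (q * b))) :=
      (((hGd _ (mul_ne_zero hq' hb)).continuousAt.comp
        (continuous_const_mul (q : ℂ)).continuousAt).tendsto).mono_left nhdsWithin_le_nhds
    have hr : Tendsto (fun b => -(c * b)⁻¹ * G b) (𝓝[S] b) (𝓝 (-(c * b)⁻¹ * G b)) := by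
      refine Tendsto.mono_left ?_ nhdsWithin_le_nhds
      refine ContinuousAt.tendsto (ContinuousAt.mul (ContinuousAt.neg (ContinuousAt.inv₀
        (by fun_prop) (mul_ne_zero hc0 hb))) (hGd b hb).continuousAt)
    refine tendsto_nhds_unique_of_eventuallyEq hl hr ?_
    filter_upwards [self_mem_nhdsWithin] with w hw
    simp only [hS, Set.mem_compl_iff, Set.mem_union, Set.mem_singleton_iff, Set.mem_ofPred_eq, not_or,
      not_not] at hw
    obtain ⟨⟨hw0, hw₁⟩, hw₂⟩ := hw
    have hadm : Admissible q w b₂ x₁ x₂ :=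
      ⟨hq0, hq1, hx₁, hx₂, hw₁, h.avoids₁₂, hw₂, h.avoids₂₂⟩
    rw [hGeq w hw0 hw₁ hw₂, hGeq _ (mul_ne_zero hq' hw0) (hw₁.q_mul hq0) (hw₂.q_mul hq0),
      jacksonMoment_q_mul hadm hw0 hb₂, mul_left_comm x₁, mul_left_comm x₂,
      theta_q_mul hq hq' (mul_ne_zero hx₁ hw0), theta_q_mul hq hq' (mul_ne_zero hx₂ hw0), hc]
    field_simp
  have hcmp := mul_theta_eq_of_multiplier (fun b hb => (hGd b hb).differentiableWithinAt) hq0 hq1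
    hc0 hmul (inv_ne_zero hx₁) hb₁
  have hβ : G x₁⁻¹ = -(theta q (x₂ / x₁) * thetaMoment q b₂ x₁ x₁⁻¹) := by
    simp only [hG]
    rw [mul_inv_cancel₀ hx₁, theta_eq_zero hq hq' (m := 0) (by simp), zero_mul, zero_sub,
      div_eq_mul_inv]
  rw [hβ, hGeq b₁ hb₁ h.avoids₁₁ h.avoids₂₁,
    show c * x₁⁻¹ = x₂ * b₂ by rw [hc]; field_simp] at hcmp
  have hinv := theta_inv hq (div_ne_zero hx₁ hx₂)
  rw [inv_div] at hinv
  have hv := theta_mul_thetaMoment_inv hq0 hq1 hx₁ hb₂ h.avoids₁₂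
  rw [show x₁ * x₂ * b₁ * b₂ = c * b₁ by rw [hc]; ring]
  have hfin : x₁ * theta q (x₂ / x₁) = -x₂ * theta q (x₁ / x₂) := by
    rw [hinv]; field_simp
  linear_combination theta q (x₁ * b₂) * hcmp - theta q (x₂ / x₁) * theta q (c * b₁) * hv -
    qInf q q * theta q (c * b₁) * hfin

end ThetaFormula

/-! ### From iterated Jackson integrals to moments -/

section Jackson

theorem jacksonZero_sum {ι : Type*} (q a : ℂ) (s : Finset ι) (c : ι → ℂ) (φ : ι → ℂ → ℂ)
    (hφ : ∀ d ∈ s, Summable fun ν : ℤ => φ d (a * q ^ ν) * (a * q ^ ν)) :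
    jacksonZero q a (fun z => ∑ d ∈ s, c d * φ d z) = ∑ d ∈ s, c d * jacksonZero q a (φ d) := by
  simp only [jacksonZero, Finset.sum_mul, mul_assoc]
  rw [Summable.tsum_finsetSum fun d hd => (hφ d hd).mul_left (c d), Finset.mul_sum]
  refine Finset.sum_congr rfl fun d _ => ?_
  rw [tsum_mul_left, mul_left_comm]

theorem jackson_sum {ι : Type*} (q a b : ℂ) (s : Finset ι) (c : ι → ℂ) (φ : ι → ℂ → ℂ)
    (ha : ∀ d ∈ s, Summable fun ν : ℤ => φ d (a * q ^ ν) * (a * q ^ ν))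
    (hb : ∀ d ∈ s, Summable fun ν : ℤ => φ d (b * q ^ ν) * (b * q ^ ν)) :
    jackson q a b (fun z => ∑ d ∈ s, c d * φ d z) = ∑ d ∈ s, c d * jackson q a b (φ d) := by
  rw [jackson, jacksonZero_sum q a s c φ ha, jacksonZero_sum q b s c φ hb,
    ← Finset.sum_sub_distrib]
  exact Finset.sum_congr rfl fun d _ => (mul_sub _ _ _).symm

theorem jackson_congr {q a b : ℂ} (hq : q ≠ 0) (ha : a ≠ 0) (hb : b ≠ 0) {f g : ℂ → ℂ}
    (h : ∀ z, z ≠ 0 → f z = g z) : jackson q a b f = jackson q a b g := by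
  have key : ∀ {x : ℂ}, x ≠ 0 → jacksonZero q x f = jacksonZero q x g := fun hx => by
    simp only [jacksonZero]
    congr 1
    exact tsum_congr fun ν => by rw [h _ (mul_ne_zero hx (zpow_ne_zero ν hq))]
  rw [jackson, jackson, key ha, key hb]

theorem jacksonIter_congr {q a b : ℂ} (hq : q ≠ 0) (ha : a ≠ 0) (hb : b ≠ 0) {n : ℕ}
    {f g : (Fin n → ℂ) → ℂ} (h : ∀ z, (∀ i, z i ≠ 0) → f z = g z) :
    jacksonIter q a b n f = jacksonIter q a b n g := by
  induction n with
  | zero => exact h _ fun i => i.elim0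
  | succ n ih =>
    refine jackson_congr hq ha hb fun z hz => ih fun w hw => h _ fun i => ?_
    refine Fin.lastCases ?_ (fun i => ?_) i
    · simpa using hz
    · simpa using hw i

/-- Fubini for finite sums of products of functions of one variable. -/
theorem jacksonIter_sum_prod {ι : Type*} (q a b : ℂ) (s : Finset ι) {n : ℕ} (c : ι → ℂ)
    (φ : ι → Fin n → ℂ → ℂ)
    (ha : ∀ d ∈ s, ∀ i, Summable fun ν : ℤ => φ d i (a * q ^ ν) * (a * q ^ ν))
    (hb : ∀ d ∈ s, ∀ i, Summable fun ν : ℤ => φ d i (b * q ^ ν) * (b * q ^ ν)) :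
    jacksonIter q a b n (fun z => ∑ d ∈ s, c d * ∏ i, φ d i (z i)) =
      ∑ d ∈ s, c d * ∏ i, jackson q a b (φ d i) := by
  induction n generalizing c with
  | zero => simp [jacksonIter]
  | succ n ih =>
    have hin : ∀ z, jacksonIter q a b n (fun w => ∑ d ∈ s, c d *
        ∏ i, φ d i (Fin.snoc (α := fun _ => ℂ) w z i)) =
        ∑ d ∈ s, (c d * ∏ i : Fin n, jackson q a b (φ d i.castSucc)) * φ d (Fin.last n) z := by
      intro z
      have := ih (fun d => c d * φ d (Fin.last n) z) (fun d i => φ d i.castSucc)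
        (fun d hd i => ha d hd _) (fun d hd i => hb d hd _)
      simp only [Fin.prod_univ_castSucc, Fin.snoc_castSucc, Fin.snoc_last]
      refine Eq.trans ?_ (this.trans ?_)
      · refine congrArg _ (funext fun w => Finset.sum_congr rfl fun d _ => by ring)
      · exact Finset.sum_congr rfl fun d _ => by ring
    rw [jacksonIter]
    simp only [hin]
    rw [jackson_sum q a b s _ (fun d => φ d (Fin.last n)) (fun d hd => ha d hd _)
      fun d hd => hb d hd _]
    exact Finset.sum_congr rfl fun d _ => by rw [Fin.prod_univ_castSucc, mul_assoc]

theorem summable_norm_prod {n : ℕ} {g : Fin n → ℤ → ℂ} (hg : ∀ i, Summable fun ν => ‖g i ν‖) :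
    Summable fun ν : Fin n → ℤ => ‖∏ i, g i (ν i)‖ := by
  induction n with
  | zero => exact Summable.of_finite
  | succ n ih =>
    rw [← (Fin.consEquiv fun _ => ℤ).summable_iff]
    refine ((hg 0).mul_of_nonneg (ih fun i => hg i.succ) (fun _ => norm_nonneg _)
      fun _ => norm_nonneg _).congr fun p => ?_
    simp [Fin.prod_univ_succ, Fin.consEquiv]

end Jackson

section Integrand

open MvPolynomial

theorem momentFunctional_prod_X_mul {n : ℕ} (μ : ℕ → ℂ) (p : MvPolynomial (Fin n) ℂ) :
    momentFunctional μ n ((∏ j, X j) * p) = ∑ d ∈ p.support, p.coeff d * ∏ i, μ (d i + 1) := by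
  conv_lhs => rw [p.as_sum, Finset.mul_sum, map_sum]
  refine Finset.sum_congr rfl fun d _ => ?_
  rw [← momentFunctional_C_mul_prod μ (p.coeff d) fun i => d i + 1, monomial_eq_C_mul_prod]
  refine congrArg _ ?_
  simp only [pow_succ, Finset.prod_mul_distrib]
  ring

theorem eval_symKernel (q : ℂ) (τ n : ℕ) (z : Fin n → ℂ) :
    eval z (symKernel q τ n) = pairProd fun j k => symPair q τ (z j) (z k) := by
  rw [symKernel, map_pairProd]
  congr! 3 with j k
  have := map_symPair (aeval z) q τ (X j) (X k)
  rw [← coe_aeval_eq_eval]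
  simpa using this

theorem symPair_eq_qFin (q : ℂ) (τ : ℕ) {x y : ℂ} (hx : x ≠ 0) (hy : y ≠ 0) :
    symPair q τ x y = x ^ τ * y ^ τ * (qFin q (x / y) τ * qFin q (y / x) τ) := by
  have : ∀ c : ℂ, c ^ τ = ∏ _i ∈ Finset.range τ, c := fun c => by simp
  rw [symPair, qFin, qFin, this x, this y, ← Finset.prod_mul_distrib, ← Finset.prod_mul_distrib,
    ← Finset.prod_mul_distrib]
  refine Finset.prod_congr rfl fun i _ => ?_
  simp only [smul_eq_mul]
  field_simp

/-- The integrand is the product of the one-variable weights and of the symmetric kernel. -/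
theorem integrand_eq (q a₁ a₂ b₁ b₂ : ℂ) (τ n : ℕ) {z : Fin n → ℂ} (hz : ∀ i, z i ≠ 0) :
    integrand q a₁ a₂ b₁ b₂ τ n z = ∑ d ∈ (symKernel q τ n).support, (symKernel q τ n).coeff d *
      ∏ i, weight q a₁⁻¹ a₂⁻¹ b₁ b₂ (z i) * z i ^ d i := by
  have h₁ : eval z (symKernel q τ n) = (∏ i, z i ^ ((n - 1) * τ)) *
      pairProd fun j k => qFin q (z j / z k) τ * qFin q (z k / z j) τ := by
    rw [eval_symKernel, ← pairProd_pow_mul, ← pairProd_mul]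
    exact pairProd_congr fun j k _ => symPair_eq_qFin q τ (hz j) (hz k)
  have h₂ : integrand q a₁ a₂ b₁ b₂ τ n z =
      (∏ i, weight q a₁⁻¹ a₂⁻¹ b₁ b₂ (z i)) * eval z (symKernel q τ n) := by
    rw [h₁, ← mul_assoc, ← Finset.prod_mul_distrib]
    unfold integrand pairProd weight
    congr 1
    exact Finset.prod_congr rfl fun i _ => by ring
  rw [h₂, eval_eq', Finset.mul_sum]
  refine Finset.sum_congr rfl fun d _ => ?_
  rw [Finset.prod_mul_distrib]
  ring

variable {q : ℝ} {b₁ b₂ x₁ x₂ : ℂ}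

theorem le_of_mem_support_symKernel {τ n : ℕ} {d : Fin n →₀ ℕ}
    (hd : d ∈ (symKernel (q : ℂ) τ n).support) (i : Fin n) : d i ≤ 2 * (n - 1) * τ :=
  (monomial_le_degreeOf i hd).trans (degreeOf_symKernel_le (q : ℂ) τ n i)

theorem summable_integrand (h : Admissible q b₁ b₂ x₁ x₂) {a₁ a₂ : ℂ} {τ n : ℕ}
    (hconv : q ^ 2 * ‖a₁⁻¹‖ * ‖a₂⁻¹‖ < q ^ (2 * (n - 1) * τ + 1) * ‖b₁‖ * ‖b₂‖)
    {y : Fin n → ℂ} (hy : ∀ i, y i = x₁ ∨ y i = x₂) :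
    Summable fun ν : Fin n → ℤ => ‖integrand q a₁ a₂ b₁ b₂ τ n (fun i => y i * (q : ℂ) ^ ν i) *
      ∏ i, (y i * (q : ℂ) ^ ν i)‖ := by
  have hy0 : ∀ i, y i ≠ 0 := fun i => by
    rcases hy i with h' | h' <;> rw [h']
    exacts [h.x₁_ne_zero, h.x₂_ne_zero]
  have hsum : ∀ k ≤ 2 * (n - 1) * τ, ∀ i, Summable fun ν : ℤ =>
      ‖weight q a₁⁻¹ a₂⁻¹ b₁ b₂ (y i * (q : ℂ) ^ ν) * (y i * (q : ℂ) ^ ν) ^ (k + 1)‖ := by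
    intro k hk i
    refine Summable.norm (summable_latticeMoment h.q_pos h.q_lt_one (hy0 i) ?_ ?_
      (Nat.succ_pos k) (Nat.succ_le_succ hk) hconv)
    · rcases hy i with h' | h' <;> rw [h']
      exacts [h.avoids₁₁, h.avoids₂₁]
    · rcases hy i with h' | h' <;> rw [h']
      exacts [h.avoids₁₂, h.avoids₂₂]
  have hall := summable_sum (s := (symKernel (q : ℂ) τ n).support) fun d hd =>
    (summable_norm_prod (g := fun i ν => weight q a₁⁻¹ a₂⁻¹ b₁ b₂ (y i * (q : ℂ) ^ ν) *
      (y i * (q : ℂ) ^ ν) ^ (d i + 1)) fun i =>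
        hsum _ (le_of_mem_support_symKernel hd i) i).mul_left ‖(symKernel (q : ℂ) τ n).coeff d‖
  refine Summable.of_nonneg_of_le (fun _ => norm_nonneg _) (fun ν => ?_) hall
  rw [integrand_eq _ _ _ _ _ _ _ fun i => mul_ne_zero (hy0 i) (zpow_ne_zero _ h.q_ne_zero),
    Finset.sum_mul]
  refine (norm_sum_le _ _).trans (le_of_eq ?_)
  refine Finset.sum_congr rfl fun d _ => ?_
  rw [mul_assoc, ← Finset.prod_mul_distrib, norm_mul]
  simp only [pow_succ, mul_assoc]

theorem jacksonIter_integrand (h : Admissible q b₁ b₂ x₁ x₂) {a₁ a₂ : ℂ} {τ n : ℕ}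
    (hconv : q ^ 2 * ‖a₁⁻¹‖ * ‖a₂⁻¹‖ < q ^ (2 * (n - 1) * τ + 1) * ‖b₁‖ * ‖b₂‖) :
    jacksonIter q x₁ x₂ n (integrand q a₁ a₂ b₁ b₂ τ n) =
      (1 - q) ^ n * symIntegral (jacksonMoment q a₁⁻¹ a₂⁻¹ b₁ b₂ x₁ x₂) q τ n := by
  have hsum : ∀ {x : ℂ}, x ≠ 0 → Avoids q x b₁ → Avoids q x b₂ → ∀ k ≤ 2 * (n - 1) * τ,
      Summable fun ν : ℤ => weight q a₁⁻¹ a₂⁻¹ b₁ b₂ (x * (q : ℂ) ^ ν) * (x * (q : ℂ) ^ ν) ^ k *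
        (x * (q : ℂ) ^ ν) := by
    intro x hx h₁ h₂ k hk
    simpa only [pow_succ, mul_assoc] using summable_latticeMoment h.q_pos h.q_lt_one hx h₁ h₂
      (Nat.succ_pos k) (Nat.succ_le_succ hk) hconv
  rw [jacksonIter_congr h.q_ne_zero h.x₁_ne_zero h.x₂_ne_zero fun z hz =>
      integrand_eq (q : ℂ) a₁ a₂ b₁ b₂ τ n hz,
    jacksonIter_sum_prod (q : ℂ) x₁ x₂ _ (fun d => (symKernel (q : ℂ) τ n).coeff d)
      (fun d i z => weight q a₁⁻¹ a₂⁻¹ b₁ b₂ z * z ^ d i)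
      (fun d hd i => hsum h.x₁_ne_zero h.avoids₁₁ h.avoids₁₂ _ (le_of_mem_support_symKernel hd i))
      (fun d hd i => hsum h.x₂_ne_zero h.avoids₂₁ h.avoids₂₂ _ (le_of_mem_support_symKernel hd i)),
    symIntegral, momentFunctional_prod_X_mul, Finset.mul_sum]
  refine Finset.sum_congr rfl fun d _ => ?_
  have hj : ∀ k, jackson q x₁ x₂ (fun z => weight q a₁⁻¹ a₂⁻¹ b₁ b₂ z * z ^ k) =
      (1 - q) * jacksonMoment q a₁⁻¹ a₂⁻¹ b₁ b₂ x₁ x₂ (k + 1) := by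
    intro k
    rw [jacksonMoment_of_pos _ _ _ _ _ _ _ k.succ_ne_zero, jackson, jacksonZero, jacksonZero,
      latticeMoment, latticeMoment, mul_sub]
    simp only [pow_succ, mul_assoc]
  simp only [hj, Finset.prod_mul_distrib, Finset.prod_const, Finset.card_univ, Fintype.card_fin]
  ring

end Integrand

/-! ### Collecting the constants -/

section Constants

theorem sum_shift_exponents (τ n : ℕ) :
    ∑ k ∈ Finset.range (n + 1), (k * τ * ((n - k) * τ) + 4 * (k * τ).choose 2 + τ * k * (k * τ)) =
      ∑ k ∈ Finset.range (n + 1), (((n + k) * τ).choose 2 + k * τ.choose 2) := by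
  have key : ∀ N : ℕ, ∑ k ∈ Finset.range N, ((k : ℚ) * τ * ((n - k) * τ) +
      4 * ((k * τ) * (k * τ - 1) / 2) + τ * k * (k * τ) -
      ((n + k) * τ * ((n + k) * τ - 1) / 2 + k * (τ * (τ - 1) / 2))) =
      N * (N - 1 - n) * τ * (τ * (N + n) - 2) / 2 - N * (N - 1 - n) * τ * (τ - 1) / 2 := by
    intro N
    induction N with
    | zero => simp
    | succ N ih => rw [Finset.sum_range_succ, ih]; push_cast; ring
  have h := key (n + 1)
  rw [Finset.sum_sub_distrib] at h
  have h' : ((n + 1 : ℕ) : ℚ) - 1 - n = 0 := by push_cast; ring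
  rw [h'] at h
  simp only [mul_zero, zero_mul, zero_div, sub_zero, sub_eq_zero] at h
  have hQ : ((∑ k ∈ Finset.range (n + 1),
      (k * τ * ((n - k) * τ) + 4 * (k * τ).choose 2 + τ * k * (k * τ)) : ℕ) : ℚ) =
      (∑ k ∈ Finset.range (n + 1), (((n + k) * τ).choose 2 + k * τ.choose 2) : ℕ) := by
    push_cast
    simp only [Nat.cast_choose_two]
    push_cast
    rw [← h]
    refine Finset.sum_congr rfl fun k hk => ?_
    rw [Nat.cast_sub (Nat.lt_succ_iff.1 (Finset.mem_range.1 hk))]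
  exact_mod_cast hQ

/-- The factors which the theta functions of the closed formula acquire when their arguments are
shifted back to the lattice base points. -/
theorem prod_shift_factors (q X β : ℂ) (τ n : ℕ) :
    ∏ k ∈ Finset.range (n + 1), (X * q ^ (k * τ)) ^ ((n - k) * τ) *
        (((X * β) ^ 2) ^ (k * τ) * q ^ (4 * (k * τ).choose 2)) * (β * (q ^ τ) ^ k) ^ (k * τ) =
      ∏ k ∈ Finset.range (n + 1), (-(X * β)) ^ ((n + k) * τ) * q ^ ((n + k) * τ).choose 2 *
        ((-1) ^ (k * τ) * q ^ (k * τ.choose 2)) := by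
  have hr : ∑ k ∈ Finset.range (n + 1), (n - k) * τ = ∑ k ∈ Finset.range (n + 1), k * τ := by
    rw [← Finset.sum_range_reflect]
    refine Finset.sum_congr rfl fun k hk => ?_
    have := Finset.mem_range.1 hk
    congr 1
    omega
  have hl : ∀ k, (X * q ^ (k * τ)) ^ ((n - k) * τ) *
        (((X * β) ^ 2) ^ (k * τ) * q ^ (4 * (k * τ).choose 2)) * (β * (q ^ τ) ^ k) ^ (k * τ) =
      X ^ ((n - k) * τ) * β ^ (k * τ) * (X * β) ^ (2 * (k * τ)) *
        q ^ (k * τ * ((n - k) * τ) + 4 * (k * τ).choose 2 + τ * k * (k * τ)) := by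
    intro k
    rw [mul_pow, mul_pow β, ← pow_mul, ← pow_mul, ← pow_mul, ← pow_mul, pow_add, pow_add]
    ring
  have hR : ∀ k, (-(X * β)) ^ ((n + k) * τ) * q ^ ((n + k) * τ).choose 2 *
        ((-1) ^ (k * τ) * q ^ (k * τ.choose 2)) =
      (-1) ^ ((n + k) * τ + k * τ) * (X * β) ^ ((n + k) * τ) *
        q ^ (((n + k) * τ).choose 2 + k * τ.choose 2) := by
    intro k
    rw [neg_pow, pow_add, pow_add]
    ring
  have hsign : ∑ k ∈ Finset.range (n + 1), ((n + k) * τ + k * τ) = 2 * ((n + 1) * n * τ) := by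
    have h2 := Finset.sum_range_id_mul_two (n + 1)
    rw [Nat.add_sub_cancel] at h2
    have : ∀ k, (n + k) * τ + k * τ = n * τ + k * (2 * τ) := fun k => by ring
    simp only [this]
    rw [Finset.sum_add_distrib, Finset.sum_const, Finset.card_range, smul_eq_mul, ← Finset.sum_mul,
      ← mul_assoc _ 2 τ, h2]
    ring
  have hB : ∑ k ∈ Finset.range (n + 1), (k * τ + 2 * (k * τ)) =
      ∑ k ∈ Finset.range (n + 1), (n + k) * τ := by
    have : ∀ k, (n + k) * τ = n * τ + k * τ := fun k => by ring
    simp only [this, Finset.sum_add_distrib]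
    have h2 := Finset.sum_range_id_mul_two (n + 1)
    rw [Nat.add_sub_cancel] at h2
    rw [← Finset.mul_sum, ← Finset.sum_mul, Finset.sum_const, Finset.card_range, smul_eq_mul]
    linear_combination τ * h2
  simp only [hl, hR, Finset.prod_mul_distrib, Finset.prod_pow_eq_pow_sum, sum_shift_exponents,
    hr, hsign]
  rw [pow_mul (-1 : ℂ) 2, neg_one_sq, one_pow, one_mul, ← mul_pow, ← pow_add, ← Finset.sum_add_distrib,
    hB]

variable {q : ℝ} {b₁ b₂ x₁ x₂ : ℂ}

theorem theta_shift {q : ℂ} (hq : ‖q‖ < 1) (hq0 : q ≠ 0) {a : ℂ} (ha : a ≠ 0) (m : ℕ) :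
    theta q (a * q ^ m) = theta q a / ((-a) ^ m * q ^ m.choose 2) := by
  rw [eq_div_iff (mul_ne_zero (pow_ne_zero _ (neg_ne_zero.2 ha)) (pow_ne_zero _ hq0)),
    ← theta_pow_mul hq hq0 ha m, mul_comm a]
  ring

theorem Avoids.theta_ne_zero (hq0 : 0 < q) (hq1 : q < 1) {x b : ℂ} (hx : x ≠ 0) (hb : b ≠ 0)
    (h : Avoids q x b) : theta q (x * b) ≠ 0 :=
  AskeyEvans.theta_ne_zero (norm_ofReal_lt_one hq0 hq1) (by exact_mod_cast hq0.ne')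
    (mul_ne_zero hx hb) h

/-- The product of shifted theta functions in the closed formula, in terms of the one-dimensional
formula. -/
theorem prod_theta_shift (h : Admissible q b₁ b₂ x₁ x₂) (hb₁ : b₁ ≠ 0) (hb₂ : b₂ ≠ 0) (τ n : ℕ) :
    ∏ k ∈ Finset.range (n + 1),
      ((x₁ * x₂ * (q : ℂ) ^ (k * τ)) ^ ((n - k) * τ) * x₂ * theta q (x₁ / x₂) *
        theta q (x₁ * x₂ * b₁ * b₂ * (q : ℂ) ^ ((n + k) * τ))) /
        (theta q (x₁ * b₁ * (q : ℂ) ^ (k * τ)) * theta q (x₁ * b₂ * (q : ℂ) ^ (k * τ)) *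
          theta q (x₂ * b₁ * (q : ℂ) ^ (k * τ)) * theta q (x₂ * b₂ * (q : ℂ) ^ (k * τ))) =
    (∏ k ∈ Finset.range (n + 1), (-1) ^ (k * τ) * (q : ℂ) ^ (k * τ.choose 2) /
      (b₁ * b₂ * ((q : ℂ) ^ τ) ^ k) ^ (k * τ)) *
    ((x₂ * theta q (x₁ / x₂) * theta q (x₁ * x₂ * b₁ * b₂)) /
      (theta q (x₁ * b₁) * theta q (x₁ * b₂) * theta q (x₂ * b₁) * theta q (x₂ * b₂))) ^ (n + 1) := by
  have hq := h.norm_lt_one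
  have hq0 := h.q_ne_zero
  have hx₁ := h.x₁_ne_zero
  have hx₂ := h.x₂_ne_zero
  have hp := prod_shift_factors (q : ℂ) (x₁ * x₂) (b₁ * b₂) τ n
  set B := x₁ * x₂ * (b₁ * b₂) with hB
  have hBne : B ≠ 0 := mul_ne_zero (mul_ne_zero hx₁ hx₂) (mul_ne_zero hb₁ hb₂)
  have hBeq : x₁ * x₂ * b₁ * b₂ = B := by rw [hB]; ring
  have t₁ := h.avoids₁₁.theta_ne_zero h.q_pos h.q_lt_one hx₁ hb₁
  have t₂ := h.avoids₁₂.theta_ne_zero h.q_pos h.q_lt_one hx₁ hb₂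
  have t₃ := h.avoids₂₁.theta_ne_zero h.q_pos h.q_lt_one hx₂ hb₁
  have t₄ := h.avoids₂₂.theta_ne_zero h.q_pos h.q_lt_one hx₂ hb₂
  set V := (x₂ * theta q (x₁ / x₂) * theta q B) /
      (theta q (x₁ * b₁) * theta q (x₁ * b₂) * theta q (x₂ * b₁) * theta q (x₂ * b₂)) with hV
  have hterm : ∀ k, ((x₁ * x₂ * (q : ℂ) ^ (k * τ)) ^ ((n - k) * τ) * x₂ * theta q (x₁ / x₂) *
        theta q (B * (q : ℂ) ^ ((n + k) * τ))) /
        (theta q (x₁ * b₁ * (q : ℂ) ^ (k * τ)) * theta q (x₁ * b₂ * (q : ℂ) ^ (k * τ)) *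
          theta q (x₂ * b₁ * (q : ℂ) ^ (k * τ)) * theta q (x₂ * b₂ * (q : ℂ) ^ (k * τ))) =
      ((x₁ * x₂ * (q : ℂ) ^ (k * τ)) ^ ((n - k) * τ) *
        ((B ^ 2) ^ (k * τ) * (q : ℂ) ^ (4 * (k * τ).choose 2))) /
        ((-B) ^ ((n + k) * τ) * (q : ℂ) ^ ((n + k) * τ).choose 2) * V := by
    intro k
    rw [theta_shift hq hq0 hBne, theta_shift hq hq0 (mul_ne_zero hx₁ hb₁),
      theta_shift hq hq0 (mul_ne_zero hx₁ hb₂), theta_shift hq hq0 (mul_ne_zero hx₂ hb₁),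
      theta_shift hq hq0 (mul_ne_zero hx₂ hb₂)]
    have hB2 : (B ^ 2) ^ (k * τ) = (-(x₁ * b₁)) ^ (k * τ) * (-(x₁ * b₂)) ^ (k * τ) *
        ((-(x₂ * b₁)) ^ (k * τ) * (-(x₂ * b₂)) ^ (k * τ)) := by
      rw [← mul_pow, ← mul_pow, ← mul_pow, hB]; ring
    rw [hB2, mul_comm 4, pow_mul _ _ 4, hV]
    have n₁ := pow_ne_zero (k * τ) (neg_ne_zero.2 (mul_ne_zero hx₁ hb₁))
    have n₂ := pow_ne_zero (k * τ) (neg_ne_zero.2 (mul_ne_zero hx₁ hb₂))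
    have n₃ := pow_ne_zero (k * τ) (neg_ne_zero.2 (mul_ne_zero hx₂ hb₁))
    have n₄ := pow_ne_zero (k * τ) (neg_ne_zero.2 (mul_ne_zero hx₂ hb₂))
    have n₅ := pow_ne_zero ((k * τ).choose 2) hq0
    have n₆ := pow_ne_zero ((n + k) * τ) (neg_ne_zero.2 hBne)
    have n₇ := pow_ne_zero (((n + k) * τ).choose 2) hq0
    generalize (x₁ * x₂ * (q : ℂ) ^ (k * τ)) ^ ((n - k) * τ) = A
    generalize (-(x₁ * b₁)) ^ (k * τ) = c₁ at *
    generalize (-(x₁ * b₂)) ^ (k * τ) = c₂ at *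
    generalize (-(x₂ * b₁)) ^ (k * τ) = c₃ at *
    generalize (-(x₂ * b₂)) ^ (k * τ) = c₄ at *
    generalize (q : ℂ) ^ (k * τ).choose 2 = c₅ at *
    generalize (-B) ^ ((n + k) * τ) = c₆ at *
    generalize (q : ℂ) ^ ((n + k) * τ).choose 2 = c₇ at *
    generalize theta q (x₁ * b₁) = d₁ at *
    generalize theta q (x₁ * b₂) = d₂ at *
    generalize theta q (x₂ * b₁) = d₃ at *
    generalize theta q (x₂ * b₂) = d₄ at *
    generalize theta q (x₁ / x₂) = d₅ at *
    generalize theta q B = d₆ at *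
    field_simp
  simp only [hBeq, hterm]
  rw [Finset.prod_mul_distrib, Finset.prod_const, Finset.card_range, ← hV]
  congr 1
  rw [Finset.prod_div_distrib, Finset.prod_div_distrib]
  rw [Finset.prod_mul_distrib (g := fun k => (b₁ * b₂ * ((q : ℂ) ^ τ) ^ k) ^ (k * τ)),
    Finset.prod_mul_distrib (g := fun k => (-1) ^ (k * τ) * (q : ℂ) ^ (k * τ.choose 2))] at hp
  rw [div_eq_div_iff]
  · rw [hp]; ring
  · exact Finset.prod_ne_zero_iff.2 fun k _ => mul_ne_zero (pow_ne_zero _ (neg_ne_zero.2 hBne))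
      (pow_ne_zero _ hq0)
  · exact Finset.prod_ne_zero_iff.2 fun k _ => pow_ne_zero _ (mul_ne_zero (mul_ne_zero hb₁ hb₂)
      (pow_ne_zero _ (pow_ne_zero _ hq0)))

theorem qFin_self_div (hq0 : 0 < q) (hq1 : q < 1) {m : ℕ} (hm : m ≠ 0) :
    qFin (q : ℂ) q m = (1 - (q : ℂ) ^ m) * (qInf q q / qInf (q : ℂ) ((q : ℂ) ^ m)) := by
  have hq := norm_ofReal_lt_one hq0 hq1
  have h₁ := qFin_mul_qInf hq (q : ℂ) m
  have h₂ := qInf_eq_one_sub_mul hq ((q : ℂ) ^ m)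
  rw [mul_comm (q : ℂ)] at h₂
  have hQ : qInf (q : ℂ) q ≠ 0 := qInf_ne_zero_of_norm_lt_one hq hq
  have h₃ := one_sub_pow_ne_zero hq hm
  have h₄ := right_ne_zero_of_mul (h₁.trans_ne hQ)
  rw [h₂, ← h₁]
  generalize qInf (q : ℂ) ((q : ℂ) ^ m * q) = Y at *
  generalize 1 - (q : ℂ) ^ m = w at *
  field_simp

/-- The symmetric integral, in terms of the one-dimensional integral without numerator
parameters. -/
theorem symIntegral_jacksonMoment (h : Admissible q b₁ b₂ x₁ x₂) (hb₁ : b₁ ≠ 0) (hb₂ : b₂ ≠ 0)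
    {τ : ℕ} (hτ : 1 ≤ τ) (n : ℕ) {α₁ α₂ : ℂ}
    (hconv : q ^ 2 * ‖α₁‖ * ‖α₂‖ < q ^ (2 * n * τ + 1) * ‖b₁‖ * ‖b₂‖) :
    symIntegral (jacksonMoment q α₁ α₂ b₁ b₂ x₁ x₂) q τ (n + 1) * ∏ k ∈ Finset.range (n + 1),
        qInf q (q * α₁ * α₂ * b₁⁻¹ * b₂⁻¹ * (((q : ℂ) ^ τ) ^ (n + k))⁻¹) =
      (n + 1).factorial * (∏ k ∈ Finset.range (n + 1),
        qInf q ((q : ℂ) ^ τ) * (qInf (q : ℂ) (q * α₁ * b₁⁻¹ * (((q : ℂ) ^ τ) ^ k)⁻¹) *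
        qInf q (q * α₁ * b₂⁻¹ * (((q : ℂ) ^ τ) ^ k)⁻¹) *
        qInf q (q * α₂ * b₁⁻¹ * (((q : ℂ) ^ τ) ^ k)⁻¹) *
        qInf q (q * α₂ * b₂⁻¹ * (((q : ℂ) ^ τ) ^ k)⁻¹)) / qInf q (((q : ℂ) ^ τ) ^ (k + 1))) *
      (∏ k ∈ Finset.range (n + 1), (-1) ^ (k * τ) * (q : ℂ) ^ (k * τ.choose 2) /
        (b₁ * b₂ * ((q : ℂ) ^ τ) ^ k) ^ (k * τ)) *
      jacksonMoment q 0 0 b₁ b₂ x₁ x₂ 1 ^ (n + 1) := by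
  have hq := h.norm_lt_one
  have hs := symIntegral_eq hτ (jacksonMoment q α₁ α₂ b₁ b₂ x₁ x₂) (q : ℂ) (n + 1)
  have hr := ordJackson_reduce h hb₁ hb₂ hτ n hconv
  rw [ordJackson_zero h hb₁ hb₂ hτ n, ordJackson] at hr
  have hτ0 : τ ≠ 0 := by omega
  have hpow : ∀ k, ((q : ℂ) ^ τ) ^ (k + 1) = (q : ℂ) ^ ((k + 1) * τ) := fun k => by
    rw [← pow_mul, mul_comm]
  have hne : ∏ k ∈ Finset.range (n + 1), (1 - ((q : ℂ) ^ τ) ^ (k + 1)) ≠ 0 :=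
    Finset.prod_ne_zero_iff.2 fun k _ => by
      rw [hpow]; exact one_sub_pow_ne_zero hq (mul_ne_zero k.succ_ne_zero hτ0)
  have hQ : qInf (q : ℂ) q ≠ 0 := qInf_ne_zero_of_norm_lt_one hq hq
  have hQpow : ∀ {m : ℕ}, m ≠ 0 → qInf (q : ℂ) ((q : ℂ) ^ m) ≠ 0 := fun hm =>
    qInf_ne_zero_of_norm_lt_one hq (by
      rw [norm_pow]; exact pow_lt_one₀ (norm_nonneg _) hq hm)
  have hfac : (1 - (q : ℂ) ^ τ) ^ (n + 1) * ∏ k ∈ Finset.range (n + 1),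
      ((-1) ^ (k * τ) * (q : ℂ) ^ (k * τ.choose 2) * qFin q q ((k + 1) * τ) /
        ((b₁ * b₂ * ((q : ℂ) ^ τ) ^ k) ^ (k * τ) * qFin q q τ)) =
      (∏ k ∈ Finset.range (n + 1), (1 - ((q : ℂ) ^ τ) ^ (k + 1))) *
      ((∏ k ∈ Finset.range (n + 1), qInf q ((q : ℂ) ^ τ) / qInf q (((q : ℂ) ^ τ) ^ (k + 1))) *
      ∏ k ∈ Finset.range (n + 1), (-1) ^ (k * τ) * (q : ℂ) ^ (k * τ.choose 2) /
        (b₁ * b₂ * ((q : ℂ) ^ τ) ^ k) ^ (k * τ)) := by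
    have hconst : (1 - (q : ℂ) ^ τ) ^ (n + 1) = ∏ _k ∈ Finset.range (n + 1), (1 - (q : ℂ) ^ τ) := by
      simp
    rw [hconst, ← Finset.prod_mul_distrib, ← Finset.prod_mul_distrib, ← Finset.prod_mul_distrib]
    refine Finset.prod_congr rfl fun k _ => ?_
    have hk0 : (k + 1) * τ ≠ 0 := mul_ne_zero k.succ_ne_zero hτ0
    rw [hpow, qFin_self_div h.q_pos h.q_lt_one hk0, qFin_self_div h.q_pos h.q_lt_one hτ0]
    have n₁ := one_sub_pow_ne_zero hq hτ0
    have n₂ := hQpow hτ0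
    have n₃ := hQpow hk0
    generalize (b₁ * b₂ * ((q : ℂ) ^ τ) ^ k) ^ (k * τ) = w
    generalize qInf (q : ℂ) ((q : ℂ) ^ τ) = y at *
    generalize qInf (q : ℂ) ((q : ℂ) ^ ((k + 1) * τ)) = y' at *
    generalize 1 - (q : ℂ) ^ τ = s at *
    generalize 1 - (q : ℂ) ^ ((k + 1) * τ) = s' at *
    field_simp
  refine mul_left_cancel₀ hne ?_
  simp only [mul_div_right_comm _ _ (qInf (q : ℂ) (((q : ℂ) ^ τ) ^ (_ + 1)))]
  rw [Finset.prod_mul_distrib (f := fun k =>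
    qInf (q : ℂ) ((q : ℂ) ^ τ) / qInf q (((q : ℂ) ^ τ) ^ (k + 1)))]
  set P₄ := ∏ k ∈ Finset.range (n + 1), (qInf (q : ℂ) (q * α₁ * b₁⁻¹ * (((q : ℂ) ^ τ) ^ k)⁻¹) *
        qInf q (q * α₁ * b₂⁻¹ * (((q : ℂ) ^ τ) ^ k)⁻¹) *
        qInf q (q * α₂ * b₁⁻¹ * (((q : ℂ) ^ τ) ^ k)⁻¹) *
        qInf q (q * α₂ * b₂⁻¹ * (((q : ℂ) ^ τ) ^ k)⁻¹))
  rw [← mul_assoc, hs, mul_assoc _ (ordIntegral _ _ _ _), hr]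
  linear_combination (((n + 1).factorial : ℂ) * P₄ *
    jacksonMoment q 0 0 b₁ b₂ x₁ x₂ 1 ^ (n + 1)) * hfac

end Constants

end AskeyEvans

theorem mainTheorem5 (q : ℝ) (hq0 : 0 < q) (hq1 : q < 1)
    (n : ℕ) (hn : 1 ≤ n) (τ : ℕ) (hτ : 1 ≤ τ)
    (a₁ a₂ b₁ b₂ : ℂ)
    (hconv : ∀ i ∈ Finset.Icc 1 n, q < ‖a₁ * a₂ * b₁ * b₂ * ((q : ℂ) ^ τ) ^ (2 * i - 2)‖)
    (x₁ x₂ : ℂ) (hx₁ : x₁ ≠ 0) (hx₂ : x₂ ≠ 0)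
    (h₁₁ : ∀ m : ℤ, x₁ * b₁ * (q : ℂ) ^ m ≠ 1) (h₁₂ : ∀ m : ℤ, x₁ * b₂ * (q : ℂ) ^ m ≠ 1)
    (h₂₁ : ∀ m : ℤ, x₂ * b₁ * (q : ℂ) ^ m ≠ 1) (h₂₂ : ∀ m : ℤ, x₂ * b₂ * (q : ℂ) ^ m ≠ 1) :
    (∀ y : Fin n → ℂ, (∀ i, y i = x₁ ∨ y i = x₂) →
      Summable fun ν : Fin n → ℤ =>
        ‖AskeyEvans.integrand q a₁ a₂ b₁ b₂ τ n (fun i => y i * (q : ℂ) ^ ν i) *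
          ∏ i, (y i * (q : ℂ) ^ ν i)‖) ∧
    1 / (n.factorial : ℂ) *
        AskeyEvans.jacksonIter q x₁ x₂ n (AskeyEvans.integrand q a₁ a₂ b₁ b₂ τ n) =
      AskeyEvans.C₀ q a₁ a₂ b₁ b₂ ((q : ℂ) ^ τ) n *
        ∏ j ∈ Finset.Icc 1 n,
          ((x₁ * x₂ * (q : ℂ) ^ ((j - 1) * τ)) ^ ((n - j) * τ) * x₂ *
              AskeyEvans.theta q (x₁ / x₂) *
              AskeyEvans.theta q (x₁ * x₂ * b₁ * b₂ * (q : ℂ) ^ ((n + j - 2) * τ))) /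
            (AskeyEvans.theta q (x₁ * b₁ * (q : ℂ) ^ ((j - 1) * τ)) *
              AskeyEvans.theta q (x₁ * b₂ * (q : ℂ) ^ ((j - 1) * τ)) *
              AskeyEvans.theta q (x₂ * b₁ * (q : ℂ) ^ ((j - 1) * τ)) *
              AskeyEvans.theta q (x₂ * b₂ * (q : ℂ) ^ ((j - 1) * τ))) := by
  obtain ⟨n, rfl⟩ := Nat.exists_eq_add_of_le' hn
  have hadm : AskeyEvans.Admissible q b₁ b₂ x₁ x₂ := ⟨hq0, hq1, hx₁, hx₂, h₁₁, h₁₂, h₂₁, h₂₂⟩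
  have hq := hadm.norm_lt_one
  have hqn : ‖(q : ℂ)‖ = q := by rw [Complex.norm_real, Real.norm_of_nonneg hq0.le]
  -- the strongest of the conditions is the last one
  have hlast := hconv (n + 1) (by simp)
  rw [show 2 * (n + 1) - 2 = 2 * n by omega, norm_mul, norm_pow, norm_pow, hqn] at hlast
  have hne : a₁ * a₂ * b₁ * b₂ ≠ 0 := by
    intro h0
    rw [h0, norm_zero, zero_mul] at hlast
    exact lt_asymm hq0 hlast
  have hb₂ : b₂ ≠ 0 := right_ne_zero_of_mul hne
  have hb₁ : b₁ ≠ 0 := right_ne_zero_of_mul (left_ne_zero_of_mul hne)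
  have ha₂ : a₂ ≠ 0 := right_ne_zero_of_mul (left_ne_zero_of_mul (left_ne_zero_of_mul hne))
  have ha₁ : a₁ ≠ 0 := left_ne_zero_of_mul (left_ne_zero_of_mul (left_ne_zero_of_mul hne))
  have hc : q ^ 2 * ‖a₁⁻¹‖ * ‖a₂⁻¹‖ < q ^ (2 * n * τ + 1) * ‖b₁‖ * ‖b₂‖ := by
    rw [norm_mul, norm_mul, norm_mul] at hlast
    have p₁ := norm_pos_iff.2 ha₁
    have p₂ := norm_pos_iff.2 ha₂
    rw [norm_inv, norm_inv, ← div_eq_mul_inv, ← div_eq_mul_inv, div_div, div_lt_iff₀ (by positivity)]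
    calc q ^ 2 = q * q := by ring
      _ < q * (‖a₁‖ * ‖a₂‖ * ‖b₁‖ * ‖b₂‖ * (q ^ τ) ^ (2 * n)) := by gcongr
      _ = _ := by rw [← pow_mul, mul_comm τ, pow_succ]; ring
  refine ⟨fun y hy => AskeyEvans.summable_integrand hadm (by simpa using hc) hy, ?_⟩
  have hjack := AskeyEvans.jacksonIter_integrand hadm (a₁ := a₁) (a₂ := a₂) (τ := τ) (n := n + 1)
    (by simpa using hc)
  have hsym := AskeyEvans.symIntegral_jacksonMoment hadm hb₁ hb₂ hτ n hc
  have hone := AskeyEvans.jacksonMoment_one_mul_theta hadm hb₁ hb₂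
  have hIcc : ∀ f : ℕ → ℂ, ∏ j ∈ Finset.Icc 1 (n + 1), f j =
      ∏ k ∈ Finset.range (n + 1), f (k + 1) := fun f => by
    rw [Finset.range_eq_Ico, Finset.prod_Ico_add' f 0 (n + 1) 1]
    rfl
  have i₁ : ∀ k, n + 1 - (k + 1) = n - k := fun k => by omega
  have i₂ : ∀ k, n + 1 + (k + 1) - 2 = n + k := fun k => by omega
  rw [AskeyEvans.C₀, hIcc, hIcc]
  simp only [Nat.add_sub_cancel, i₁, i₂]
  rw [AskeyEvans.prod_theta_shift hadm hb₁ hb₂ τ n, hjack]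
  have t₁ := AskeyEvans.Avoids.theta_ne_zero hq0 hq1 hx₁ hb₁ h₁₁
  have t₂ := AskeyEvans.Avoids.theta_ne_zero hq0 hq1 hx₁ hb₂ h₁₂
  have t₃ := AskeyEvans.Avoids.theta_ne_zero hq0 hq1 hx₂ hb₁ h₂₁
  have t₄ := AskeyEvans.Avoids.theta_ne_zero hq0 hq1 hx₂ hb₂ h₂₂
  have hJ := eq_div_of_mul_eq (mul_ne_zero (mul_ne_zero (mul_ne_zero t₁ t₂) t₃) t₄) hone
  set D := ∏ k ∈ Finset.range (n + 1), AskeyEvans.qInf q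
    (q * a₁⁻¹ * a₂⁻¹ * b₁⁻¹ * b₂⁻¹ * (((q : ℂ) ^ τ) ^ (n + k))⁻¹) with hD
  have hD0 : D ≠ 0 := by
    refine Finset.prod_ne_zero_iff.2 fun k hk => AskeyEvans.qInf_ne_zero_of_norm_lt_one hq ?_
    have hk' : n + k ≤ 2 * n := by have := Finset.mem_range.1 hk; omega
    have ht0 : (q : ℂ) ^ τ ≠ 0 := pow_ne_zero _ hadm.q_ne_zero
    rw [show (q : ℂ) * a₁⁻¹ * a₂⁻¹ * b₁⁻¹ * b₂⁻¹ * (((q : ℂ) ^ τ) ^ (n + k))⁻¹ =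
        q / (a₁ * a₂ * b₁ * b₂ * ((q : ℂ) ^ τ) ^ (n + k)) by field_simp,
      norm_div, hqn, div_lt_one (norm_pos_iff.2 (mul_ne_zero hne (pow_ne_zero _ ht0))),
      norm_mul, norm_pow, norm_pow, hqn]
    refine hlast.trans_le ?_
    have := pow_le_pow_of_le_one (pow_nonneg hq0.le τ) (pow_le_one₀ hq0.le hq1.le) hk'
    gcongr
  have hfac : ((n + 1).factorial : ℂ) ≠ 0 := Nat.cast_ne_zero.2 (Nat.factorial_ne_zero _)
  rw [eq_div_of_mul_eq hD0 hsym, hJ]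
  set V := AskeyEvans.theta q (x₁ * b₁) * AskeyEvans.theta q (x₁ * b₂) *
    AskeyEvans.theta q (x₂ * b₁) * AskeyEvans.theta q (x₂ * b₂)
  have hsplit : ∀ (c u : ℂ) (X Y Z : ℕ → ℂ),
      ∏ k ∈ Finset.range (n + 1), c * u * X k / (Y k * Z k) =
        c ^ (n + 1) * (∏ k ∈ Finset.range (n + 1), u * X k / Y k) /
          ∏ k ∈ Finset.range (n + 1), Z k := fun c u X Y Z => by
    simp only [Finset.prod_div_distrib, Finset.prod_mul_distrib, Finset.prod_const,
      Finset.card_range]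
    rw [← div_div, mul_assoc, mul_div_assoc]
  rw [hsplit, ← hD, mul_assoc (AskeyEvans.qInf (q : ℂ) q), mul_assoc (AskeyEvans.qInf (q : ℂ) q),
    mul_div_assoc (AskeyEvans.qInf (q : ℂ) q), mul_pow (AskeyEvans.qInf (q : ℂ) q)]
  have hcancel : ∀ N c a p r s : ℂ, N ≠ 0 →
      1 / N * (c * (N * p * r * (a * s) / D)) = c * (a * p / D) * (r * s) := fun N c a p r s hN => by
    field_simp
  exact hcancel _ _ _ _ _ _ hfac
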